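/- \textbf{Setting.} There are $n\ge 1$ treatment samples and $n'\ge 0$ control samples. Two nominal covariates $p=1,2$ assign to every sample a level in $\{1,\dots,k_p\}$. Let $L_{p,i}$ and $L'_{p,i}$ be the sets of treatment and of control samples with level $i$ of covariate $p$, let $\ell_{p,i}=|L_{p,i}|$, and let $u_{i_1,i_2}=|L_{1,i_1}\cap L_{2,i_2}|$ and $u'_{i_1,i_2}=|L'_{1,i_1}\cap L'_{2,i_2}|$. The 2-covariate maximum fine-balance selection problem (FBS) asks for a set $S$ of treatment samples and a set $S'$ of control samples with $|S\cap L_{p,i}|=|S'\cap L'_{p,i}|$ for all $p,i$ (fine balance) and with $|S|$ maximum. A pair $(S,S')$ is represented by its level-intersection sizes $x_{i_1,i_2}=|S\cap L_{1,i_1}\cap L_{2,i_2}|$ and $x'_{i_1,i_2}=|S'\cap L'_{1,i_1}\cap L'_{2,i_2}|$. \textbf{Network.} Let $N$ be the network with one node $(p,i)$ for every level of either covariate, all supplies and lower bounds $0$, and, for all $i_1,i_2$, an arc $(1,i_1)\to(2,i_2)$ of cost $-1$ and capacity $u_{i_1,i_2}$ and an arc $(2,i_2)\to(1,i_1)$ of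 cost $0$ and capacity $u'_{i_1,i_2}$. Let $N^{\rm rev}$ be $N$ after reversal of the arcs of cost $-1$: they become arcs $(2,i_2)\to(1,i_1)$ of cost $1$ and capacity $u_{i_1,i_2}$, node $(2,i_2)$ has supply $\ell_{2,i_2}$, and node $(1,i_1)$ has demand $\ell_{1,i_1}$. A flow $(\bar x,x')$ of $N^{\rm rev}$ corresponds to the flow $(u-\bar x,x')$ of $N$. \textbf{Theorem.} (a) FBS with two covariates is the minimum cost network flow problem on $N$ (the formulation holds for $n=0$ too): $(S,S')$ satisfies fine balance if and only if $(x,x')$ is a feasible flow of $N$; the cost of this flow is $-|S|$; every integral feasible flow of $N$ arises from some $(S,S')$; and $(S,S')$ is optimal for FBS if and only if $(x,x')$ is a minimum cost flow of $N$ (among all real-valued feasible flows). (b) This flow problem is solved by successive shortest paths in time $$O\bigl(n\cdot(\min\{n+n',\,k_1k_2\}+(k_1+k_2)\log(k_1+k_2))\bigr).$$ Precisely, there is one word-RAM program (with unit-cost addition, subtraction, comparison and indirect array access, and words of $O(\log(n+n'+k_1+k_2))$ bits) whose input is $k_1$, $k_2$ and, in any order, the list of the nonempty level-intersections of treatment samples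 and of control samples with their sizes $u_{i_1,i_2}$, $u'_{i_1,i_2}$. Its main loop starts from the zero flow of $N^{\rm rev}$. In each iteration it chooses a node $s$ with remaining excess supply and a node $t$ with unfulfilled demand, and sends along a shortest $s$-$t$ path of the residual network as much flow as the excess, the demand and the residual capacities allow. After at most $n$ iterations the flow is a minimum cost flow of $N^{\rm rev}$, and the program outputs the corresponding minimum cost flow of $N$, which consists of the level-intersection sizes of an optimal solution of FBS. The total number of steps is within the stated bound, with a constant that does not depend on the instance. -/

import Mathlib

namespace FineBalance

/-! ### Samples, fine balance, and the selection problem -/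

/-- `n` treatment samples and `n'` control samples, each carrying one of `k p` levels for every
covariate `p`. The level sets `{s | treat s p = i}` partition the treatment group, and similarly for
the control group; a level may be empty in either group. -/
structure Samples (P : ℕ) (k : Fin P → ℕ) (n n' : ℕ) where
  treat : Fin n → (p : Fin P) → Fin (k p)
  control : Fin n' → (p : Fin P) → Fin (k p)

namespace Samples

/-- `κ`-fine-balance of the selections `S` (treatment) and `S'` (control):
`κ * |S ∩ L_{p,i}| = |S' ∩ L'_{p,i}|` for every covariate `p` and every level `i` of it. -/
def IsFineBalanced {P : ℕ} {k : Fin P → ℕ} {n n' : ℕ} (I : Samples P k n n') (κ : ℕ)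
    (S : Finset (Fin n)) (S' : Finset (Fin n')) : Prop :=
  ∀ (p : Fin P) (i : Fin (k p)),
    κ * (S.filter fun s => I.treat s p = i).card = (S'.filter fun s => I.control s p = i).card

/-- `(S, S')` is an optimal solution of the maximum `κ`-fine-balance selection problem. -/
def IsMaxSelection {P : ℕ} {k : Fin P → ℕ} {n n' : ℕ} (I : Samples P k n n') (κ : ℕ)
    (S : Finset (Fin n)) (S' : Finset (Fin n')) : Prop :=
  I.IsFineBalanced κ S S' ∧
    ∀ (R : Finset (Fin n)) (R' : Finset (Fin n')), I.IsFineBalanced κ R R' → R.card ≤ S.card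

variable {k : Fin 2 → ℕ} {n n' : ℕ}

/-- With two covariates: the level-intersection of a treatment sample. -/
def treatCell (I : Samples 2 k n n') (s : Fin n) : Fin (k 0) × Fin (k 1) :=
  (I.treat s 0, I.treat s 1)

/-- With two covariates: the level-intersection of a control sample. -/
def controlCell (I : Samples 2 k n n') (s : Fin n') : Fin (k 0) × Fin (k 1) :=
  (I.control s 0, I.control s 1)

/-- `u_{i₁,i₂}`: number of treatment samples in a level-intersection. -/
def treatCount (I : Samples 2 k n n') (q : Fin (k 0) × Fin (k 1)) : ℕ :=
  (Finset.univ.filter fun s => I.treatCell s = q).card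

/-- `u'_{i₁,i₂}`: number of control samples in a level-intersection. -/
def controlCount (I : Samples 2 k n n') (q : Fin (k 0) × Fin (k 1)) : ℕ :=
  (Finset.univ.filter fun s => I.controlCell s = q).card

/-- `ℓ_{p,i}`: number of treatment samples in level `i` of covariate `p`. -/
def levelSize (I : Samples 2 k n n') (p : Fin 2) (i : Fin (k p)) : ℕ :=
  (Finset.univ.filter fun s => I.treat s p = i).card

end Samples

/-! ### Minimum cost network flow -/

/-- An instance of minimum cost network flow, with integer data; parallel arcs are allowed. -/
structure FlowNetwork (V A : Type) where
  tail : A → V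
  head : A → V
  cost : A → ℤ
  lower : A → ℤ
  upper : A → ℤ
  supply : V → ℤ

namespace FlowNetwork

variable {V A : Type} [DecidableEq V] [Fintype A] [DecidableEq A]

/-- Flow balance (outflow minus inflow equals supply at every node) and capacity constraints. -/
def IsFeasible (N : FlowNetwork V A) (x : A → ℝ) : Prop :=
  (∀ v, (∑ a with N.tail a = v, x a) - (∑ a with N.head a = v, x a) = N.supply v) ∧
    ∀ a, (N.lower a : ℝ) ≤ x a ∧ x a ≤ N.upper a

/-- The objective `∑ c_a x_a`. -/
def totalCost (N : FlowNetwork V A) (x : A → ℝ) : ℝ := ∑ a, (N.cost a : ℝ) * x a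

/-- Optimal solutions of the minimum cost flow linear program. -/
def IsMinCostFlow (N : FlowNetwork V A) (x : A → ℝ) : Prop :=
  N.IsFeasible x ∧ ∀ y, N.IsFeasible y → N.totalCost x ≤ N.totalCost y

/-- Supply of `v` not yet sent on (negative: unfulfilled demand). -/
def excess (N : FlowNetwork V A) (x : A → ℤ) (v : V) : ℤ :=
  N.supply v + (∑ a with N.head a = v, x a) - (∑ a with N.tail a = v, x a)

/-- Residual arcs are pairs `(a, forward?)`: `(a, true)` is `a` itself, `(a, false)` its reverse. -/
def resTail (N : FlowNetwork V A) : A × Bool → V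
  | (a, true) => N.tail a
  | (a, false) => N.head a

/-- Head of a residual arc. -/
def resHead (N : FlowNetwork V A) : A × Bool → V
  | (a, true) => N.head a
  | (a, false) => N.tail a

/-- Cost of a residual arc. -/
def resCost (N : FlowNetwork V A) : A × Bool → ℤ
  | (a, true) => N.cost a
  | (a, false) => -N.cost a

/-- Residual capacity; the residual network has the arcs where it is positive. -/
def resCap (N : FlowNetwork V A) (x : A → ℤ) : A × Bool → ℤ
  | (a, true) => N.upper a - x a
  | (a, false) => x a - N.lower a

/-- `p` is the list of arcs of a walk from `s` to `t` in the residual network of `x`. -/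
def IsResWalk (N : FlowNetwork V A) (x : A → ℤ) : V → List (A × Bool) → V → Prop
  | s, [], t => s = t
  | s, e :: p, t => N.resTail e = s ∧ 0 < N.resCap x e ∧ N.IsResWalk x (N.resHead e) p t

/-- `p` is a path (a walk visiting no node twice) from `s` to `t` in the residual network of `x`. -/
def IsResPath (N : FlowNetwork V A) (x : A → ℤ) (s : V) (p : List (A × Bool)) (t : V) : Prop :=
  N.IsResWalk x s p t ∧ (s :: p.map N.resHead).Nodup

/-- Cost of a path. -/
def pathCost (N : FlowNetwork V A) (p : List (A × Bool)) : ℤ := (p.map N.resCost).sum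

/-- `p` is a shortest path from `s` to `t` in the residual network of `x`. -/
def IsShortestResPath (N : FlowNetwork V A) (x : A → ℤ) (s : V) (p : List (A × Bool)) (t : V) :
    Prop :=
  N.IsResPath x s p t ∧ ∀ r, N.IsResPath x s r t → N.pathCost p ≤ N.pathCost r

/-- The flow `x` after sending `δ` units along the path `p`. -/
def augment (x : A → ℤ) (p : List (A × Bool)) (δ : ℤ) (a : A) : ℤ :=
  x a + (if (a, true) ∈ p then δ else 0) - (if (a, false) ∈ p then δ else 0)

/-- One iteration of the successive shortest path algorithm turns `x` into `y`: choose a node `s`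
with excess supply and a node `t` with unfulfilled demand, and send as much flow as the excess, the
demand and the residual capacities allow along a shortest `s`-`t` path of the residual network. -/
def SSPStep (N : FlowNetwork V A) (x y : A → ℤ) : Prop :=
  ∃ (s t : V) (p : List (A × Bool)) (δ : ℤ),
    0 < N.excess x s ∧ N.excess x t < 0 ∧ N.IsShortestResPath x s p t ∧
    IsGreatest {d : ℤ | d ≤ N.excess x s ∧ d ≤ -N.excess x t ∧ ∀ e ∈ p, d ≤ N.resCap x e} δ ∧
    y = augment x p δ

end FlowNetwork

/-! ### The networks on the level nodes of the two covariates -/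

namespace Samples

variable {k : Fin 2 → ℕ} {n n' : ℕ}

/-- One node for every level of either covariate. -/
abbrev Node (k : Fin 2 → ℕ) : Type := Fin (k 0) ⊕ Fin (k 1)

/-- For every pair of levels one treatment arc (`inl`) and one control arc (`inr`). -/
abbrev Arc (k : Fin 2 → ℕ) : Type := (Fin (k 0) × Fin (k 1)) ⊕ (Fin (k 0) × Fin (k 1))

/-- The network for fine-balance selection: a treatment arc goes from `i₁` to `i₂`, with cost `-1`
and capacity `u_{i₁,i₂}`; a control arc goes from `i₂` to `i₁`, with cost `0` and capacity
`u'_{i₁,i₂}`. All lower bounds and all supplies are `0`. -/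
def network (I : Samples 2 k n n') : FlowNetwork (Node k) (Arc k) where
  tail := Sum.elim (fun q => Sum.inl q.1) (fun q => Sum.inr q.2)
  head := Sum.elim (fun q => Sum.inr q.2) (fun q => Sum.inl q.1)
  cost := Sum.elim (fun _ => -1) (fun _ => 0)
  lower := fun _ => 0
  upper := Sum.elim (fun q => I.treatCount q) (fun q => I.controlCount q)
  supply := fun _ => 0

/-- The network after reversal of the treatment arcs: these now go from `i₂` to `i₁`, with cost `1`,
level `i₁` of the first covariate has demand `ℓ_{1,i₁}`, and level `i₂` of the second covariate has
supply `ℓ_{2,i₂}`. -/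
def reversedNetwork (I : Samples 2 k n n') : FlowNetwork (Node k) (Arc k) where
  tail := Sum.elim (fun q => Sum.inr q.2) (fun q => Sum.inr q.2)
  head := Sum.elim (fun q => Sum.inl q.1) (fun q => Sum.inl q.1)
  cost := Sum.elim (fun _ => 1) (fun _ => 0)
  lower := fun _ => 0
  upper := Sum.elim (fun q => I.treatCount q) (fun q => I.controlCount q)
  supply := Sum.elim (fun i => -(I.levelSize 0 i : ℤ)) (fun i => (I.levelSize 1 i : ℤ))

/-- Flow in `network` that corresponds to a flow in `reversedNetwork`. -/
def unreverse (I : Samples 2 k n n') (x : Arc k → ℤ) : Arc k → ℤ :=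
  Sum.elim (fun q => I.treatCount q - x (Sum.inl q)) (fun q => x (Sum.inr q))

/-- The level-intersection sizes of a pair of selections, as a vector indexed by the arcs. -/
def selectionFlow (I : Samples 2 k n n') (S : Finset (Fin n)) (S' : Finset (Fin n')) :
    Arc k → ℤ :=
  Sum.elim (fun q => ((S.filter fun s => I.treatCell s = q).card : ℤ))
    (fun q => ((S'.filter fun s => I.controlCell s = q).card : ℤ))

end Samples

/-! ### A word RAM with a step count -/

/-- Memory: integer registers, and integer arrays with static names. A program mentions only
finitely many registers and arrays. -/
structure Memory where
  reg : ℕ → ℤ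
  arr : ℕ → ℤ → ℤ

/-- Elementary instructions. -/
inductive Instr : Type
  /-- `x := c` -/
  | const (x : ℕ) (c : ℤ)
  /-- `x := y` -/
  | move (x y : ℕ)
  /-- `x := y + z` -/
  | add (x y z : ℕ)
  /-- `x := y - z` -/
  | sub (x y z : ℕ)
  /-- `x := a[y]` -/
  | load (x a y : ℕ)
  /-- `a[x] := y` -/
  | store (a x y : ℕ)

/-- The value an instruction writes. -/
def Instr.value (σ : Memory) : Instr → ℤ
  | .const _ c => c
  | .move _ y => σ.reg y
  | .add _ y z => σ.reg y + σ.reg z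
  | .sub _ y z => σ.reg y - σ.reg z
  | .load _ a y => σ.arr a (σ.reg y)
  | .store _ _ y => σ.reg y

/-- Write `v` to register `x`. -/
def Memory.setReg (σ : Memory) (x : ℕ) (v : ℤ) : Memory :=
  ⟨Function.update σ.reg x v, σ.arr⟩

/-- Write `v` to cell `i` of array `a`. -/
def Memory.setArr (σ : Memory) (a : ℕ) (i v : ℤ) : Memory :=
  ⟨σ.reg, Function.update σ.arr a (Function.update (σ.arr a) i v)⟩

/-- The memory after an instruction. -/
def Instr.apply (σ : Memory) : Instr → Memory
  | .const x c => σ.setReg x (Instr.value σ (.const x c))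
  | .move x y => σ.setReg x (Instr.value σ (.move x y))
  | .add x y z => σ.setReg x (Instr.value σ (.add x y z))
  | .sub x y z => σ.setReg x (Instr.value σ (.sub x y z))
  | .load x a y => σ.setReg x (Instr.value σ (.load x a y))
  | .store a x y => σ.setArr a (σ.reg x) (Instr.value σ (.store a x y))

/-- The only test: is register `x` at most register `y`? -/
structure Test where
  x : ℕ
  y : ℕ

/-- Outcome of a test. -/
def Test.Holds (b : Test) (σ : Memory) : Prop := σ.reg b.x ≤ σ.reg b.y

/-- Programs. -/
inductive Program : Type
  | skip
  | instr (i : Instr)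
  | seq (p q : Program)
  | cond (b : Test) (p q : Program)
  | loop (b : Test) (p : Program)

/-- `Exec W p σ σ' t`: with words restricted to integers of absolute value at most `W`, the program
`p`, started in memory `σ`, halts in memory `σ'` after `t` steps. Each instruction and each
evaluation of a test is one step. A program that writes a value exceeding the word bound has no
execution. -/
inductive Exec (W : ℤ) : Program → Memory → Memory → ℕ → Prop
  | skip (σ : Memory) : Exec W .skip σ σ 0
  | instr (i : Instr) (σ : Memory) (h : |i.value σ| ≤ W) : Exec W (.instr i) σ (i.apply σ) 1
  | seq {p q : Program} {σ₁ σ₂ σ₃ : Memory} {t₁ t₂ : ℕ}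
      (h₁ : Exec W p σ₁ σ₂ t₁) (h₂ : Exec W q σ₂ σ₃ t₂) : Exec W (.seq p q) σ₁ σ₃ (t₁ + t₂)
  | condTrue {b : Test} {p q : Program} {σ₁ σ₂ : Memory} {t : ℕ}
      (hb : b.Holds σ₁) (h : Exec W p σ₁ σ₂ t) : Exec W (.cond b p q) σ₁ σ₂ (1 + t)
  | condFalse {b : Test} {p q : Program} {σ₁ σ₂ : Memory} {t : ℕ}
      (hb : ¬ b.Holds σ₁) (h : Exec W q σ₁ σ₂ t) : Exec W (.cond b p q) σ₁ σ₂ (1 + t)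
  | loopFalse {b : Test} {p : Program} {σ : Memory} (hb : ¬ b.Holds σ) : Exec W (.loop b p) σ σ 1
  | loopTrue {b : Test} {p : Program} {σ₁ σ₂ σ₃ : Memory} {t₁ t₂ : ℕ}
      (hb : b.Holds σ₁) (h₁ : Exec W p σ₁ σ₂ t₁) (h₂ : Exec W (.loop b p) σ₂ σ₃ t₂) :
      Exec W (.loop b p) σ₁ σ₃ (1 + t₁ + t₂)

/-! ### Input and output of the flow problem -/

/-- An array holding a list from index `0` on, and `0` elsewhere. -/
def listArray (l : List ℤ) (i : ℤ) : ℤ := if 0 ≤ i then l.getD i.toNat 0 else 0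

/-- `l` lists, in some order and without repetition, the pairs of positive capacity `c`. -/
def IsListing {Q : Type} (c : Q → ℕ) (l : List Q) : Prop := l.Nodup ∧ ∀ q, q ∈ l ↔ 0 < c q

/-- Array `a` of `σ` holds the vector `x`, whose nonzero entries are among those listed in `l`. -/
def HoldsVector {Q : Type} (σ : Memory) (a : ℕ) (l : List Q) (x : Q → ℤ) : Prop :=
  (∀ j (h : j < l.length), σ.arr a (j : ℤ) = x l[j]) ∧ ∀ q, q ∉ l → x q = 0

namespace Samples

variable {k : Fin 2 → ℕ} {n n' : ℕ}

/-- The input: registers `0`-`3` hold `k₁`, `k₂` and the numbers of treatment and of control arcs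
with positive capacity; arrays `0`-`2` list the first level, the second level and the capacity of
these treatment arcs, arrays `3`-`5` the same of the control arcs. All other cells are `0`. -/
def input (I : Samples 2 k n n') (l l' : List (Fin (k 0) × Fin (k 1))) : Memory where
  reg
    | 0 => k 0
    | 1 => k 1
    | 2 => l.length
    | 3 => l'.length
    | _ => 0
  arr
    | 0 => listArray (l.map fun q => (q.1 : ℤ))
    | 1 => listArray (l.map fun q => (q.2 : ℤ))
    | 2 => listArray (l.map fun q => (I.treatCount q : ℤ))
    | 3 => listArray (l'.map fun q => (q.1 : ℤ))
    | 4 => listArray (l'.map fun q => (q.2 : ℤ))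
    | 5 => listArray (l'.map fun q => (I.controlCount q : ℤ))
    | _ => fun _ => 0

/-- Arrays `a` and `a'` of `σ` hold the flow `x` on the treatment and on the control arcs. -/
def HoldsFlow (l l' : List (Fin (k 0) × Fin (k 1))) (σ : Memory) (a a' : ℕ) (x : Arc k → ℤ) :
    Prop :=
  HoldsVector σ a l (fun q => x (Sum.inl q)) ∧ HoldsVector σ a' l' (fun q => x (Sum.inr q))

end Samples

end FineBalance

open FineBalance

/-! Part (a). The arcs at a level node carry the level-intersection sizes of that level, so flow
conservation at the node is fine balance for the level, and the capacities hold automatically for a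
selection. Conversely, the level-intersections are disjoint, so every integral flow within the
capacities is realised by picking the prescribed number of samples in each of them. That a maximum
selection is optimal even among real-valued flows requires one integral minimum cost flow for
comparison (`Samples.isMaxSelection_iff`). The algorithm of part (b) supplies it; for `n = 0` it is
the zero flow.

Part (b) is the primal-dual form of successive shortest paths. Reversal makes all costs nonnegative,
so for the zero flow and zero potentials no residual arc has negative reduced cost; this is the
invariant `FlowNetwork.Slack`. A breadth first search starts from all nodes with excess and follows
residual arcs of reduced cost at most `0`, hence equal to `0`. If it reaches a node with demand, the
tree path is a shortest path, because potentials telescope along a walk (`pathCost_eq`,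
`le_pathCost`), and augmenting along it preserves the invariant. If it does not, the potentials of
all visited nodes are raised by `1`. Since costs and potentials are integers, this preserves the
invariant too.

The time bound rests on the Lagrangian: cost plus the sum of excess times potential. Under the
invariant it is at most the cost of any feasible flow (`Slack.lagrangian_le`), hence at most `n`,
the cost in the reversed network of the flow that corresponds to the zero flow. A raise increases it
by at least `1` (`lagrangian_raise`) and an augmentation leaves it unchanged (`lagrangian_augment`),
so there are at most `n` raises in the whole run. The remaining supply starts at `n` and drops with
every augmentation, so there are at most `n` of these as well. Every search ends in one or the
other, and it is linear in the number of listed arcs and nodes. No priority queue is needed; the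
logarithm in the bound only absorbs the number of nodes.

The bounded Lagrangian also forces the search to reach a node with demand eventually, and it bounds
the potentials, so that they fit into words. When no supply remains, all excesses vanish and weak
duality is tight, which gives optimality.

Programs are treated by total correctness with step counts (`WP`). The loop rule `WP.loop` carries
an amount of prepaid time, which makes amortised accounts direct. `exists_run` joins the iterations,
and `Samples.exists_program_run` adds set-up and output. -/

namespace FineBalance

/-! ### Reasoning about runs -/

/-- `p` halts from `σ`, and the final memory and the step count satisfy `Q`. -/
def WP (W : ℤ) (p : Program) (σ : Memory) (Q : Memory → ℕ → Prop) : Prop :=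
  ∃ σ' t, Exec W p σ σ' t ∧ Q σ' t

/-- A straight-line program. -/
def block : List Instr → Program
  | [] => .skip
  | i :: is => .seq (.instr i) (block is)

/-- Registers written by a program. -/
def Program.regs : Program → List ℕ
  | .skip => []
  | .instr (.const x _) => [x]
  | .instr (.move x _) => [x]
  | .instr (.add x _ _) => [x]
  | .instr (.sub x _ _) => [x]
  | .instr (.load x _ _) => [x]
  | .instr (.store _ _ _) => []
  | .seq p q => p.regs ++ q.regs
  | .cond _ p q => p.regs ++ q.regs
  | .loop _ p => p.regs

/-- Arrays written by a program. -/
def Program.arrs : Program → List ℕ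
  | .skip => []
  | .instr (.store a _ _) => [a]
  | .instr _ => []
  | .seq p q => p.arrs ++ q.arrs
  | .cond _ p q => p.arrs ++ q.arrs
  | .loop _ p => p.arrs

/-- `σ'` differs from `σ` only in registers and arrays that `p` writes. -/
structure Frame (p : Program) (σ σ' : Memory) : Prop where
  reg : ∀ r, r ∉ p.regs → σ'.reg r = σ.reg r
  arr : ∀ a, a ∉ p.arrs → σ'.arr a = σ.arr a

theorem Frame.refl (p : Program) (σ : Memory) : Frame p σ σ := ⟨fun _ _ => rfl, fun _ _ => rfl⟩

theorem Frame.trans {p : Program} {σ₁ σ₂ σ₃ : Memory} (h : Frame p σ₁ σ₂) (h' : Frame p σ₂ σ₃) :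
    Frame p σ₁ σ₃ :=
  ⟨fun r hr => (h'.reg r hr).trans (h.reg r hr), fun a ha => (h'.arr a ha).trans (h.arr a ha)⟩

/-- This lets later invariants mention only what changes: for the concrete programs, that a register
or array is not written is settled by `decide` or `simp`. -/
theorem Exec.frame {W : ℤ} {p : Program} {σ σ' : Memory} {t : ℕ} (h : Exec W p σ σ' t) :
    Frame p σ σ' := by
  induction h with
  | skip σ => exact Frame.refl _ _
  | instr i σ h =>
    constructor
    · intro r hr
      cases i <;> simp_all [Program.regs, Instr.apply, Memory.setReg, Memory.setArr]
    · intro r hr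
      cases i <;> simp_all [Program.arrs, Instr.apply, Memory.setReg, Memory.setArr]
  | seq _ _ h1 h2 =>
    constructor
    · intro r hr
      simp only [Program.regs, List.mem_append, not_or] at hr
      exact (h2.reg r hr.2).trans (h1.reg r hr.1)
    · intro r hr
      simp only [Program.arrs, List.mem_append, not_or] at hr
      exact (h2.arr r hr.2).trans (h1.arr r hr.1)
  | condTrue _ _ h1 =>
    constructor
    · intro r hr
      simp only [Program.regs, List.mem_append, not_or] at hr
      exact h1.reg r hr.1
    · intro r hr
      simp only [Program.arrs, List.mem_append, not_or] at hr
      exact h1.arr r hr.1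
  | condFalse _ _ h1 =>
    constructor
    · intro r hr
      simp only [Program.regs, List.mem_append, not_or] at hr
      exact h1.reg r hr.2
    · intro r hr
      simp only [Program.arrs, List.mem_append, not_or] at hr
      exact h1.arr r hr.2
  | loopFalse _ => exact Frame.refl _ _
  | loopTrue _ _ _ h1 h2 =>
    exact Frame.trans ⟨fun r hr => h1.reg r hr, fun r hr => h1.arr r hr⟩ h2

theorem WP.mono {W : ℤ} {p : Program} {σ : Memory} {Q Q' : Memory → ℕ → Prop} (h : WP W p σ Q)
    (hQ : ∀ σ' t, Frame p σ σ' → Q σ' t → Q' σ' t) : WP W p σ Q' := by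
  obtain ⟨σ', t, he, hq⟩ := h
  exact ⟨σ', t, he, hQ _ _ he.frame hq⟩

theorem WP.skip {W : ℤ} {σ : Memory} {Q : Memory → ℕ → Prop} (h : Q σ 0) : WP W .skip σ Q :=
  ⟨σ, 0, .skip σ, h⟩

theorem WP.seq {W : ℤ} {p q : Program} {σ : Memory} {Q : Memory → ℕ → Prop}
    (h : WP W p σ fun σ' t => WP W q σ' fun σ'' t' => Q σ'' (t + t')) :
    WP W (.seq p q) σ Q := by
  obtain ⟨σ', t, he, σ'', t', he', hq⟩ := h
  exact ⟨σ'', t + t', .seq he he', hq⟩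

theorem WP.cond {W : ℤ} {b : Test} {p q : Program} {σ : Memory} {Q : Memory → ℕ → Prop}
    (hp : σ.reg b.x ≤ σ.reg b.y → WP W p σ fun σ' t => Q σ' (1 + t))
    (hq : σ.reg b.y < σ.reg b.x → WP W q σ fun σ' t => Q σ' (1 + t)) : WP W (.cond b p q) σ Q := by
  by_cases hb : b.Holds σ
  · obtain ⟨σ', t, he, h⟩ := hp hb
    exact ⟨σ', 1 + t, .condTrue hb he, h⟩
  · obtain ⟨σ', t, he, h⟩ := hq (not_le.1 hb)
    exact ⟨σ', 1 + t, .condFalse hb he, h⟩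

theorem WP.nil {W : ℤ} {σ : Memory} {Q : Memory → ℕ → Prop} (h : Q σ 0) : WP W (block []) σ Q :=
  ⟨σ, 0, .skip σ, h⟩

theorem WP.const {W : ℤ} {x : ℕ} {c : ℤ} {is : List Instr} {σ : Memory} {Q : Memory → ℕ → Prop}
    (hv : |c| ≤ W) (h : WP W (block is) (σ.setReg x c) fun σ' t => Q σ' (1 + t)) :
    WP W (block (.const x c :: is)) σ Q :=
  WP.seq ⟨_, 1, .instr (.const x c) σ hv, h⟩

theorem WP.move {W : ℤ} {x y : ℕ} {is : List Instr} {σ : Memory} {Q : Memory → ℕ → Prop}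
    (hv : |σ.reg y| ≤ W)
    (h : WP W (block is) (σ.setReg x (σ.reg y)) fun σ' t => Q σ' (1 + t)) :
    WP W (block (.move x y :: is)) σ Q :=
  WP.seq ⟨_, 1, .instr (.move x y) σ hv, h⟩

theorem WP.add {W : ℤ} {x y z : ℕ} {is : List Instr} {σ : Memory} {Q : Memory → ℕ → Prop}
    (hv : |σ.reg y + σ.reg z| ≤ W)
    (h : WP W (block is) (σ.setReg x (σ.reg y + σ.reg z)) fun σ' t => Q σ' (1 + t)) :
    WP W (block (.add x y z :: is)) σ Q :=
  WP.seq ⟨_, 1, .instr (.add x y z) σ hv, h⟩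

theorem WP.sub {W : ℤ} {x y z : ℕ} {is : List Instr} {σ : Memory} {Q : Memory → ℕ → Prop}
    (hv : |σ.reg y - σ.reg z| ≤ W)
    (h : WP W (block is) (σ.setReg x (σ.reg y - σ.reg z)) fun σ' t => Q σ' (1 + t)) :
    WP W (block (.sub x y z :: is)) σ Q :=
  WP.seq ⟨_, 1, .instr (.sub x y z) σ hv, h⟩

theorem WP.load {W : ℤ} {x a y : ℕ} {is : List Instr} {σ : Memory} {Q : Memory → ℕ → Prop}
    (hv : |σ.arr a (σ.reg y)| ≤ W)
    (h : WP W (block is) (σ.setReg x (σ.arr a (σ.reg y))) fun σ' t => Q σ' (1 + t)) :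
    WP W (block (.load x a y :: is)) σ Q :=
  WP.seq ⟨_, 1, .instr (.load x a y) σ hv, h⟩

theorem WP.store {W : ℤ} {a x y : ℕ} {is : List Instr} {σ : Memory} {Q : Memory → ℕ → Prop}
    (hv : |σ.reg y| ≤ W)
    (h : WP W (block is) (σ.setArr a (σ.reg x) (σ.reg y)) fun σ' t => Q σ' (1 + t)) :
    WP W (block (.store a x y :: is)) σ Q :=
  WP.seq ⟨_, 1, .instr (.store a x y) σ hv, h⟩

/-- Total correctness of a loop, with an amount `φ` of time that is set aside and pays for it. -/
theorem WP.loop {W : ℤ} {b : Test} {p : Program} {σ : Memory} (Inv : ℕ → Memory → Prop) (φ : ℕ)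
    (h0 : Inv φ σ)
    (hs : ∀ φ σ₁, Frame p σ σ₁ → Inv φ σ₁ → σ₁.reg b.x ≤ σ₁.reg b.y →
      WP W p σ₁ fun σ₂ t => ∃ φ', Inv φ' σ₂ ∧ φ' + t + 1 ≤ φ) :
    WP W (.loop b p) σ fun σ' t =>
      ∃ φ', Inv φ' σ' ∧ σ'.reg b.y < σ'.reg b.x ∧ φ' + t ≤ φ + 1 := by
  -- Each round consumes at least one unit of the prepaid time, so induction on a bound for it
  -- proves termination. The extra `1` in `φ + 1` pays for the test that fails.
  suffices h : ∀ n φ σ₁, φ ≤ n → Frame p σ σ₁ → Inv φ σ₁ → WP W (.loop b p) σ₁ fun σ' t =>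
      ∃ φ', Inv φ' σ' ∧ σ'.reg b.y < σ'.reg b.x ∧ φ' + t ≤ φ + 1 from
    h φ φ σ le_rfl (Frame.refl _ _) h0
  intro n
  induction n with
  | zero =>
    intro φ σ₁ hφ hf hi
    by_cases hb : b.Holds σ₁
    · obtain ⟨σ₂, t, -, φ', -, h⟩ := hs φ σ₁ hf hi hb
      omega
    · exact ⟨σ₁, 1, .loopFalse hb, φ, hi, not_le.1 hb, le_rfl⟩
  | succ n ih =>
    intro φ σ₁ hφ hf hi
    by_cases hb : b.Holds σ₁
    · obtain ⟨σ₂, t, he, φ', hi', h⟩ := hs φ σ₁ hf hi hb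
      obtain ⟨σ₃, t', he', φ'', hi'', hb', h'⟩ :=
        ih φ' σ₂ (by omega) (hf.trans ⟨he.frame.reg, he.frame.arr⟩) hi'
      exact ⟨σ₃, 1 + t + t', .loopTrue hb he he', φ'', hi'', hb', by omega⟩
    · exact ⟨σ₁, 1, .loopFalse hb, φ, hi, not_le.1 hb, le_rfl⟩

theorem Memory.reg_setReg (σ : Memory) (x y : ℕ) (v : ℤ) :
    (σ.setReg x v).reg y = if y = x then v else σ.reg y := by
  simp [Memory.setReg, Function.update_apply]

theorem Memory.arr_setReg (σ : Memory) (x : ℕ) (v : ℤ) : (σ.setReg x v).arr = σ.arr := rfl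

theorem Memory.reg_setArr (σ : Memory) (a : ℕ) (i v : ℤ) : (σ.setArr a i v).reg = σ.reg := rfl

theorem Memory.arr_setArr (σ : Memory) (a b : ℕ) (i v : ℤ) :
    (σ.setArr a i v).arr b = if b = a then Function.update (σ.arr a) i v else σ.arr b := by
  by_cases h : b = a
  · subst h
    simp [Memory.setArr]
  · simp [Memory.setArr, h]

/-- The main theorem exposes the memory before every iteration, so iterations are kept as explicit
sequences and assembled into one run of the loop only at the end. The final `1` is the exit test. -/
theorem exec_loop_of_seq {W : ℤ} {b : Test} {p : Program} (m : ℕ) :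
    ∀ (σ : ℕ → Memory) (t : ℕ → ℕ), (∀ j < m, b.Holds (σ j) ∧ Exec W p (σ j) (σ (j + 1)) (t j)) →
      ¬ b.Holds (σ m) → Exec W (.loop b p) (σ 0) (σ m) (∑ j ∈ Finset.range m, (1 + t j) + 1) := by
  induction m with
  | zero =>
    intro σ t _ h
    simpa using Exec.loopFalse h
  | succ m ih =>
    intro σ t hs h
    have h1 := ih (fun j => σ (j + 1)) (fun j => t (j + 1)) (fun j hj => hs (j + 1) (by omega)) h
    have h2 := Exec.loopTrue (hs 0 (by omega)).1 (hs 0 (by omega)).2 h1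
    rw [Finset.sum_range_succ']
    convert h2 using 1
    ring

section

attribute [simp] Memory.reg_setReg Memory.arr_setReg Memory.reg_setArr Memory.arr_setArr

/-! ### The search -/

/-- A graph given by its arcs `0, …, H - 1` on the nodes `0, …, K - 1`, with linked lists of the
arcs that leave a node. The number `B` bounds the data. -/
structure Graph where
  K : ℤ
  H : ℤ
  B : ℤ
  frm : ℤ → ℤ
  tgt : ℤ → ℤ
  cst : ℤ → ℤ
  rv : ℤ → ℤ
  nxt : ℤ → ℤ
  hd : ℤ → ℤ

namespace Graph

/-- The lists of leaving arcs are in decreasing order, and complete. -/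
structure WF (G : Graph) : Prop where
  K_nonneg : 0 ≤ G.K
  H_nonneg : 0 ≤ G.H
  one_le_B : 3 ≤ G.B
  K_le : G.K ≤ G.B
  H_le : G.H ≤ 2 * G.B
  frm_nonneg : ∀ h, 0 ≤ h → h < G.H → 0 ≤ G.frm h
  frm_lt : ∀ h, 0 ≤ h → h < G.H → G.frm h < G.K
  tgt_nonneg : ∀ h, 0 ≤ h → h < G.H → 0 ≤ G.tgt h
  tgt_lt : ∀ h, 0 ≤ h → h < G.H → G.tgt h < G.K
  cst_ge : ∀ h, 0 ≤ h → h < G.H → -1 ≤ G.cst h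
  cst_le : ∀ h, 0 ≤ h → h < G.H → G.cst h ≤ 1
  rv_nonneg : ∀ h, 0 ≤ h → h < G.H → 0 ≤ G.rv h
  rv_lt : ∀ h, 0 ≤ h → h < G.H → G.rv h < G.H
  rv_rv : ∀ h, 0 ≤ h → h < G.H → G.rv (G.rv h) = h
  rv_ne : ∀ h, 0 ≤ h → h < G.H → G.rv h ≠ h
  nxt_ge : ∀ h, 0 ≤ h → h < G.H → -1 ≤ G.nxt h
  nxt_lt : ∀ h, 0 ≤ h → h < G.H → G.nxt h < h
  frm_nxt : ∀ h, 0 ≤ h → h < G.H → 0 ≤ G.nxt h → G.frm (G.nxt h) = G.frm h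
  le_nxt : ∀ h, 0 ≤ h → h < G.H → ∀ h', 0 ≤ h' → h' < h → G.frm h' = G.frm h → h' ≤ G.nxt h
  hd_ge : ∀ v, 0 ≤ v → v < G.K → -1 ≤ G.hd v
  hd_lt : ∀ v, 0 ≤ v → v < G.K → G.hd v < G.H
  frm_hd : ∀ v, 0 ≤ v → v < G.K → 0 ≤ G.hd v → G.frm (G.hd v) = v
  le_hd : ∀ v, 0 ≤ v → v < G.K → ∀ h, 0 ≤ h → h < G.H → G.frm h = v → h ≤ G.hd v

/-- The memory holds the graph and some constants. -/
structure Mem (G : Graph) (σ : Memory) : Prop where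
  r4 : σ.reg 4 = G.K
  r7 : σ.reg 7 = 0
  r8 : σ.reg 8 = 1
  r9 : σ.reg 9 = -1
  a10 : σ.arr 10 = G.frm
  a11 : σ.arr 11 = G.tgt
  a12 : σ.arr 12 = G.cst
  a13 : σ.arr 13 = G.rv
  a14 : σ.arr 14 = G.nxt
  a15 : σ.arr 15 = G.hd

theorem Mem.frame {G : Graph} {p : Program} {σ σ' : Memory} (hm : G.Mem σ) (hf : Frame p σ σ')
    (hr : ∀ r ∈ [4, 7, 8, 9], r ∉ p.regs) (ha : ∀ a ∈ [10, 11, 12, 13, 14, 15], a ∉ p.arrs) :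
    G.Mem σ' where
  r4 := (hf.reg _ (hr _ (by simp))).trans hm.r4
  r7 := (hf.reg _ (hr _ (by simp))).trans hm.r7
  r8 := (hf.reg _ (hr _ (by simp))).trans hm.r8
  r9 := (hf.reg _ (hr _ (by simp))).trans hm.r9
  a10 := (hf.arr _ (ha _ (by simp))).trans hm.a10
  a11 := (hf.arr _ (ha _ (by simp))).trans hm.a11
  a12 := (hf.arr _ (ha _ (by simp))).trans hm.a12
  a13 := (hf.arr _ (ha _ (by simp))).trans hm.a13
  a14 := (hf.arr _ (ha _ (by simp))).trans hm.a14
  a15 := (hf.arr _ (ha _ (by simp))).trans hm.a15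

/-- Positions `1, …, n` of the queue `q` hold distinct nodes from `lo` on, and `pos` tells the
position of such a node, or is `0` if the node is not in the queue. -/
structure Queue (K lo n : ℤ) (pos q : ℤ → ℤ) : Prop where
  n_nonneg : 0 ≤ n
  pos_nonneg : ∀ v, lo ≤ v → v < K → 0 ≤ pos v
  pos_le : ∀ v, lo ≤ v → v < K → pos v ≤ n
  q_pos : ∀ v, lo ≤ v → v < K → 0 < pos v → q (pos v) = v
  q_ge : ∀ i, 0 < i → i ≤ n → lo ≤ q i
  q_lt : ∀ i, 0 < i → i ≤ n → q i < K
  pos_q : ∀ i, 0 < i → i ≤ n → pos (q i) = i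

/-- The map `q` is injective on the positions, since `pos` inverts it, and its values lie in an
interval with `K - lo` elements. -/
theorem Queue.le {K lo n : ℤ} {pos q : ℤ → ℤ} (h : Queue K lo n pos q) (hlo : lo ≤ K) :
    n ≤ K - lo := by
  have hc := Finset.card_le_card_of_injOn (s := Finset.Icc 1 n) (t := Finset.Ico lo K) q
    (fun i hi => by
      simp only [Finset.coe_Icc, Set.mem_Icc] at hi
      simp only [Finset.coe_Ico, Set.mem_Ico]
      exact ⟨h.q_ge i (by omega) (by omega), h.q_lt i (by omega) (by omega)⟩)
    (fun i hi j hj hij => by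
      simp only [Finset.coe_Icc, Set.mem_Icc] at hi hj
      rw [← h.pos_q i (by omega) (by omega), ← h.pos_q j (by omega) (by omega), hij])
  simp only [Int.card_Icc, Int.card_Ico] at hc
  have := h.n_nonneg
  omega

/-- Initialisation goes downward through the nodes. Below `lo` the array of positions may still hold
data of an earlier search, so only nodes from `lo` on are constrained. -/
theorem Queue.extend {K lo n : ℤ} {pos q : ℤ → ℤ} (h : Queue K (lo + 1) n pos q) :
    Queue K lo n (Function.update pos lo 0) q where
  n_nonneg := h.n_nonneg
  pos_nonneg v h1 h2 := by
    rw [Function.update_apply]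
    split_ifs with hv
    · rfl
    · exact h.pos_nonneg v (by omega) h2
  pos_le v h1 h2 := by
    rw [Function.update_apply]
    split_ifs with hv
    · exact h.n_nonneg
    · exact h.pos_le v (by omega) h2
  q_pos v h1 h2 := by
    rw [Function.update_apply]
    split_ifs with hv
    · simp
    · exact h.q_pos v (by omega) h2
  q_ge i h1 h2 := by
    have := h.q_ge i h1 h2
    omega
  q_lt i h1 h2 := h.q_lt i h1 h2
  pos_q i h1 h2 := by
    have := h.q_ge i h1 h2
    rw [Function.update_of_ne (by omega)]
    exact h.pos_q i h1 h2

theorem Queue.push {K lo n v : ℤ} {pos q : ℤ → ℤ} (h : Queue K lo n pos q) (hlo : lo ≤ v)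
    (hK : v < K) (hv : pos v = 0) :
    Queue K lo (n + 1) (Function.update pos v (n + 1)) (Function.update q (n + 1) v) where
  n_nonneg := by
    have := h.n_nonneg
    omega
  pos_nonneg w h1 h2 := by
    have := h.n_nonneg
    rw [Function.update_apply]
    split_ifs with hw
    · omega
    · exact h.pos_nonneg w h1 h2
  pos_le w h1 h2 := by
    rw [Function.update_apply]
    split_ifs with hw
    · exact le_rfl
    · have := h.pos_le w h1 h2
      omega
  q_pos w h1 h2 := by
    by_cases hw : w = v
    · simp [hw]
    · have := h.pos_le w h1 h2
      rw [Function.update_of_ne hw, Function.update_of_ne (by omega)]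
      exact h.q_pos w h1 h2
  q_ge i h1 h2 := by
    by_cases hi : i = n + 1
    · simpa [hi] using hlo
    · rw [Function.update_of_ne hi]
      exact h.q_ge i h1 (by omega)
  q_lt i h1 h2 := by
    by_cases hi : i = n + 1
    · simpa [hi] using hK
    · rw [Function.update_of_ne hi]
      exact h.q_lt i h1 (by omega)
  pos_q i h1 h2 := by
    by_cases hi : i = n + 1
    · simp [hi]
    · have := h.pos_q i h1 (by omega)
      rw [Function.update_of_ne hi, Function.update_of_ne, this]
      intro hq
      rw [hq] at this
      omega

/-- Put the nodes with positive excess into the queue. -/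
def initProg : Program :=
  .seq (block [.move 11 4, .const 12 0]) (.loop ⟨8, 11⟩ (.seq (block [.sub 11 11 8, .load 19 17 11])
    (.cond ⟨8, 19⟩ (block [.add 12 12 8, .store 19 11 12, .store 20 11 9, .store 21 12 11])
      (block [.store 19 11 7]))))

/-- The queue holds the nodes from `lo` on with positive excess. -/
structure Initial (K lo n : ℤ) (exc pos par q : ℤ → ℤ) : Prop where
  queue : Queue K lo n pos q
  pos_of_exc : ∀ v, lo ≤ v → v < K → 0 < exc v → 0 < pos v
  exc_of_pos : ∀ v, lo ≤ v → v < K → 0 < pos v → 0 < exc v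
  par_of_pos : ∀ v, lo ≤ v → v < K → 0 < pos v → par v = -1

theorem wp_initProg {W : ℤ} {G : Graph} (hG : G.WF) (hW : 27 * G.B ≤ W) {σ : Memory}
    (hm : G.Mem σ) {exc : ℤ → ℤ} (he : σ.arr 17 = exc)
    (hB : ∀ v, 0 ≤ v → v < G.K → |exc v| ≤ G.B) :
    WP W initProg σ fun σ' t =>
      Initial G.K 0 (σ'.reg 12) exc (σ'.arr 19) (σ'.arr 20) (σ'.arr 21) ∧
        t ≤ 10 * G.K.toNat + 3 := by
  have hK := hG.K_nonneg
  have hKB := hG.K_le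
  have hB1 := hG.one_le_B
  refine WP.seq (WP.move ?_ (WP.const ?_ (WP.nil ?_)))
  · rw [hm.r4, abs_le]; omega
  · simp; omega
  refine WP.mono (WP.loop (fun φ σ₁ => 0 ≤ σ₁.reg 11 ∧ σ₁.reg 11 ≤ G.K ∧
    φ = 10 * (σ₁.reg 11).toNat ∧
    Initial G.K (σ₁.reg 11) (σ₁.reg 12) exc (σ₁.arr 19) (σ₁.arr 20) (σ₁.arr 21))
    (10 * G.K.toNat) ?_ ?_) ?_
  · simp only [Memory.reg_setReg, hm.r4]
    refine ⟨by simpa using hK, by simp, by simp, ⟨⟨by simp, ?_, ?_, ?_, ?_, ?_, ?_⟩, ?_, ?_, ?_⟩⟩ <;>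
      simp <;> intros <;> omega
  · rintro φ σ₁ hf ⟨h1, h2, rfl, hi⟩ hb
    have e7 : σ₁.reg 7 = 0 := (hf.reg 7 (by decide)).trans (by simp [hm.r7])
    have e8 : σ₁.reg 8 = 1 := (hf.reg 8 (by decide)).trans (by simp [hm.r8])
    have e9 : σ₁.reg 9 = -1 := (hf.reg 9 (by decide)).trans (by simp [hm.r9])
    have e17 : σ₁.arr 17 = exc := (hf.arr 17 (by decide)).trans (by simp [he])
    simp only [e8] at hb
    obtain ⟨v, hv⟩ : ∃ v, σ₁.reg 11 = v + 1 := ⟨σ₁.reg 11 - 1, by ring⟩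
    rw [hv] at h1 h2 hb hi
    have hBv := abs_le.1 (hB v (by omega) (by omega))
    have hle := hi.queue.le (by omega)
    have hn := hi.queue.n_nonneg
    refine WP.seq (WP.sub ?_ (WP.load ?_ (WP.nil (WP.cond ?_ ?_))))
    · simp [hv, e8, abs_le]; omega
    · simp [hv, e8, e17, abs_le]; omega
    · simp only [Memory.reg_setReg, Memory.arr_setReg, hv, e8, e17]
      simp only [Nat.reduceEqDiff, if_true, if_false, add_sub_cancel_right]
      intro hev
      refine WP.add ?_ (WP.store ?_ (WP.store ?_ (WP.store ?_ (WP.nil ?_))))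
      · simp [e8, abs_le]; omega
      · simp [e8, abs_le]; omega
      · simp [e9]; omega
      · simp [e8, abs_le]; omega
      · refine ⟨10 * v.toNat, ?_, by omega⟩
        simp [e8, e9]
        refine ⟨by omega, by omega, ?_, ?_, ?_, ?_⟩
        -- The program writes the new position at once. The intermediate reset to `0` exists only in
        -- the proof, and `simp` merges the two updates.
        · have := hi.queue.extend.push le_rfl (by omega) (by simp)
          simpa using this
        · intro w hw1 hw2 hw3
          rw [Function.update_apply]
          split_ifs
          · omega
          · exact hi.pos_of_exc w (by omega) hw2 hw3
        · intro w hw1 hw2 hw3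
          rw [Function.update_apply] at hw3
          split_ifs at hw3 with h
          · subst h; omega
          · exact hi.exc_of_pos w (by omega) hw2 hw3
        · intro w hw1 hw2 hw3
          rw [Function.update_apply] at hw3 ⊢
          split_ifs at hw3 ⊢ with h
          · rfl
          · exact hi.par_of_pos w (by omega) hw2 hw3
    · simp only [Memory.reg_setReg, Memory.arr_setReg, hv, e8, e17]
      simp only [Nat.reduceEqDiff, if_true, if_false, add_sub_cancel_right]
      intro hev
      refine WP.store ?_ (WP.nil ?_)
      · simp [e7]; omega
      · refine ⟨10 * v.toNat, ?_, by omega⟩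
        simp [e7]
        refine ⟨by omega, by omega, hi.queue.extend, ?_, ?_, ?_⟩
        · intro w hw1 hw2 hw3
          rw [Function.update_apply]
          split_ifs with h
          · subst h; omega
          · exact hi.pos_of_exc w (by omega) hw2 hw3
        · intro w hw1 hw2 hw3
          rw [Function.update_apply] at hw3
          split_ifs at hw3 with h
          · omega
          exact hi.exc_of_pos w (by omega) hw2 hw3
        · intro w hw1 hw2 hw3
          rw [Function.update_apply] at hw3
          split_ifs at hw3 with h
          · omega
          exact hi.par_of_pos w (by omega) hw2 hw3
  · rintro σ' t hf ⟨φ', ⟨h1, h2, rfl, hi⟩, hb, ht⟩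
    have e8 : σ'.reg 8 = 1 := (hf.reg 8 (by decide)).trans (by simp [hm.r8])
    have h0 : σ'.reg 11 = 0 := by
      simp only [e8] at hb
      omega
    rw [h0] at hi
    exact ⟨hi, by omega⟩

/-- Residual arcs of reduced cost at most `0`. -/
def Adm (G : Graph) (cap pi : ℤ → ℤ) (h : ℤ) : Prop :=
  0 < cap h ∧ G.cst h - pi (G.frm h) + pi (G.tgt h) ≤ 0

/-- Every visited node is a root with positive excess, or has a tree arc from a node visited
earlier. -/
def Tree (G : Graph) (cap pi exc pos par : ℤ → ℤ) : Prop :=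
  ∀ v, 0 ≤ v → v < G.K → 0 < pos v → (par v = -1 ∧ 0 < exc v) ∨
    (0 ≤ par v ∧ par v < G.H ∧ G.tgt (par v) = v ∧ G.Adm cap pi (par v) ∧
      0 < pos (G.frm (par v)) ∧ pos (G.frm (par v)) < pos v)

/-- The state of the search when the nodes at positions below `qh` are scanned, where node `v` is
scanned down to its leaving arc `h`. -/
structure Searching (G : Graph) (cap pi exc : ℤ → ℤ) (qh n v h : ℤ) (pos par q : ℤ → ℤ) :
    Prop where
  queue : Queue G.K 0 n pos q
  roots : ∀ v, 0 ≤ v → v < G.K → 0 < exc v → 0 < pos v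
  tree : G.Tree cap pi exc pos par
  qh_pos : 0 < qh
  qh_le : qh ≤ n + 1
  closed : ∀ h', 0 ≤ h' → h' < G.H → 0 < pos (G.frm h') → pos (G.frm h') < qh →
    (G.frm h' = v → h < h') → G.Adm cap pi h' → 0 < pos (G.tgt h')

section

variable {G : Graph} {cap pi exc : ℤ → ℤ} {qh n v h : ℤ} {pos par q : ℤ → ℤ}

/-- For `qh = 1` no node counts as scanned, so the closure condition is empty, and the current node
`0` and arc `-1` are arbitrary. -/
theorem Initial.searching (hi : Initial G.K 0 n exc pos par q) :
    Searching G cap pi exc 1 n 0 (-1) pos par q where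
  queue := hi.queue
  roots := hi.pos_of_exc
  tree v h1 h2 h3 := Or.inl ⟨hi.par_of_pos v h1 h2 h3, hi.exc_of_pos v h1 h2 h3⟩
  qh_pos := by omega
  qh_le := by
    have := hi.queue.n_nonneg
    omega
  closed h' _ _ h3 h4 := by omega

/-- The lists are decreasing and complete, so no arc that leaves `v` lies strictly between `G.nxt h`
and `h`. Hence the closure condition gains the single arc `h`. -/
theorem Searching.advance (hG : G.WF) (hs : Searching G cap pi exc qh n v h pos par q)
    (h0 : 0 ≤ h) (hH : h < G.H) (hv : G.frm h = v)
    (hp : G.Adm cap pi h → 0 < pos (G.tgt h)) :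
    Searching G cap pi exc qh n v (G.nxt h) pos par q where
  queue := hs.queue
  roots := hs.roots
  tree := hs.tree
  qh_pos := hs.qh_pos
  qh_le := hs.qh_le
  closed h' h1 h2 h3 h4 h5 h6 := by
    rcases eq_or_ne h' h with rfl | hne
    · exact hp h6
    refine hs.closed h' h1 h2 h3 h4 (fun h7 => ?_) h6
    have := h5 h7
    by_contra hlt
    have := hG.le_nxt h h0 hH h' h1 (by omega) (h7.trans hv.symm)
    omega

/-- The new node gets the last position `n + 1`. It therefore comes after its parent, and it is not
below `qh`, so the closure condition demands nothing of its own arcs yet. -/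
theorem Searching.push (hG : G.WF) (hs : Searching G cap pi exc qh n v h pos par q)
    (h0 : 0 ≤ h) (hH : h < G.H) (hv : 0 < pos (G.frm h)) (ha : G.Adm cap pi h)
    (hw : pos (G.tgt h) = 0) :
    Searching G cap pi exc qh (n + 1) v h (Function.update pos (G.tgt h) (n + 1))
      (Function.update par (G.tgt h) h) (Function.update q (n + 1) (G.tgt h)) where
  queue := hs.queue.push (hG.tgt_nonneg h h0 hH) (hG.tgt_lt h h0 hH) hw
  roots u h1 h2 h3 := by
    have := hs.queue.n_nonneg
    rw [Function.update_apply]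
    split_ifs
    · omega
    · exact hs.roots u h1 h2 h3
  tree u h1 h2 h3 := by
    by_cases hu : u = G.tgt h
    · right
      have hne : G.frm h ≠ G.tgt h := fun he => by
        rw [he] at hv
        omega
      have := hs.queue.pos_le (G.frm h) (hG.frm_nonneg h h0 hH) (hG.frm_lt h h0 hH)
      simp only [hu, Function.update_self, Function.update_of_ne hne]
      exact ⟨h0, hH, trivial, ha, hv, by omega⟩
    · rw [Function.update_of_ne hu] at h3 ⊢
      rw [Function.update_of_ne hu]
      rcases hs.tree u h1 h2 h3 with h4 | ⟨h4, h5, h6, h7, h8, h9⟩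
      · exact Or.inl h4
      · refine Or.inr ⟨h4, h5, h6, h7, ?_⟩
        rw [Function.update_of_ne (fun he => by rw [he] at h8; omega)]
        exact ⟨h8, h9⟩
  qh_pos := hs.qh_pos
  qh_le := by
    have := hs.qh_le
    omega
  closed h' h1 h2 h3 h4 h5 h6 := by
    have hn := hs.queue.n_nonneg
    have hq := hs.qh_le
    by_cases hu : G.frm h' = G.tgt h
    · rw [hu, Function.update_self] at h4
      omega
    · rw [Function.update_of_ne hu] at h3 h4
      have := hs.closed h' h1 h2 h3 h4 h5 h6
      rw [Function.update_apply]
      split_ifs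
      · omega
      · exact this

/-- The marker `-1` says that the list of `v` is exhausted, so `v` is no longer an exception to
closure. The new current node starts at the largest arc that leaves it, so nothing is claimed about
its arcs yet. -/
theorem Searching.pop (hG : G.WF) (hs : Searching G cap pi exc qh n v (-1) pos par q)
    (hq : qh ≤ n) :
    Searching G cap pi exc (qh + 1) n (q qh) (G.hd (q qh)) pos par q where
  queue := hs.queue
  roots := hs.roots
  tree := hs.tree
  qh_pos := by
    have := hs.qh_pos
    omega
  qh_le := by omega
  closed h' h1 h2 h3 h4 h5 h6 := by
    have hpos := hs.qh_pos
    by_cases hu : pos (G.frm h') = qh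
    · have hf : q qh = G.frm h' := by
        rw [← hu]
        exact hs.queue.q_pos _ (hG.frm_nonneg h' h1 h2) (hG.frm_lt h' h1 h2) h3
      have h7 := h5 hf.symm
      have := hG.le_hd (q qh) (hs.queue.q_ge _ hpos hq) (hs.queue.q_lt _ hpos hq) h' h1 h2 hf.symm
      omega
    · exact hs.closed h' h1 h2 h3 (by omega) (fun _ => by omega) h6

end

/-- Visit the head of arc `h` if it is not yet visited and the arc is admissible. -/
def visitProg : Program :=
  .seq (block [.load 15 11 14, .load 16 19 15]) (.cond ⟨16, 7⟩ (.seq (block [.load 17 16 14])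
    (.cond ⟨8, 17⟩ (.seq (block [.load 17 12 14, .load 18 18 11, .sub 17 17 18, .load 18 18 15,
      .add 17 17 18]) (.cond ⟨17, 7⟩ (block [.add 12 12 8, .store 19 15 12, .store 20 15 14,
        .store 21 12 15]) .skip)) .skip)) .skip)

/-- Breadth first search along admissible arcs. -/
def bfsProg : Program :=
  .seq (block [.const 13 1]) (.loop ⟨13, 12⟩ (.seq (block [.load 11 21 13, .add 13 13 8,
    .load 14 15 11]) (.loop ⟨7, 14⟩ (.seq visitProg (block [.load 14 14 14])))))

/-- Data that the search reads. -/
structure SearchData (G : Graph) (cap pi exc : ℤ → ℤ) (σ : Memory) : Prop where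
  a16 : σ.arr 16 = cap
  a17 : σ.arr 17 = exc
  a18 : σ.arr 18 = pi

/-- Bounds on the data that the search reads. -/
structure DataBound (G : Graph) (cap pi exc : ℤ → ℤ) : Prop where
  cap_nonneg : ∀ h, 0 ≤ h → h < G.H → 0 ≤ cap h
  cap_le : ∀ h, 0 ≤ h → h < G.H → cap h ≤ G.B
  exc_le : ∀ v, 0 ≤ v → v < G.K → |exc v| ≤ G.B
  pi_nonneg : ∀ v, 0 ≤ v → v < G.K → 0 ≤ pi v
  pi_le : ∀ v, 0 ≤ v → v < G.K → pi v ≤ G.B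

/-- Whenever one of the three tests fails, the head is already visited or the arc is not admissible,
and `Searching.advance` suffices. The clause on array `21` says that a push, which writes at a
position of at least `qh`, does not move scanned nodes; the time account of the search uses it. -/
theorem wp_visitProg {W : ℤ} {G : Graph} (hG : G.WF) (hW : 27 * G.B ≤ W) {σ : Memory}
    (hm : G.Mem σ) {cap pi exc : ℤ → ℤ} (hd : SearchData G cap pi exc σ)
    (hB : DataBound G cap pi exc) {qh h : ℤ} (h14 : σ.reg 14 = h) (h0 : 0 ≤ h) (hH : h < G.H)
    (h11 : σ.reg 11 = G.frm h) (hv : 0 < σ.arr 19 (G.frm h))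
    (hs : Searching G cap pi exc qh (σ.reg 12) (G.frm h) h (σ.arr 19) (σ.arr 20) (σ.arr 21)) :
    WP W visitProg σ fun σ' t =>
      Searching G cap pi exc qh (σ'.reg 12) (G.frm h) (G.nxt h) (σ'.arr 19) (σ'.arr 20)
        (σ'.arr 21) ∧ (∀ i, i < qh → σ'.arr 21 i = σ.arr 21 i) ∧
          0 < σ'.arr 19 (G.frm h) ∧ t ≤ 15 := by
  have hK := hG.K_nonneg
  have hKB := hG.K_le
  have hHB := hG.H_le
  have hB1 := hG.one_le_B
  have hn := hs.queue.le hK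
  have hn0 := hs.queue.n_nonneg
  have hqh := hs.qh_le
  have h1 := hG.tgt_nonneg h h0 hH
  have h2 := hG.tgt_lt h h0 hH
  have h3 := hs.queue.pos_nonneg _ h1 h2
  have h4 := hs.queue.pos_le _ h1 h2
  have f1 := hG.frm_nonneg h h0 hH
  have f2 := hG.frm_lt h h0 hH
  have c1 := hB.cap_nonneg h h0 hH
  have c2 := hB.cap_le h h0 hH
  have c3 := hG.cst_ge h h0 hH
  have c4 := hG.cst_le h h0 hH
  have p1 := hB.pi_nonneg _ h1 h2
  have p2 := hB.pi_le _ h1 h2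
  have p3 := hB.pi_nonneg _ f1 f2
  have p4 := hB.pi_le _ f1 f2
  refine WP.seq (WP.load ?_ (WP.load ?_ (WP.nil (WP.cond ?_ ?_))))
  · simp [hm.a11, h14, abs_le]; omega
  · simp [hm.a11, h14, abs_le]; omega
  · simp only [Memory.reg_setReg, Memory.arr_setReg, h14, hm.a11, hm.r7]
    simp only [Nat.reduceEqDiff, if_true, if_false]
    intro h5
    refine WP.seq (WP.load ?_ (WP.nil (WP.cond ?_ ?_)))
    · simp [h14, hd.a16, abs_le]; omega
    · simp only [Memory.reg_setReg, Memory.arr_setReg, h14, hm.r8, hd.a16]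
      simp only [Nat.reduceEqDiff, if_true, if_false]
      intro h6
      refine WP.seq (WP.load ?_ (WP.load ?_ (WP.sub ?_ (WP.load ?_ (WP.add ?_ (WP.nil
        (WP.cond ?_ ?_)))))))
      · simp [h14, hm.a12, abs_le]; omega
      · simp [h11, hd.a18, abs_le]; omega
      · simp [h11, h14, hd.a18, hm.a12, abs_le]; omega
      · simp [hd.a18, abs_le]; omega
      · simp [h11, h14, hd.a18, hm.a12, abs_le]; omega
      · simp only [Memory.reg_setReg, Memory.arr_setReg, h14, hm.a12, hm.r7, hd.a18, h11]
        simp only [Nat.reduceEqDiff, if_true, if_false]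
        intro h7
        refine WP.add ?_ (WP.store ?_ (WP.store ?_ (WP.store ?_ (WP.nil ?_))))
        · simp [hm.r8, abs_le]; omega
        · simp [hm.r8, abs_le]; omega
        · simp [h14, abs_le]; omega
        · simp [abs_le]; omega
        · have hp := hs.push hG h0 hH hv ⟨by omega, h7⟩ (by omega)
          refine ⟨?_, ?_, ?_, by omega⟩
          · simpa [hm.r8, h14] using hp.advance hG h0 hH rfl (fun _ => by simp; omega)
          · intro i hi
            simp only [Memory.reg_setReg, Memory.arr_setReg, Memory.arr_setArr, Memory.reg_setArr]
            simp [hm.r8]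
            rw [Function.update_of_ne (by omega)]
          · simp [hm.r8, Function.update_apply]
            split_ifs
            · omega
            · exact hv
      · simp only [Memory.reg_setReg, Memory.arr_setReg, h14, hm.a12, hm.r7, hd.a18, h11]
        simp only [Nat.reduceEqDiff, if_true, if_false]
        intro h7
        refine WP.skip ⟨?_, fun i hi => by simp, by simpa using hv, by omega⟩
        simpa using hs.advance hG h0 hH rfl (fun ha => by have := ha.2; omega)
    · simp only [Memory.reg_setReg, Memory.arr_setReg, h14, hm.r8, hd.a16]
      simp only [Nat.reduceEqDiff, if_true, if_false]
      intro h6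
      refine WP.skip ⟨?_, fun i hi => by simp, by simpa using hv, by omega⟩
      simpa using hs.advance hG h0 hH rfl (fun ha => by have := ha.1; omega)
  · simp only [Memory.reg_setReg, Memory.arr_setReg, h14, hm.a11, hm.r7]
    simp only [Nat.reduceEqDiff, if_true, if_false]
    intro h5
    refine WP.skip ⟨?_, fun i hi => by simp, by simpa using hv, by omega⟩
    simpa using hs.advance hG h0 hH rfl (fun ha => h5)

end Graph

end

/-! ### Linear running time and correctness of breadth first search -/

namespace Graph

theorem SearchData.frame {G : Graph} {cap pi exc : ℤ → ℤ} {p : Program} {σ σ' : Memory}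
    (hd : SearchData G cap pi exc σ) (hf : Frame p σ σ')
    (ha : ∀ a ∈ [16, 17, 18], a ∉ p.arrs) : SearchData G cap pi exc σ' where
  a16 := (hf.arr _ (ha _ (by simp))).trans hd.a16
  a17 := (hf.arr _ (ha _ (by simp))).trans hd.a17
  a18 := (hf.arr _ (ha _ (by simp))).trans hd.a18

/-- Number of arcs up to `h` that leave `v`. -/
noncomputable def deg (G : Graph) (v h : ℤ) : ℕ := ((Finset.Icc 0 h).filter fun h' => G.frm h' = v).card

theorem deg_nxt_lt {G : Graph} (hG : G.WF) {h : ℤ} (h0 : 0 ≤ h) (hH : h < G.H) :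
    G.deg (G.frm h) (G.nxt h) < G.deg (G.frm h) h := by
  apply Finset.card_lt_card
  have := hG.nxt_lt h h0 hH
  refine Finset.ssubset_iff_of_subset (fun x => ?_) |>.2 ⟨h, ?_, ?_⟩
  · simp only [Finset.mem_filter, Finset.mem_Icc]
    rintro ⟨⟨h1, h2⟩, h3⟩
    exact ⟨⟨h1, by omega⟩, h3⟩
  · simp [h0]
  · simp; omega

theorem wp_scanLoop {W : ℤ} {G : Graph} (hG : G.WF) (hW : 27 * G.B ≤ W) {σ : Memory}
    (hm : G.Mem σ) {cap pi exc : ℤ → ℤ} (hd : SearchData G cap pi exc σ)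
    (hB : DataBound G cap pi exc) {qh v h : ℤ} (h14 : σ.reg 14 = h) (h0 : -1 ≤ h) (hH : h < G.H)
    (h11 : σ.reg 11 = v) (hv : 0 < σ.arr 19 v) (hfv : 0 ≤ h → G.frm h = v)
    (hs : Searching G cap pi exc qh (σ.reg 12) v h (σ.arr 19) (σ.arr 20) (σ.arr 21)) :
    WP W (.loop ⟨7, 14⟩ (.seq visitProg (block [.load 14 14 14]))) σ fun σ' t =>
      Searching G cap pi exc qh (σ'.reg 12) v (-1) (σ'.arr 19) (σ'.arr 20) (σ'.arr 21) ∧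
        (∀ i, i < qh → σ'.arr 21 i = σ.arr 21 i) ∧ t ≤ 20 * G.deg v h + 1 := by
  have hHB := hG.H_le
  have hB1 := hG.one_le_B
  refine WP.mono (WP.loop (fun φ σ₁ => -1 ≤ σ₁.reg 14 ∧ σ₁.reg 14 < G.H ∧
    (0 ≤ σ₁.reg 14 → G.frm (σ₁.reg 14) = v) ∧ 0 < σ₁.arr 19 v ∧
    Searching G cap pi exc qh (σ₁.reg 12) v (σ₁.reg 14) (σ₁.arr 19) (σ₁.arr 20) (σ₁.arr 21) ∧
    (∀ i, i < qh → σ₁.arr 21 i = σ.arr 21 i) ∧ φ = 20 * G.deg v (σ₁.reg 14))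
    (20 * G.deg v h) ?_ ?_) ?_
  · simp only [h14]
    exact ⟨h0, hH, hfv, hv, hs, fun i _ => trivial, trivial⟩
  · rintro φ σ₁ hf ⟨h1, h2, h3, h4, h5, h6, rfl⟩ hb
    have hm₁ : G.Mem σ₁ := hm.frame hf (by decide) (by decide)
    have hd₁ : SearchData G cap pi exc σ₁ := hd.frame hf (by decide)
    have e11 : σ₁.reg 11 = v := (hf.reg 11 (by decide)).trans h11
    simp only [hm₁.r7] at hb
    have h3 := h3 hb
    refine WP.seq (WP.mono (wp_visitProg hG hW hm₁ hd₁ hB (qh := qh) rfl hb h2 (by rw [h3, e11])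
      (by rw [h3]; exact h4) (by rw [h3]; exact h5)) ?_)
    rintro σ₂ t hf₂ ⟨g1, g2, g3, ht⟩
    have e14 : σ₂.reg 14 = σ₁.reg 14 := hf₂.reg 14 (by decide)
    have hm₂ : G.Mem σ₂ := hm₁.frame hf₂ (by decide) (by decide)
    have n1 := hG.nxt_ge _ hb h2
    have n2 := hG.nxt_lt _ hb h2
    have n3 := deg_nxt_lt hG hb h2
    rw [h3] at g1 g3 n3
    refine WP.load ?_ (WP.nil ⟨20 * G.deg v (G.nxt (σ₁.reg 14)), ?_, by omega⟩)
    · rw [hm₂.a14, e14, abs_le]; omega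
    · simp only [Memory.reg_setReg, Memory.arr_setReg, hm₂.a14, e14, if_true]
      exact ⟨n1, by omega, fun h => (hG.frm_nxt _ hb h2 h).trans h3, g3, g1,
        fun i hi => (g2 i hi).trans (h6 i hi), trivial⟩
  · rintro σ' t hf ⟨φ', ⟨h1, h2, h3, h4, h5, h6, rfl⟩, hb, ht⟩
    have e7 : σ'.reg 7 = 0 := (hf.reg 7 (by decide)).trans hm.r7
    simp only [e7] at hb
    have : σ'.reg 14 = -1 := by omega
    rw [this] at h5
    exact ⟨h5, h6, by omega⟩

/-- The arcs whose tail is not yet scanned. -/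
noncomputable def pending (G : Graph) (pos : ℤ → ℤ) (qh : ℤ) : ℕ :=
  ((Finset.Ico 0 G.H).filter fun h => ¬(0 < pos (G.frm h) ∧ pos (G.frm h) < qh)).card

/-- The arcs that leave the node at position `qh` are pending before its scan and not after it, and
nodes scanned earlier keep their positions because the queues agree up to `qh`. Thus each scan is
paid by the arcs it settles, and the search is linear. -/
theorem pending_add_deg_le {G : Graph} (hG : G.WF) {pos q pos' q' : ℤ → ℤ} {qh n n' : ℤ}
    (hq : Queue G.K 0 n pos q) (hq' : Queue G.K 0 n' pos' q') (h0 : 0 < qh) (hn : qh ≤ n)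
    (hn' : qh ≤ n') (he : ∀ i, i < qh + 1 → q' i = q i) :
    G.pending pos' (qh + 1) + G.deg (q qh) (G.hd (q qh)) ≤ G.pending pos qh := by
  have hv0 := hq.q_ge qh h0 hn
  have hvK := hq.q_lt qh h0 hn
  have hv := hq.pos_q qh h0 hn
  have hv' := hq'.pos_q qh h0 hn'
  rw [he qh (by omega)] at hv'
  have hh := hG.hd_lt _ hv0 hvK
  unfold pending deg
  rw [← Finset.card_union_of_disjoint]
  · apply Finset.card_le_card
    intro h
    simp only [Finset.mem_union, Finset.mem_filter, Finset.mem_Ico, Finset.mem_Icc]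
    rintro (⟨⟨h1, h2⟩, h3⟩ | ⟨⟨h1, h2⟩, h3⟩)
    · refine ⟨⟨h1, h2⟩, fun ⟨h4, h5⟩ => h3 ?_⟩
      have h6 := hq.q_pos _ (hG.frm_nonneg h h1 h2) (hG.frm_lt h h1 h2) h4
      have h7 := hq'.pos_q (pos (G.frm h)) h4 (by omega)
      rw [he _ (by omega), h6] at h7
      omega
    · refine ⟨⟨h1, by omega⟩, ?_⟩
      rw [h3, hv]
      omega
  · rw [Finset.disjoint_left]
    intro h
    simp only [Finset.mem_filter, not_and]
    rintro ⟨-, h3⟩ - h4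
    rw [h4, hv'] at h3
    omega

/-- The result of the search. -/
structure Labels (G : Graph) (cap pi exc pos par : ℤ → ℤ) : Prop where
  pos_nonneg : ∀ v, 0 ≤ v → v < G.K → 0 ≤ pos v
  pos_le : ∀ v, 0 ≤ v → v < G.K → pos v ≤ G.K
  roots : ∀ v, 0 ≤ v → v < G.K → 0 < exc v → 0 < pos v
  tree : G.Tree cap pi exc pos par
  closed : ∀ h, 0 ≤ h → h < G.H → 0 < pos (G.frm h) → G.Adm cap pi h → 0 < pos (G.tgt h)

theorem wp_bfsProg {W : ℤ} {G : Graph} (hG : G.WF) (hW : 27 * G.B ≤ W) {σ : Memory}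
    (hm : G.Mem σ) {cap pi exc : ℤ → ℤ} (hd : SearchData G cap pi exc σ)
    (hB : DataBound G cap pi exc)
    (hi : Initial G.K 0 (σ.reg 12) exc (σ.arr 19) (σ.arr 20) (σ.arr 21)) :
    WP W bfsProg σ fun σ' t =>
      Labels G cap pi exc (σ'.arr 19) (σ'.arr 20) ∧ t ≤ 20 * G.H.toNat + 20 * G.K.toNat + 2 := by
  have hK := hG.K_nonneg
  have hKB := hG.K_le
  have hHB := hG.H_le
  have hB1 := hG.one_le_B
  refine WP.seq (WP.const ?_ (WP.nil ?_))
  · simp; omega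
  -- The prepaid time charges the inner loop to the pending arcs and the constant work per round to
  -- the nodes not yet taken from the queue.
  refine WP.mono (WP.loop (fun φ σ₁ => (∃ v, Searching G cap pi exc (σ₁.reg 13) (σ₁.reg 12) v (-1)
    (σ₁.arr 19) (σ₁.arr 20) (σ₁.arr 21)) ∧
    φ = 20 * G.pending (σ₁.arr 19) (σ₁.reg 13) + 20 * (G.K + 1 - σ₁.reg 13).toNat)
    (20 * G.pending (σ.arr 19) 1 + 20 * G.K.toNat) ?_ ?_) ?_
  · simp only [Memory.reg_setReg, Memory.arr_setReg, Nat.reduceEqDiff, if_true, if_false]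
    exact ⟨⟨_, hi.searching⟩, by simp⟩
  · rintro φ σ₁ hf ⟨⟨u, hs⟩, rfl⟩ hb
    have hm₁ : G.Mem σ₁ := by
      refine Mem.frame (p := bfsProg) hm ⟨fun r hr => (hf.reg r ?_).trans ?_,
        fun r hr => (hf.arr r hr)⟩ (by decide) (by decide)
      · exact fun h => hr (List.mem_append_right _ h)
      · rw [Memory.reg_setReg, if_neg]
        exact fun h => hr (by simp [h, bfsProg, Program.regs, block])
    have hd₁ : SearchData G cap pi exc σ₁ :=
      ⟨(hf.arr _ (by decide)).trans hd.a16, (hf.arr _ (by decide)).trans hd.a17,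
        (hf.arr _ (by decide)).trans hd.a18⟩
    have hb : σ₁.reg 13 ≤ σ₁.reg 12 := hb
    have h0 := hs.qh_pos
    have hn := hs.queue.le hK
    have hv0 := hs.queue.q_ge _ h0 hb
    have hvK := hs.queue.q_lt _ h0 hb
    have hv := hs.queue.pos_q _ h0 hb
    have g1 := hG.hd_ge _ hv0 hvK
    have g2 := hG.hd_lt _ hv0 hvK
    refine WP.seq (WP.load ?_ (WP.add ?_ (WP.load ?_ (WP.nil ?_))))
    · rw [abs_le]; omega
    · simp [hm₁.r8, abs_le]; omega
    · simp [hm₁.a15, abs_le]; omega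
    refine WP.mono (wp_scanLoop (v := σ₁.arr 21 (σ₁.reg 13))
      (h := G.hd (σ₁.arr 21 (σ₁.reg 13))) (qh := σ₁.reg 13 + 1) hG hW ?_ ?_ hB ?_ g1 g2 ?_ ?_
      (hG.frm_hd _ hv0 hvK) ?_) ?_
    · exact ⟨by simp [hm₁.r4], by simp [hm₁.r7], by simp [hm₁.r8], by simp [hm₁.r9], hm₁.a10,
        hm₁.a11, hm₁.a12, hm₁.a13, hm₁.a14, hm₁.a15⟩
    · exact ⟨hd₁.a16, hd₁.a17, hd₁.a18⟩
    · simp [hm₁.a15]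
    · simp
    · simp only [Memory.arr_setReg]
      omega
    · simpa using hs.pop hG hb
    · rintro σ₂ t hf₂ ⟨k1, k2, ht⟩
      have e13 : σ₂.reg 13 = σ₁.reg 13 + 1 := (hf₂.reg 13 (by decide)).trans (by simp [hm₁.r8])
      have hqh := k1.qh_le
      simp only [Memory.arr_setReg] at k2
      have := pending_add_deg_le hG hs.queue k1.queue h0 hb (by omega) k2
      refine ⟨_, ⟨⟨_, by rw [e13]; exact k1⟩, rfl⟩, ?_⟩
      rw [e13]
      omega
  · rintro σ' t hf ⟨φ', ⟨⟨u, hs⟩, rfl⟩, hb, ht⟩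
    have hb : σ'.reg 12 < σ'.reg 13 := hb
    have hn := hs.queue.le hK
    have hp : G.pending (σ.arr 19) 1 ≤ G.H.toNat := by
      refine (Finset.card_filter_le _ _).trans ?_
      simp
    refine ⟨⟨hs.queue.pos_nonneg, fun v h1 h2 => ?_, hs.roots, hs.tree,
      fun h h1 h2 h3 h4 => ?_⟩, by omega⟩
    · have := hs.queue.pos_le v h1 h2
      omega
    · have := hs.queue.pos_le _ (hG.frm_nonneg h h1 h2) (hG.frm_lt h h1 h2)
      exact hs.closed h h1 h2 h3 (by omega) (fun _ => by omega) h4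

/-- Visit all nodes that are reachable along admissible arcs from nodes with positive excess. -/
def searchProg : Program := .seq initProg bfsProg

theorem wp_searchProg {W : ℤ} {G : Graph} (hG : G.WF) (hW : 27 * G.B ≤ W) {σ : Memory}
    (hm : G.Mem σ) {cap pi exc : ℤ → ℤ} (hd : SearchData G cap pi exc σ)
    (hB : DataBound G cap pi exc) :
    WP W searchProg σ fun σ' t =>
      Labels G cap pi exc (σ'.arr 19) (σ'.arr 20) ∧ t ≤ 20 * G.H.toNat + 30 * G.K.toNat + 5 := by
  refine WP.seq (WP.mono (wp_initProg hG hW hm hd.a17 hB.exc_le) ?_)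
  rintro σ₁ t hf ⟨hi, ht⟩
  refine WP.mono (wp_bfsProg hG hW (hm.frame hf (by decide) (by decide)) (hd.frame hf (by decide))
    hB hi) ?_
  rintro σ₂ t' - ⟨hl, ht'⟩
  exact ⟨hl, by omega⟩

end Graph

/-- This unrolls one round, for loops that follow a tree path and are treated by induction on that
path. -/
theorem WP.loop_step {W : ℤ} {b : Test} {p : Program} {σ : Memory} {Q : Memory → ℕ → Prop}
    (hb : σ.reg b.x ≤ σ.reg b.y)
    (h : WP W p σ fun σ₁ t => WP W (.loop b p) σ₁ fun σ₂ t' => Q σ₂ (1 + t + t')) :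
    WP W (.loop b p) σ Q := by
  obtain ⟨σ₁, t, he, σ₂, t', he', hq⟩ := h
  exact ⟨σ₂, _, .loopTrue hb he he', hq⟩

theorem WP.loop_exit {W : ℤ} {b : Test} {p : Program} {σ : Memory} {Q : Memory → ℕ → Prop}
    (hb : σ.reg b.y < σ.reg b.x) (h : Q σ 1) : WP W (.loop b p) σ Q :=
  ⟨σ, 1, .loopFalse (not_le.2 hb), h⟩

/-! ### Nodes with demand, raised potentials and tree paths in memory -/

namespace Graph

/-- Find a visited node with negative excess. -/
def findProg : Program :=
  .seq (block [.move 20 9, .move 11 4]) (.loop ⟨8, 11⟩ (.seq (block [.sub 11 11 8, .load 19 17 11])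
    (.cond ⟨19, 9⟩ (.seq (block [.load 16 19 11]) (.cond ⟨8, 16⟩ (block [.move 20 11]) .skip))
      .skip)))

theorem wp_findProg {W : ℤ} {G : Graph} (hG : G.WF) (hW : 27 * G.B ≤ W) {σ : Memory}
    (hm : G.Mem σ) {exc pos : ℤ → ℤ} (he : σ.arr 17 = exc) (hp : σ.arr 19 = pos)
    (hB : ∀ v, 0 ≤ v → v < G.K → |exc v| ≤ G.B) (hp0 : ∀ v, 0 ≤ v → v < G.K → 0 ≤ pos v)
    (hpK : ∀ v, 0 ≤ v → v < G.K → pos v ≤ G.K) :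
    WP W findProg σ fun σ' t =>
      ((σ'.reg 20 = -1 ∧ ∀ v, 0 ≤ v → v < G.K → exc v < 0 → pos v ≤ 0) ∨
        (0 ≤ σ'.reg 20 ∧ σ'.reg 20 < G.K ∧ exc (σ'.reg 20) < 0 ∧ 0 < pos (σ'.reg 20))) ∧
        t ≤ 10 * G.K.toNat + 3 := by
  have hK := hG.K_nonneg
  have hKB := hG.K_le
  have hB1 := hG.one_le_B
  refine WP.seq (WP.move ?_ (WP.move ?_ (WP.nil ?_)))
  · simp [hm.r9]; omega
  · simp [hm.r4, abs_le]; omega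
  refine WP.mono (WP.loop (fun φ σ₁ => 0 ≤ σ₁.reg 11 ∧ σ₁.reg 11 ≤ G.K ∧
    φ = 10 * (σ₁.reg 11).toNat ∧
    ((σ₁.reg 20 = -1 ∧ ∀ v, σ₁.reg 11 ≤ v → v < G.K → exc v < 0 → pos v ≤ 0) ∨
        (0 ≤ σ₁.reg 20 ∧ σ₁.reg 20 < G.K ∧ exc (σ₁.reg 20) < 0 ∧ 0 < pos (σ₁.reg 20))))
    (10 * G.K.toNat) ?_ ?_) ?_
  · simp [hm.r4, hm.r9, hK]
    intros
    omega
  · rintro φ σ₁ hf ⟨h1, h2, rfl, hi⟩ hb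
    have e8 : σ₁.reg 8 = 1 := (hf.reg 8 (by decide)).trans (by simp [hm.r8])
    have e9 : σ₁.reg 9 = -1 := (hf.reg 9 (by decide)).trans (by simp [hm.r9])
    have e17 : σ₁.arr 17 = exc := (hf.arr 17 (by decide)).trans (by simp [he])
    have e19 : σ₁.arr 19 = pos := (hf.arr 19 (by decide)).trans (by simp [hp])
    simp only [e8] at hb
    obtain ⟨v, hv⟩ : ∃ v, σ₁.reg 11 = v + 1 := ⟨σ₁.reg 11 - 1, by ring⟩
    rw [hv] at h1 h2 hb hi
    have hBv := abs_le.1 (hB v (by omega) (by omega))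
    have hp1 := hp0 v (by omega) (by omega)
    have hp2 := hpK v (by omega) (by omega)
    -- If `v` is not a visited node with demand, the answer found for the nodes above `v` remains
    -- valid with `v` included.
    have key : (0 ≤ exc v ∨ pos v ≤ 0) →
        ((σ₁.reg 20 = -1 ∧ ∀ w, v ≤ w → w < G.K → exc w < 0 → pos w ≤ 0) ∨
        (0 ≤ σ₁.reg 20 ∧ σ₁.reg 20 < G.K ∧ exc (σ₁.reg 20) < 0 ∧ 0 < pos (σ₁.reg 20))) := by
      rintro h
      rcases hi with ⟨hi, hi'⟩ | hi
      · refine Or.inl ⟨hi, fun w w1 w2 w3 => ?_⟩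
        rcases eq_or_ne w v with rfl | hne
        · omega
        · exact hi' w (by omega) w2 w3
      · exact Or.inr hi
    refine WP.seq (WP.sub ?_ (WP.load ?_ (WP.nil (WP.cond ?_ ?_))))
    · simp [hv, e8, abs_le]; omega
    · simp [hv, e8, e17, abs_le]; omega
    · simp only [Memory.reg_setReg, Memory.arr_setReg, hv, e8, e9, e17]
      simp only [Nat.reduceEqDiff, if_true, if_false, add_sub_cancel_right]
      intro hev
      refine WP.seq (WP.load ?_ (WP.nil (WP.cond ?_ ?_)))
      · simp [e19, abs_le]; omega
      · simp only [Memory.reg_setReg, Memory.arr_setReg, e8, e19]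
        simp only [Nat.reduceEqDiff, if_true, if_false]
        intro hpv
        refine WP.move ?_ (WP.nil ⟨10 * v.toNat, ?_, by omega⟩)
        · simp [abs_le]; omega
        · simp
          exact ⟨by omega, by omega, Or.inr ⟨by omega, by omega, by omega, by omega⟩⟩
      · simp only [Memory.reg_setReg, Memory.arr_setReg, e8, e19]
        simp only [Nat.reduceEqDiff, if_true, if_false]
        intro hpv
        refine WP.skip ⟨10 * v.toNat, ?_, by omega⟩
        simp
        exact ⟨by omega, by omega, key (by omega)⟩
    · simp only [Memory.reg_setReg, Memory.arr_setReg, hv, e8, e9, e17]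
      simp only [Nat.reduceEqDiff, if_true, if_false, add_sub_cancel_right]
      intro hev
      refine WP.skip ⟨10 * v.toNat, ?_, by omega⟩
      simp
      exact ⟨by omega, by omega, key (by omega)⟩
  · rintro σ' t hf ⟨φ', ⟨h1, h2, rfl, hi⟩, hb, ht⟩
    have e8 : σ'.reg 8 = 1 := (hf.reg 8 (by decide)).trans (by simp [hm.r8])
    simp only [e8] at hb
    have h0 : σ'.reg 11 = 0 := by omega
    rw [h0] at hi
    exact ⟨hi, by omega⟩

/-- Raise the potential of the visited nodes by `1`. -/
def raiseProg : Program :=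
  .seq (block [.move 11 4]) (.loop ⟨8, 11⟩ (.seq (block [.sub 11 11 8, .load 16 19 11])
    (.cond ⟨8, 16⟩ (block [.load 17 18 11, .add 17 17 8, .store 18 11 17]) .skip)))

theorem wp_raiseProg {W : ℤ} {G : Graph} (hG : G.WF) (hW : 27 * G.B ≤ W) {σ : Memory}
    (hm : G.Mem σ) {pi pos : ℤ → ℤ} (hpi : σ.arr 18 = pi) (hp : σ.arr 19 = pos)
    (hB : ∀ v, 0 ≤ v → v < G.K → |pi v| ≤ G.B) (hp0 : ∀ v, 0 ≤ v → v < G.K → 0 ≤ pos v)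
    (hpK : ∀ v, 0 ≤ v → v < G.K → pos v ≤ G.K) :
    WP W raiseProg σ fun σ' t =>
      (∀ v, 0 ≤ v → v < G.K → σ'.arr 18 v = pi v + if 0 < pos v then 1 else 0) ∧
        t ≤ 10 * G.K.toNat + 2 := by
  have hK := hG.K_nonneg
  have hKB := hG.K_le
  have hB1 := hG.one_le_B
  refine WP.seq (WP.move ?_ (WP.nil ?_))
  · simp [hm.r4, abs_le]; omega
  refine WP.mono (WP.loop (fun φ σ₁ => 0 ≤ σ₁.reg 11 ∧ σ₁.reg 11 ≤ G.K ∧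
    φ = 10 * (σ₁.reg 11).toNat ∧ (∀ v, 0 ≤ v → v < G.K →
      σ₁.arr 18 v = pi v + if σ₁.reg 11 ≤ v ∧ 0 < pos v then 1 else 0))
    (10 * G.K.toNat) ?_ ?_) ?_
  · simp [hm.r4, hK, hpi]
    intros
    omega
  · rintro φ σ₁ hf ⟨h1, h2, rfl, hi⟩ hb
    have e8 : σ₁.reg 8 = 1 := (hf.reg 8 (by decide)).trans (by simp [hm.r8])
    have e19 : σ₁.arr 19 = pos := (hf.arr 19 (by decide)).trans (by simp [hp])
    simp only [e8] at hb
    obtain ⟨v, hv⟩ : ∃ v, σ₁.reg 11 = v + 1 := ⟨σ₁.reg 11 - 1, by ring⟩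
    rw [hv] at h1 h2 hb hi
    have hBv := abs_le.1 (hB v (by omega) (by omega))
    have hp1 := hp0 v (by omega) (by omega)
    have hp2 := hpK v (by omega) (by omega)
    have hiv := hi v (by omega) (by omega)
    rw [if_neg (by omega)] at hiv
    refine WP.seq (WP.sub ?_ (WP.load ?_ (WP.nil (WP.cond ?_ ?_))))
    · simp [hv, e8, abs_le]; omega
    · simp [hv, e8, e19, abs_le]; omega
    · simp only [Memory.reg_setReg, Memory.arr_setReg, hv, e8, e19]
      simp only [Nat.reduceEqDiff, if_true, if_false, add_sub_cancel_right]
      intro hev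
      refine WP.load ?_ (WP.add ?_ (WP.store ?_ (WP.nil ⟨10 * v.toNat, ?_, by omega⟩)))
      · simp [hiv, abs_le]; omega
      · simp [hiv, e8, abs_le]; omega
      · simp [hiv, e8, abs_le]; omega
      · simp [e8, hiv]
        refine ⟨by omega, by omega, fun w w1 w2 => ?_⟩
        rcases eq_or_ne w v with rfl | hne
        · rw [Function.update_self, if_pos ⟨le_rfl, by omega⟩]
        · rw [Function.update_of_ne hne, hi w w1 w2]
          congr 1
          exact if_congr (by omega) rfl rfl
    · simp only [Memory.reg_setReg, Memory.arr_setReg, hv, e8, e19]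
      simp only [Nat.reduceEqDiff, if_true, if_false, add_sub_cancel_right]
      intro hev
      refine WP.skip ⟨10 * v.toNat, ?_, by omega⟩
      simp
      refine ⟨by omega, by omega, fun w w1 w2 => ?_⟩
      rw [hi w w1 w2]
      rcases eq_or_ne w v with rfl | hne
      · rw [if_neg (by omega), if_neg (by omega)]
      · congr 1
        exact if_congr (by omega) rfl rfl
  · rintro σ' t hf ⟨φ', ⟨h1, h2, rfl, hi⟩, hb, ht⟩
    have e8 : σ'.reg 8 = 1 := (hf.reg 8 (by decide)).trans (by simp [hm.r8])
    simp only [e8] at hb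
    refine ⟨fun v v1 v2 => ?_, by omega⟩
    rw [hi v v1 v2]
    congr 1
    exact if_congr (by omega) rfl rfl

/-- `L` lists the tree arcs from `v` back to the root `s`. -/
def Trace (G : Graph) (par : ℤ → ℤ) : ℤ → List ℤ → ℤ → Prop
  | v, [], s => v = s ∧ par v = -1
  | v, h :: L, s => par v = h ∧ G.tgt h = v ∧ 0 ≤ h ∧ h < G.H ∧ Trace G par (G.frm h) L s

/-- Positions strictly decrease from a node to its tree parent. Hence the induction on a bound for
the position ends at a root, the length is less than the position, and the nodes on the way are
distinct, which makes the walk a path. -/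
theorem Labels.exists_trace {G : Graph} (hG : G.WF) {cap pi exc pos par : ℤ → ℤ}
    (hl : Labels G cap pi exc pos par) (n : ℕ) :
    ∀ v, 0 ≤ v → v < G.K → 0 < pos v → pos v ≤ n → ∃ L s, G.Trace par v L s ∧ 0 ≤ s ∧ s < G.K ∧
      0 < exc s ∧ (L.length : ℤ) < pos v ∧ (∀ h ∈ L, G.Adm cap pi h) ∧
      (∀ w ∈ v :: L.map G.frm, pos w ≤ pos v) ∧ (v :: L.map G.frm).Nodup := by
  induction n with
  | zero =>
    intro v _ _ h3 h4
    simp at h4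
    omega
  | succ n ih =>
    intro v h1 h2 h3 h4
    rcases hl.tree v h1 h2 h3 with ⟨h5, h6⟩ | ⟨h5, h6, h7, h8, h9, h10⟩
    · exact ⟨[], v, ⟨rfl, h5⟩, h1, h2, h6, by simpa using h3, by simp, by simp, by simp⟩
    · push_cast at h4
      obtain ⟨L, s, t1, t2, t3, t4, t5, t6, t7, t8⟩ := ih (G.frm (par v))
        (hG.frm_nonneg _ h5 h6) (hG.frm_lt _ h5 h6) h9 (by omega)
      refine ⟨par v :: L, s, ⟨rfl, h7, h5, h6, t1⟩, t2, t3, t4, ?_, ?_, ?_, ?_⟩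
      · simp; omega
      · simpa using ⟨h8, t6⟩
      · rintro w hw
        rcases List.mem_cons.1 hw with rfl | hw
        · exact le_rfl
        · have := t7 w hw
          omega
      · refine List.nodup_cons.2 ⟨fun hv => ?_, t8⟩
        have := t7 v hv
        omega

/-- Find the largest amount of flow that the demand of node `t` and the residual capacities on the
tree path to `t` allow. -/
def traceProg : Program :=
  .seq (block [.load 21 17 20, .sub 21 7 21, .move 11 20, .load 14 20 20])
    (.loop ⟨7, 14⟩ (.seq (block [.load 17 16 14]) (.seq (.cond ⟨17, 21⟩ (block [.move 21 17]) .skip)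
      (block [.load 11 10 14, .load 14 20 11]))))

/-- Register `21` holds a running minimum. It is described by `IsGreatest` so that the result
matches the amount of flow required in `SSPStep`. -/
theorem wp_traceLoop {W : ℤ} {G : Graph} (hG : G.WF) (hW : 27 * G.B ≤ W) {cap par : ℤ → ℤ}
    (hc0 : ∀ h, 0 ≤ h → h < G.H → 0 ≤ cap h) (hcB : ∀ h, 0 ≤ h → h < G.H → cap h ≤ G.B) {s : ℤ}
    (hs0 : 0 ≤ s) (hsK : s < G.K) (L : List ℤ) :
    ∀ (v d : ℤ) (σ : Memory), G.Mem σ → σ.arr 16 = cap → σ.arr 20 = par → G.Trace par v L s →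
      σ.reg 11 = v → σ.reg 14 = par v → σ.reg 21 = d →
    WP W (.loop ⟨7, 14⟩ (.seq (block [.load 17 16 14])
      (.seq (.cond ⟨17, 21⟩ (block [.move 21 17]) .skip)
      (block [.load 11 10 14, .load 14 20 11])))) σ fun σ' t =>
      σ'.reg 11 = s ∧ IsGreatest {x | x ≤ d ∧ ∀ h ∈ L, x ≤ cap h} (σ'.reg 21) ∧
        t ≤ 10 * L.length + 1 := by
  have hKB := hG.K_le
  have hHB := hG.H_le
  have hB1 := hG.one_le_B
  induction L with
  | nil =>
    rintro v d σ hm h16 h20 ⟨rfl, ht⟩ h11 h14 h21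
    refine WP.loop_exit ?_ ⟨h11, ⟨by simp [h21], fun x hx => ?_⟩, by simp⟩
    · simp only [h14, hm.r7, ht]
      omega
    · simpa [h21] using hx
  | cons h L ih =>
    rintro v d σ hm h16 h20 ⟨rfl, ht, h0, hH, hL⟩ h11 h14 h21
    have c1 := hc0 _ h0 hH
    have c2 := hcB _ h0 hH
    have f1 := hG.frm_nonneg _ h0 hH
    have f2 := hG.frm_lt _ h0 hH
    have p1 : -1 ≤ par (G.frm (par v)) ∧ par (G.frm (par v)) < G.H := by
      cases L with
      | nil => exact ⟨hL.2.ge, hL.2.trans_lt (by omega)⟩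
      | cons h' L => exact ⟨hL.1.symm ▸ by have := hL.2.2.1; omega, hL.1.symm ▸ hL.2.2.2.1⟩
    refine WP.loop_step (by simpa only [hm.r7, h14]) (WP.seq (WP.load ?_ (WP.nil ?_)))
    · simp [h14, h16, abs_le]; omega
    refine WP.seq (WP.mono (Q := fun σ₁ t => σ₁.reg 21 = min d (cap (par v)) ∧ t ≤ 2)
      (WP.cond ?_ ?_) ?_)
    · simp [h14, h16, h21]
      intro hd
      refine WP.move ?_ (WP.nil ?_)
      · simp [abs_le]; omega
      · simp; omega
    · simp [h14, h16, h21]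
      intro hd
      refine WP.skip ?_
      simp [h21]; omega
    · rintro σ₁ t hf ⟨k1, k2⟩
      have hm₁ : G.Mem σ₁ := Mem.frame (σ := σ.setReg 17 (σ.arr 16 (σ.reg 14)))
        ⟨by simp [hm.r4], by simp [hm.r7], by simp [hm.r8], by simp [hm.r9], hm.a10,
        hm.a11, hm.a12, hm.a13, hm.a14, hm.a15⟩ hf (by decide) (by decide)
      have e14 : σ₁.reg 14 = par v := (hf.reg 14 (by decide)).trans (by simp [h14])
      have e16 : σ₁.arr 16 = cap := (hf.arr 16 (by decide)).trans (by simp [h16])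
      have e20 : σ₁.arr 20 = par := (hf.arr 20 (by decide)).trans (by simp [h20])
      refine WP.load ?_ (WP.load ?_ (WP.nil ?_))
      · simp [e14, hm₁.a10, abs_le]; omega
      · simp [e14, hm₁.a10, e20, abs_le]; omega
      refine WP.mono (ih (G.frm (par v)) (min d (cap (par v))) _ ?_ ?_ ?_ hL ?_ ?_ ?_) ?_
      · exact ⟨by simp [hm₁.r4], by simp [hm₁.r7], by simp [hm₁.r8], by simp [hm₁.r9], hm₁.a10,
          hm₁.a11, hm₁.a12, hm₁.a13, hm₁.a14, hm₁.a15⟩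
      · simp [e16]
      · simp [e20]
      · simp [e14, hm₁.a10]
      · simp [e14, hm₁.a10, e20]
      · simp [k1]
      · rintro σ₂ t' - ⟨g1, g2, g3⟩
        refine ⟨g1, ?_, ?_⟩
        · convert g2 using 1
          ext x
          simp [and_assoc]
        · simp only [List.length_cons]
          omega

theorem wp_traceProg {W : ℤ} {G : Graph} (hG : G.WF) (hW : 27 * G.B ≤ W) {σ : Memory}
    (hm : G.Mem σ) {cap pi exc par : ℤ → ℤ} (hd : SearchData G cap pi exc σ)
    (hB : DataBound G cap pi exc) (hp : σ.arr 20 = par) {s v : ℤ} (hs0 : 0 ≤ s) (hsK : s < G.K)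
    {L : List ℤ} (hv0 : 0 ≤ v) (hvK : v < G.K) (h20 : σ.reg 20 = v) (hL : G.Trace par v L s) :
    WP W traceProg σ fun σ' t =>
      σ'.reg 11 = s ∧ IsGreatest {x | x ≤ - exc v ∧ ∀ h ∈ L, x ≤ cap h} (σ'.reg 21) ∧
        t ≤ 10 * L.length + 5 := by
  have hKB := hG.K_le
  have hHB := hG.H_le
  have hB1 := hG.one_le_B
  have b1 := abs_le.1 (hB.exc_le v hv0 hvK)
  have p1 : -1 ≤ par v ∧ par v < G.H := by
    have := hG.H_nonneg
    cases L with
    | nil => exact ⟨hL.2.ge, hL.2.trans_lt (by omega)⟩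
    | cons h' L => exact ⟨hL.1.symm ▸ by have := hL.2.2.1; omega, hL.1.symm ▸ hL.2.2.2.1⟩
  refine WP.seq (WP.load ?_ (WP.sub ?_ (WP.move ?_ (WP.load ?_ (WP.nil ?_)))))
  · simp [h20, hd.a17, abs_le]; omega
  · simp [h20, hd.a17, abs_le, hm.r7]; omega
  · simp [h20, abs_le]; omega
  · simp [h20, hp, abs_le]; omega
  refine WP.mono (wp_traceLoop hG hW hB.cap_nonneg hB.cap_le hs0 hsK L v (-exc v) _
    ?_ ?_ ?_ hL ?_ ?_ ?_) ?_
  · exact ⟨by simp [hm.r4], by simp [hm.r7], by simp [hm.r8], by simp [hm.r9], hm.a10,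
      hm.a11, hm.a12, hm.a13, hm.a14, hm.a15⟩
  · simp [hd.a16]
  · simp [hp]
  · simp [h20]
  · simp [h20, hp]
  · simp [h20, hd.a17, hm.r7]
  · rintro σ₂ t' - ⟨g1, g2, g3⟩
    exact ⟨g1, g2, by omega⟩

end Graph

/-- Copy the part of array `src` that starts at the position in register `21`. -/
def copyLoop (src dst : ℕ) : Program :=
  .loop ⟨8, 11⟩ (block [.sub 11 11 8, .add 22 21 11, .load 17 src 22, .store dst 11 17])

theorem wp_copyLoop {W : ℤ} {src dst : ℕ} (hsd : src ≠ dst) {σ : Memory} (h8 : σ.reg 8 = 1)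
    {N off : ℤ} (h11 : σ.reg 11 = N) (h21 : σ.reg 21 = off) (hN : 0 ≤ N) (hNW : N ≤ W)
    (hoff : ∀ j, 0 ≤ j → j < N → |off + j| ≤ W)
    (hsrc : ∀ j, 0 ≤ j → j < N → |σ.arr src (off + j)| ≤ W) :
    WP W (copyLoop src dst) σ fun σ' t =>
      (∀ j, 0 ≤ j → j < N → σ'.arr dst j = σ.arr src (off + j)) ∧ t ≤ 10 * N.toNat + 1 := by
  refine WP.mono (WP.loop (fun φ σ₁ => 0 ≤ σ₁.reg 11 ∧ σ₁.reg 11 ≤ N ∧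
    φ = 10 * (σ₁.reg 11).toNat ∧ ∀ j, σ₁.reg 11 ≤ j → j < N → σ₁.arr dst j = σ.arr src (off + j))
    (10 * N.toNat) ?_ ?_) ?_
  · rw [h11]
    exact ⟨hN, le_rfl, rfl, fun j h1 h2 => by omega⟩
  · rintro φ σ₁ hf ⟨h1, h2, rfl, hi⟩ hb
    have e8 : σ₁.reg 8 = 1 := (hf.reg 8 (by simp [block, Program.regs])).trans h8
    have e21 : σ₁.reg 21 = off := (hf.reg 21 (by simp [block, Program.regs])).trans h21
    have es : σ₁.arr src = σ.arr src := hf.arr src (by simp [block, Program.arrs, hsd])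
    simp only [e8] at hb
    obtain ⟨v, hv⟩ : ∃ v, σ₁.reg 11 = v + 1 := ⟨σ₁.reg 11 - 1, by ring⟩
    rw [hv] at h1 h2 hb hi
    refine WP.sub ?_ (WP.add ?_ (WP.load ?_ (WP.store ?_ (WP.nil ⟨10 * v.toNat, ?_, by omega⟩))))
    · simp [hv, e8, abs_le]; omega
    · simpa [hv, e8, e21] using hoff v (by omega) (by omega)
    · simpa [hv, e8, e21, es] using hsrc v (by omega) (by omega)
    · simpa [hv, e8, e21, es] using hsrc v (by omega) (by omega)
    · simp [hv, e8, e21, es]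
      refine ⟨by omega, by omega, fun j j1 j2 => ?_⟩
      rcases eq_or_ne j v with rfl | hne
      · simp
      · rw [Function.update_of_ne hne]
        exact hi j (by omega) j2
  · rintro σ' t hf ⟨φ', ⟨h1, h2, rfl, hi⟩, hb, ht⟩
    have e8 : σ'.reg 8 = 1 := (hf.reg 8 (by simp [copyLoop, block, Program.regs])).trans h8
    simp only [e8] at hb
    exact ⟨fun j j1 j2 => hi j (by omega) j2, by omega⟩

/-! ### Updating excesses and residual capacities along a tree path -/

namespace Graph

/-- Take the excess of the root into account, and update the excesses. -/
def settleProg : Program :=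
  .seq (block [.load 19 17 11]) (.seq (.cond ⟨19, 21⟩ (block [.move 21 19]) .skip)
    (block [.sub 19 19 21, .store 17 11 19, .load 19 17 20, .add 19 19 21, .store 17 20 19,
      .sub 10 10 21, .load 14 20 20]))

/-- The root is known only after the trace, so its excess enters the minimum here. The assumption `s
≠ v` keeps the two updates of the excess array apart. -/
theorem wp_settleProg {W B : ℤ} (hW : 27 * B ≤ W) {σ : Memory} {exc : ℤ → ℤ} {s v d b : ℤ}
    (h17 : σ.arr 17 = exc) (h11 : σ.reg 11 = s) (h20 : σ.reg 20 = v) (h21 : σ.reg 21 = d)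
    (hsv : s ≠ v) (hs : 0 ≤ exc s) (hsB : exc s ≤ B) (hv : -B ≤ exc v) (hd0 : 0 ≤ d)
    (hdv : d ≤ -exc v) (h10 : 0 ≤ σ.reg 10) (h10' : σ.reg 10 ≤ B)
    (hb : σ.arr 20 v = b) (hb' : |b| ≤ W) :
    WP W settleProg σ fun σ' t =>
      σ'.reg 21 = min (exc s) d ∧ σ'.reg 10 = σ.reg 10 - min (exc s) d ∧ σ'.reg 14 = b ∧
        σ'.arr 17 = Function.update (Function.update exc s (exc s - min (exc s) d)) v
          (exc v + min (exc s) d) ∧ t ≤ 12 := by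
  refine WP.seq (WP.load ?_ (WP.nil ?_))
  · simp [h11, h17, abs_le]; omega
  refine WP.seq (WP.mono (Q := fun σ₁ t => σ₁.reg 21 = min (exc s) d ∧ t ≤ 2)
    (WP.cond ?_ ?_) ?_)
  · simp [h11, h17, h21]
    intro hd
    refine WP.move ?_ (WP.nil ?_)
    · simp [abs_le]; omega
    · simp; omega
  · simp [h11, h17, h21]
    intro hd
    refine WP.skip ?_
    simp [h21]; omega
  · rintro σ₁ t hf ⟨k1, k2⟩
    have e19 : σ₁.reg 19 = exc s := (hf.reg 19 (by decide)).trans (by simp [h11, h17])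
    have e11 : σ₁.reg 11 = s := (hf.reg 11 (by decide)).trans (by simp [h11])
    have e20 : σ₁.reg 20 = v := (hf.reg 20 (by decide)).trans (by simp [h20])
    have e10 : σ₁.reg 10 = σ.reg 10 := (hf.reg 10 (by decide)).trans (by simp)
    have a17 : σ₁.arr 17 = exc := (hf.arr 17 (by decide)).trans (by simp [h17])
    have a20 : σ₁.arr 20 = σ.arr 20 := (hf.arr 20 (by decide)).trans (by simp)
    refine WP.sub ?_ (WP.store ?_ (WP.load ?_ (WP.add ?_ (WP.store ?_ (WP.sub ?_
      (WP.load ?_ (WP.nil ?_)))))))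
    · simp [e19, k1, abs_le]; omega
    · simp [e19, k1, abs_le]; omega
    · simp [e19, k1, abs_le, a17, e20, e11, Function.update_of_ne hsv.symm]; omega
    · simp [e19, k1, abs_le, a17, e20, e11, Function.update_of_ne hsv.symm]; omega
    · simp [e19, k1, abs_le, a17, e20, e11, Function.update_of_ne hsv.symm]; omega
    · simp [k1, abs_le, e10]; omega
    · simpa [e20, a20, hb] using hb'
    · simp [e19, k1, a17, a20, e20, e10, e11, hb, Function.update_of_ne hsv.symm]
      omega

/-- Send the amount of flow in register `21` along the tree path that ends with the arc in
register `14`. -/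
def pushLoop : Program :=
  .loop ⟨7, 14⟩ (block [.load 17 16 14, .sub 17 17 21, .store 16 14 17, .load 22 13 14,
    .load 17 16 22, .add 17 17 21, .store 16 22 17, .load 11 10 14, .load 14 20 11])

/-- The two conditions on capacities are preserved by every push: nonnegativity because `d` is
available on the arc, and the bound on the sum over an arc and its reverse because that sum does not
change. They keep all values within the word bound. Multiplicities in `L` and in the list of
reverses describe the change without excluding that both an arc and its reverse occur. -/
theorem wp_pushLoop {W : ℤ} {G : Graph} (hG : G.WF) (hW : 27 * G.B ≤ W) {par : ℤ → ℤ} {d s : ℤ}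
    (hd : 0 ≤ d) (hs0 : 0 ≤ s) (hsK : s < G.K) (L : List ℤ) :
    ∀ (v : ℤ) (σ : Memory), G.Mem σ → σ.arr 20 = par → G.Trace par v L s → σ.reg 14 = par v →
      σ.reg 21 = d → (∀ h, 0 ≤ h → h < G.H → 0 ≤ σ.arr 16 h) →
      (∀ h, 0 ≤ h → h < G.H → σ.arr 16 h + σ.arr 16 (G.rv h) ≤ G.B) →
      (∀ h ∈ L, d ≤ σ.arr 16 h) → L.Nodup →
    WP W pushLoop σ fun σ' t =>
      (∀ h, 0 ≤ h → h < G.H → σ'.arr 16 h =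
        σ.arr 16 h - d * L.count h + d * (L.map G.rv).count h) ∧
      (∀ h, 0 ≤ h → h < G.H → 0 ≤ σ'.arr 16 h) ∧
      (∀ h, 0 ≤ h → h < G.H → σ'.arr 16 h + σ'.arr 16 (G.rv h) ≤ G.B) ∧
      t ≤ 10 * L.length + 1 := by
  have hKB := hG.K_le
  have hHB := hG.H_le
  have hB1 := hG.one_le_B
  induction L with
  | nil =>
    rintro v σ hm h20 ⟨rfl, ht⟩ h14 h21 hc0 hcB hL hn
    refine WP.loop_exit ?_ ⟨by simp, hc0, hcB, by simp⟩
    simp only [h14, hm.r7, ht]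
    omega
  | cons h L ih =>
    rintro v σ hm h20 ⟨rfl, ht, h0, hH, hL⟩ h14 h21 hc0 hcB hdL hn
    set g := par v with hg
    set cap := σ.arr 16 with hcap
    have f1 := hG.frm_nonneg _ h0 hH
    have f2 := hG.frm_lt _ h0 hH
    have r1 := hG.rv_nonneg _ h0 hH
    have r2 := hG.rv_lt _ h0 hH
    have rne := hG.rv_ne _ h0 hH
    have c1 := hc0 _ h0 hH
    have c2 := hc0 _ r1 r2
    have c3 := hcB _ h0 hH
    have c4 := hdL _ List.mem_cons_self
    have p1 : -1 ≤ par (G.frm g) ∧ par (G.frm g) < G.H := by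
      cases L with
      | nil => exact ⟨hL.2.ge, hL.2.trans_lt (by omega)⟩
      | cons h' L => exact ⟨hL.1.symm ▸ by have := hL.2.2.1; omega, hL.1.symm ▸ hL.2.2.2.1⟩
    refine WP.loop_step (by simpa only [hm.r7, h14]) (WP.load ?_ (WP.sub ?_ (WP.store ?_
      (WP.load ?_ (WP.load ?_ (WP.add ?_ (WP.store ?_ (WP.load ?_ (WP.load ?_ (WP.nil ?_))))))))))
    · simp [h14, ← hcap, abs_le]; omega
    · simp [h14, ← hcap, h21, abs_le]; omega
    · simp [h14, ← hcap, h21, abs_le]; omega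
    · simp [h14, hm.a13, abs_le]; omega
    · simp [h14, hm.a13, abs_le, ← hcap, Function.update_of_ne rne]; omega
    · simp [h14, h21, hm.a13, abs_le, ← hcap, Function.update_of_ne rne]; omega
    · simp [h14, h21, hm.a13, abs_le, ← hcap, Function.update_of_ne rne]; omega
    · simp [h14, hm.a10, abs_le]; omega
    · simp [h14, hm.a10, h20, abs_le]; omega
    obtain ⟨hn1, hn2⟩ := List.nodup_cons.1 hn
    set cap' := Function.update (Function.update cap g (cap g - d)) (G.rv g) (cap (G.rv g) + d)
      with hcap'
    have hne : ∀ h, h ≠ g → h ≠ G.rv g → cap' h = cap h := fun h k1 k2 => by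
      rw [hcap', Function.update_of_ne k2, Function.update_of_ne k1]
    have hg' : cap' g = cap g - d := by
      rw [hcap', Function.update_of_ne rne.symm, Function.update_self]
    have hr' : cap' (G.rv g) = cap (G.rv g) + d := by
      rw [hcap', Function.update_self]
    -- Only the arc just used loses capacity. As `L` has no repetition, the rest of the path still
    -- admits `d`.
    have hmono : ∀ h, h ≠ g → cap h ≤ cap' h := fun h k1 => by
      rcases eq_or_ne h (G.rv g) with rfl | k2
      · omega
      · rw [hne h k1 k2]
    refine WP.mono (ih (G.frm g) _ ?_ ?_ hL ?_ ?_ ?_ ?_ ?_ hn2) ?_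
    · exact ⟨by simp [hm.r4], by simp [hm.r7], by simp [hm.r8], by simp [hm.r9], hm.a10,
        hm.a11, hm.a12, hm.a13, hm.a14, hm.a15⟩
    · simp [h20]
    · simp [h14, hm.a10, h20]
    · simp [h21]
    · simp [h14, h21, hm.a13, ← hcap, Function.update_of_ne rne, ← hcap']
      intro h k1 k2
      rcases eq_or_ne h g with rfl | k3
      · omega
      · exact (hc0 h k1 k2).trans (hmono h k3)
    · simp [h14, h21, hm.a13, ← hcap, Function.update_of_ne rne, ← hcap']
      intro h k1 k2
      rcases eq_or_ne h g with rfl | k3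
      · omega
      rcases eq_or_ne h (G.rv g) with rfl | k4
      · rw [hG.rv_rv _ h0 hH]
        omega
      rw [hne h k3 k4, hne (G.rv h)]
      · exact hcB h k1 k2
      · intro k5
        exact k4 (by rw [← k5, hG.rv_rv _ k1 k2])
      · intro k5
        exact k3 (by rw [← hG.rv_rv _ k1 k2, k5, hG.rv_rv _ h0 hH])
    · simp [h14, h21, hm.a13, ← hcap, Function.update_of_ne rne, ← hcap']
      intro h k1
      exact (hdL h (List.mem_cons_of_mem _ k1)).trans
        (hmono h (fun k2 => hn1 (k2 ▸ k1)))
    · simp [h14, h21, hm.a13, ← hcap, Function.update_of_ne rne, ← hcap']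
      rintro σ₂ t' - k1 k2 k3 k4
      refine ⟨fun h j1 j2 => ?_, k2, k3, by omega⟩
      rw [k1 h j1 j2]
      rcases eq_or_ne h g with rfl | k5
      · rw [hg', List.count_cons_self, List.count_cons_of_ne rne]
        push_cast
        ring
      rw [List.count_cons_of_ne k5.symm]
      rcases eq_or_ne h (G.rv g) with rfl | k6
      · rw [hr', List.count_cons_self]
        push_cast
        ring
      · rw [List.count_cons_of_ne k6.symm, hne h k5 k6]

/-- Store the flow, given by the residual capacities of the reverse arcs, in arrays `6` and `7`. -/
def copyProg : Program :=
  .seq (block [.move 21 5, .move 11 2]) (.seq (copyLoop 16 6)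
    (.seq (block [.add 21 5 2, .move 11 3]) (copyLoop 16 7)))

theorem wp_copyProg {W B m₁ m₂ M : ℤ} (hW : 27 * B ≤ W) {σ : Memory} (h8 : σ.reg 8 = 1)
    (h2 : σ.reg 2 = m₁) (h3 : σ.reg 3 = m₂) (h5 : σ.reg 5 = M) (hm₁ : 0 ≤ m₁) (hm₂ : 0 ≤ m₂)
    (hM : M = m₁ + m₂) (hMB : M ≤ B) (hB : 1 ≤ B)
    (hcap : ∀ h, M ≤ h → h < M + M → |σ.arr 16 h| ≤ B) :
    WP W copyProg σ fun σ' t =>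
      (∀ j, 0 ≤ j → j < m₁ → σ'.arr 6 j = σ.arr 16 (M + j)) ∧
      (∀ j, 0 ≤ j → j < m₂ → σ'.arr 7 j = σ.arr 16 (M + m₁ + j)) ∧ t ≤ 10 * M.toNat + 6 := by
  have hc : ∀ h, M ≤ h → h < M + M → |σ.arr 16 h| ≤ W := fun h k1 k2 => by
    have := hcap h k1 k2
    omega
  refine WP.seq (WP.move ?_ (WP.move ?_ (WP.nil ?_)))
  · simp [h5, abs_le]; omega
  · simp [h2, abs_le]; omega
  refine WP.seq (WP.mono (wp_copyLoop (N := m₁) (off := M) (by decide) ?_ ?_ ?_ hm₁ (by omega) ?_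
    ?_) ?_)
  · simp [h8]
  · simp [h2]
  · simp [h5]
  · intro j j1 j2
    rw [abs_le]; omega
  · intro j j1 j2
    exact hc _ (by omega) (by omega)
  rintro σ₁ t hf ⟨k1, k2⟩
  have e5 : σ₁.reg 5 = M := (hf.reg 5 (by decide)).trans (by simp [h5])
  have e2 : σ₁.reg 2 = m₁ := (hf.reg 2 (by decide)).trans (by simp [h2])
  have e3 : σ₁.reg 3 = m₂ := (hf.reg 3 (by decide)).trans (by simp [h3])
  have e8 : σ₁.reg 8 = 1 := (hf.reg 8 (by decide)).trans (by simp [h8])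
  have e16 : σ₁.arr 16 = σ.arr 16 := (hf.arr 16 (by decide)).trans (by simp)
  refine WP.seq (WP.add ?_ (WP.move ?_ (WP.nil ?_)))
  · simp [e5, e2, abs_le]; omega
  · simp [e3, abs_le]; omega
  refine WP.mono (wp_copyLoop (N := m₂) (off := M + m₁) (by decide) ?_ ?_ ?_ hm₂ (by omega) ?_
    ?_) ?_
  · simp [e8]
  · simp [e3]
  · simp [e5, e2]
  · intro j j1 j2
    rw [abs_le]; omega
  · intro j j1 j2
    simp only [Memory.arr_setReg, e16]
    exact hc _ (by omega) (by omega)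
  rintro σ₂ t' hf' ⟨k3, k4⟩
  have e6 : σ₂.arr 6 = σ₁.arr 6 := (hf'.arr 6 (by decide)).trans (by simp)
  refine ⟨fun j j1 j2 => ?_, fun j j1 j2 => ?_, by omega⟩
  · rw [e6, k1 j j1 j2]
    simp
  · rw [k3 j j1 j2]
    simp [e16]

end Graph

section

set_option linter.unusedSectionVars false

namespace FlowNetwork

/-! ### Potentials and optimality -/

variable {V A : Type}

/-- Reduced cost of a residual arc. -/
def redCost (N : FlowNetwork V A) (π : V → ℤ) (e : A × Bool) : ℤ :=
  N.resCost e - π (N.resTail e) + π (N.resHead e)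

/-- The reverse of a residual arc. -/
def reverseArc (e : A × Bool) : A × Bool := (e.1, !e.2)

/-- `x` respects the capacities, and no residual arc has negative reduced cost. -/
structure Slack (N : FlowNetwork V A) (x : A → ℤ) (π : V → ℤ) : Prop where
  cap : ∀ e, 0 ≤ N.resCap x e
  red : ∀ e, 0 < N.resCap x e → 0 ≤ N.redCost π e

theorem redCost_reverseArc (N : FlowNetwork V A) (π : V → ℤ) (e : A × Bool) :
    N.redCost π (reverseArc e) = -N.redCost π e := by
  rcases e with ⟨a, _ | _⟩ <;> simp [redCost, reverseArc, resCost, resTail, resHead] <;> ring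

/-- Potentials telescope along a walk. Together with `le_pathCost` this shows that a residual path
of arcs with reduced cost `0` is shortest when `Slack` holds. -/
theorem pathCost_eq {N : FlowNetwork V A} {x : A → ℤ} {π : V → ℤ} {p : List (A × Bool)} :
    ∀ {s t : V}, N.IsResWalk x s p t → (∀ e ∈ p, N.redCost π e = 0) →
      N.pathCost p = π s - π t := by
  induction p with
  | nil =>
    rintro s t h -
    simp only [IsResWalk] at h
    simp [pathCost, h]
  | cons e p ih =>
    rintro s t ⟨rfl, h1, h2⟩ h3
    have h4 := ih h2 (fun e he => h3 e (List.mem_cons_of_mem _ he))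
    have h5 := h3 e List.mem_cons_self
    simp only [pathCost, redCost, List.map_cons, List.sum_cons] at h4 h5 ⊢
    omega

theorem le_pathCost {N : FlowNetwork V A} {x : A → ℤ} {π : V → ℤ} (hx : N.Slack x π)
    {p : List (A × Bool)} : ∀ {s t : V}, N.IsResWalk x s p t → π s - π t ≤ N.pathCost p := by
  induction p with
  | nil =>
    rintro s t h
    simp only [IsResWalk] at h
    simp [pathCost, h]
  | cons e p ih =>
    rintro s t ⟨rfl, h1, h2⟩
    have h4 := ih h2
    have h5 := hx.red e h1
    simp only [pathCost, redCost, List.map_cons, List.sum_cons] at h4 h5 ⊢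
    omega

variable [DecidableEq V] [Fintype A]

theorem sum_fiber_mul [Fintype V] {f : A → V} (y : A → ℝ) (π : V → ℝ) :
    ∑ v, (∑ a with f a = v, y a) * π v = ∑ a, y a * π (f a) := by
  rw [← Finset.sum_fiberwise (s := Finset.univ) (g := f)]
  refine Finset.sum_congr rfl fun v _ => ?_
  rw [Finset.sum_mul]
  refine Finset.sum_congr rfl fun a ha => ?_
  rw [(Finset.mem_filter.1 ha).2]

/-- The Lagrangian: cost plus weighted violation of the balance constraints. -/
theorem lagrangian_eq [Fintype V] (N : FlowNetwork V A) (y : A → ℝ) (π : V → ℤ) :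
    N.totalCost y + ∑ v, (N.supply v + (∑ a with N.head a = v, y a) -
      ∑ a with N.tail a = v, y a) * (π v : ℝ) =
    ∑ a, (N.redCost π (a, true) : ℝ) * y a + ∑ v, (N.supply v : ℝ) * π v := by
  simp only [sub_mul, add_mul, Finset.sum_sub_distrib, Finset.sum_add_distrib]
  rw [sum_fiber_mul (f := N.head) y (fun v => (π v : ℝ)),
    sum_fiber_mul (f := N.tail) y (fun v => (π v : ℝ)), totalCost]
  have : ∑ a, (N.redCost π (a, true) : ℝ) * y a = ∑ a, (N.cost a : ℝ) * y a +
      ∑ a, y a * (π (N.head a) : ℝ) - ∑ a, y a * (π (N.tail a) : ℝ) := by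
    rw [← Finset.sum_add_distrib, ← Finset.sum_sub_distrib]
    refine Finset.sum_congr rfl fun a _ => ?_
    simp only [redCost, resCost, resTail, resHead]
    push_cast
    ring
  rw [this]
  ring

/-- Complementary slackness, arc by arc: negative reduced cost forces `x` to the upper bound,
positive reduced cost forces it to the lower bound, and reduced cost `0` contributes nothing. Hence
`x` minimises every term over the capacity interval. -/
theorem Slack.sum_le {N : FlowNetwork V A} {x : A → ℤ} {π : V → ℤ} (hx : N.Slack x π)
    {y : A → ℝ} (hy : ∀ a, (N.lower a : ℝ) ≤ y a ∧ y a ≤ N.upper a) :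
    ∑ a, (N.redCost π (a, true) : ℝ) * (x a : ℝ) ≤ ∑ a, (N.redCost π (a, true) : ℝ) * y a := by
  refine Finset.sum_le_sum fun a _ => ?_
  obtain ⟨h1, h2⟩ := hy a
  have c1 := hx.cap (a, true)
  have c2 := hx.cap (a, false)
  have r1 := hx.red (a, true)
  have r2 := hx.red (a, false)
  have hf : N.redCost π (a, false) = -N.redCost π (a, true) := N.redCost_reverseArc π (a, true)
  simp only [resCap] at c1 c2 r1 r2
  rcases lt_trichotomy (N.redCost π (a, true)) 0 with h | h | h
  · have hxa : x a = N.upper a := by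
      by_contra hne
      have := r1 (by omega)
      omega
    rw [hxa]
    exact mul_le_mul_of_nonpos_left h2 (by exact_mod_cast h.le)
  · simp [h]
  · have hxa : x a = N.lower a := by
      by_contra hne
      have := r2 (by omega)
      omega
    rw [hxa]
    exact mul_le_mul_of_nonneg_left h1 (by exact_mod_cast h.le)

/-- Value of the Lagrangian. -/
def lagrangian [Fintype V] (N : FlowNetwork V A) (x : A → ℤ) (π : V → ℤ) : ℤ :=
  ∑ a, N.cost a * x a + ∑ v, N.excess x v * π v

theorem lagrangian_cast [Fintype V] (N : FlowNetwork V A) (x : A → ℤ) (π : V → ℤ) :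
    (N.lagrangian x π : ℝ) =
      ∑ a, (N.redCost π (a, true) : ℝ) * (x a : ℝ) + ∑ v, (N.supply v : ℝ) * π v := by
  rw [← lagrangian_eq]
  simp only [lagrangian, totalCost, excess]
  push_cast
  rfl

/-- Weak duality: the balance terms vanish for the feasible flow `y`, so its cost is its Lagrangian
value, and `x` minimises the Lagrangian over the capacities. -/
theorem Slack.lagrangian_le [Fintype V] {N : FlowNetwork V A} {x : A → ℤ} {π : V → ℤ}
    (hx : N.Slack x π) {y : A → ℝ} (hy : N.IsFeasible y) :
    (N.lagrangian x π : ℝ) ≤ N.totalCost y := by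
  have h := N.lagrangian_eq y π
  have h0 : ∀ v, (N.supply v + (∑ a with N.head a = v, y a) -
      ∑ a with N.tail a = v, y a : ℝ) = 0 := fun v => by
    rw [← hy.1 v]
    ring
  simp only [h0, zero_mul, Finset.sum_const_zero, add_zero] at h
  rw [h, lagrangian_cast]
  have := hx.sum_le hy.2
  linarith

theorem Slack.isFeasible {N : FlowNetwork V A} {x : A → ℤ} {π : V → ℤ} (hx : N.Slack x π)
    (he : ∀ v, N.excess x v = 0) : N.IsFeasible fun a => (x a : ℝ) := by
  refine ⟨fun v => ?_, fun a => ?_⟩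
  · have := he v
    simp only [excess] at this
    have h : (∑ a with N.tail a = v, x a) - (∑ a with N.head a = v, x a) = N.supply v := by
      omega
    beta_reduce
    exact_mod_cast h
  · have c1 := hx.cap (a, true)
    have c2 := hx.cap (a, false)
    simp only [resCap] at c1 c2
    have h1 : N.lower a ≤ x a := by omega
    have h2 : x a ≤ N.upper a := by omega
    exact ⟨Int.cast_le.2 h1, Int.cast_le.2 h2⟩

/-- Without excess the Lagrangian value of `x` is its cost, so weak duality becomes optimality. -/
theorem Slack.isMinCostFlow [Fintype V] {N : FlowNetwork V A} {x : A → ℤ} {π : V → ℤ}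
    (hx : N.Slack x π) (he : ∀ v, N.excess x v = 0) :
    N.IsMinCostFlow fun a => (x a : ℝ) := by
  refine ⟨hx.isFeasible he, fun y hy => ?_⟩
  have h := hx.lagrangian_le hy
  simpa [lagrangian, he, totalCost] using h

/-! ### Raising potentials -/

/-- The potential raised by `1` on the nodes in `R`. -/
def raise (π : V → ℤ) (R : V → Prop) [DecidablePred R] (v : V) : ℤ := π v + if R v then 1 else 0

/-- Only residual arcs from `R` to its complement lose reduced cost, and they lose `1`. By the
closure of `R` their reduced cost is positive, hence at least `1` by integrality. -/
theorem Slack.raise {N : FlowNetwork V A} {x : A → ℤ} {π : V → ℤ} (hx : N.Slack x π)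
    {R : V → Prop} [DecidablePred R] (hR : ∀ e, R (N.resTail e) → 0 < N.resCap x e →
      N.redCost π e ≤ 0 → R (N.resHead e)) : N.Slack x (raise π R) where
  cap := hx.cap
  red e he := by
    have h1 := hx.red e he
    have h2 := fun h => hR e h he
    simp only [redCost, FlowNetwork.raise] at *
    split_ifs with h3 h4 h4
    · omega
    · have := mt (h2 h3) h4
      omega
    · omega
    · omega

/-- The increase is the total excess in `R`. No node of `R` has demand and every node with positive
excess lies in `R`, so the increase is at least the excess of `s`. With weak duality this bounds the
number of raises over the entire run, not only within one iteration. -/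
theorem lagrangian_raise [Fintype V] (N : FlowNetwork V A) (x : A → ℤ) (π : V → ℤ)
    {R : V → Prop} [DecidablePred R] (h1 : ∀ v, 0 < N.excess x v → R v)
    (h2 : ∀ v, N.excess x v < 0 → ¬R v) {s : V} (hs : 0 < N.excess x s) :
    N.lagrangian x π + 1 ≤ N.lagrangian x (raise π R) := by
  simp only [lagrangian, raise, mul_add, Finset.sum_add_distrib]
  have h3 : ∀ v, 0 ≤ N.excess x v * (if R v then 1 else 0) := fun v => by
    split_ifs with h
    · have := mt (h2 v) (not_not.2 h)
      omega
    · simp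
  have h4 := Finset.single_le_sum (fun v _ => h3 v) (Finset.mem_univ s)
  rw [if_pos (h1 s hs)] at h4
  omega

/-! ### Augmentation -/

variable [DecidableEq A]

theorem resCap_augment {N : FlowNetwork V A} (x : A → ℤ) (p : List (A × Bool)) (δ : ℤ)
    (e : A × Bool) : N.resCap (augment x p δ) e =
      N.resCap x e - (if e ∈ p then δ else 0) + (if reverseArc e ∈ p then δ else 0) := by
  rcases e with ⟨a, _ | _⟩ <;> simp only [resCap, augment, reverseArc, Bool.not_true, Bool.not_false] <;>
    ring

theorem augment_cons (x : A → ℤ) (e : A × Bool) (p : List (A × Bool)) (he : e ∉ p) (δ : ℤ)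
    (a : A) : augment x (e :: p) δ a =
      augment x p δ a + (if a = e.1 then (if e.2 then δ else -δ) else 0) := by
  rcases e with ⟨b, _ | _⟩ <;> rcases eq_or_ne a b with rfl | h <;>
    simp_all [augment] <;> ring

theorem excess_augment_cons {N : FlowNetwork V A} (x : A → ℤ) (e : A × Bool)
    (p : List (A × Bool)) (he : e ∉ p) (δ : ℤ) (v : V) :
    N.excess (augment x (e :: p) δ) v = N.excess (augment x p δ) v +
      (if N.resHead e = v then δ else 0) - (if N.resTail e = v then δ else 0) := by
  simp only [excess, augment_cons x e p he, Finset.sum_add_distrib, Finset.sum_ite_eq',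
    Finset.mem_filter, Finset.mem_univ, true_and]
  rcases e with ⟨b, _ | _⟩
  · change _ = _ + (if N.tail b = v then δ else 0) - (if N.head b = v then δ else 0)
    dsimp only
    by_cases h1 : N.tail b = v <;> by_cases h2 : N.head b = v <;> simp [h1, h2] <;> ring
  · change _ = _ + (if N.head b = v then δ else 0) - (if N.tail b = v then δ else 0)
    dsimp only
    by_cases h1 : N.tail b = v <;> by_cases h2 : N.head b = v <;> simp [h1, h2] <;> ring

/-- The contributions of consecutive arcs cancel at the intermediate nodes, so only the two ends of
the walk change. -/
theorem excess_augment {N : FlowNetwork V A} {x : A → ℤ} (δ : ℤ) (v : V) {p : List (A × Bool)} :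
    ∀ {s t : V}, N.IsResWalk x s p t → p.Nodup →
      N.excess (augment x p δ) v = N.excess x v - (if s = v then δ else 0) +
        (if t = v then δ else 0) := by
  induction p with
  | nil =>
    rintro s t h -
    simp only [IsResWalk] at h
    simp [h, augment, excess]
  | cons e p ih =>
    rintro s t ⟨rfl, h1, h2⟩ h3
    obtain ⟨h4, h5⟩ := List.nodup_cons.1 h3
    rw [excess_augment_cons x e p h4, ih h2 h5]
    ring

/-- The only residual arcs that can be new are reverses of arcs of `p`, and these have reduced cost
`0`. -/
theorem Slack.augment {N : FlowNetwork V A} {x : A → ℤ} {π : V → ℤ} (hx : N.Slack x π)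
    {p : List (A × Bool)} {δ : ℤ} (hδ : 0 ≤ δ) (hp : ∀ e ∈ p, δ ≤ N.resCap x e)
    (h0 : ∀ e ∈ p, N.redCost π e = 0) : N.Slack (augment x p δ) π where
  cap e := by
    have h1 := hx.cap e
    have h2 := hp e
    rw [resCap_augment]
    split_ifs with h3 h4 h4
    · omega
    · have := h2 h3
      omega
    · omega
    · omega
  red e he := by
    by_cases h : reverseArc e ∈ p
    · have := h0 _ h
      rw [redCost_reverseArc] at this
      omega
    · rw [resCap_augment, if_neg h] at he
      refine hx.red e ?_
      split_ifs at he
      · omega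
      · omega

/-- In the form weighted by reduced costs, the flow changes only on arcs of weight `0`. -/
theorem lagrangian_augment [Fintype V] {N : FlowNetwork V A} {x : A → ℤ} {π : V → ℤ}
    {p : List (A × Bool)} {δ : ℤ} (h0 : ∀ e ∈ p, N.redCost π e = 0) :
    N.lagrangian (augment x p δ) π = N.lagrangian x π := by
  have h : (N.lagrangian (FlowNetwork.augment x p δ) π : ℝ) = N.lagrangian x π := by
    rw [lagrangian_cast, lagrangian_cast]
    congr 1
    refine Finset.sum_congr rfl fun a _ => ?_
    by_cases hr : N.redCost π (a, true) = 0
    · simp [hr]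
    · have h1 : (a, true) ∉ p := fun h => hr (h0 _ h)
      have h2 : (a, false) ∉ p := fun h => hr (by
        have := h0 _ h
        rw [show (a, false) = reverseArc (a, true) from rfl, redCost_reverseArc] at this
        omega)
      simp [FlowNetwork.augment, h1, h2]
  exact_mod_cast h

/-- Total supply that is not yet sent on. -/
def remaining [Fintype V] (N : FlowNetwork V A) (x : A → ℤ) : ℤ := ∑ v, max (N.excess x v) 0

theorem excess_nonpos_of_remaining [Fintype V] {N : FlowNetwork V A} {x : A → ℤ}
    (h : N.remaining x ≤ 0) (v : V) : N.excess x v ≤ 0 := by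
  have := Finset.single_le_sum (f := fun v => max (N.excess x v) 0) (fun v _ => le_max_right _ _)
    (Finset.mem_univ v)
  simp only [remaining] at h
  omega

theorem sum_excess [Fintype V] (N : FlowNetwork V A) (x : A → ℤ) :
    ∑ v, N.excess x v = ∑ v, N.supply v := by
  simp only [excess, Finset.sum_sub_distrib, Finset.sum_add_distrib]
  rw [Finset.sum_fiberwise, Finset.sum_fiberwise]
  ring

/-- `remaining` counts only positive excess. As the excesses sum to the supplies, that is to `0`,
there is then no demand left either. -/
theorem excess_eq_zero [Fintype V] {N : FlowNetwork V A} {x : A → ℤ} (hN : ∑ v, N.supply v = 0)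
    (h : N.remaining x ≤ 0) (v : V) : N.excess x v = 0 := by
  have h1 := N.sum_excess x
  rw [hN] at h1
  exact (Finset.sum_eq_zero_iff_of_nonpos fun v _ => excess_nonpos_of_remaining h v).1 h1 v
    (Finset.mem_univ v)

/-- The amount `δ` exceeds neither the excess of `s` nor the demand of `t`, so neither end changes
sign and the positive part drops only at `s`, by `δ`. -/
theorem remaining_augment [Fintype V] {N : FlowNetwork V A} {x : A → ℤ} {s t : V}
    {p : List (A × Bool)} (hp : N.IsResWalk x s p t) (hn : p.Nodup) {δ : ℤ} (h0 : 0 < δ)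
    (hs : δ ≤ N.excess x s) (ht : δ ≤ -N.excess x t) :
    N.remaining (augment x p δ) = N.remaining x - δ := by
  have hst : s ≠ t := fun h => by
    subst h
    omega
  have h : ∀ v, max (N.excess (FlowNetwork.augment x p δ) v) 0 =
      max (N.excess x v) 0 - if s = v then δ else 0 := fun v => by
    rw [excess_augment δ v hp hn]
    split_ifs with h1 h2 h2
    · exact absurd (h1.trans h2.symm) hst
    · subst h1
      omega
    · subst h2
      omega
    · omega
  simp only [remaining, h, Finset.sum_sub_distrib]
  simp

end FlowNetwork

end

section

open FlowNetwork

set_option linter.unusedSectionVars false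

variable {V A : Type} [DecidableEq V] [Fintype V] [Fintype A] [DecidableEq A]

/-! ### One iteration of the main loop -/

/-- The graph `G` represents the residual arcs of the network `N`: `ix` numbers the nodes, `ed`
lists the residual arcs that can ever have positive capacity. The number `U` bounds the optimal
cost. -/
structure Represents (N : FlowNetwork V A) (G : Graph) (ix : V → ℤ) (ed : ℤ → A × Bool) (U : ℤ) :
    Prop where
  wf : G.WF
  ix_nonneg : ∀ v, 0 ≤ ix v
  ix_lt : ∀ v, ix v < G.K
  ix_inj : Function.Injective ix
  ix_surj : ∀ i, 0 ≤ i → i < G.K → ∃ v, ix v = i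
  ed_inj : ∀ h, 0 ≤ h → h < G.H → ∀ h', 0 ≤ h' → h' < G.H → ed h = ed h' → h = h'
  ed_surj : ∀ e, N.lower e.1 < N.upper e.1 → ∃ h, 0 ≤ h ∧ h < G.H ∧ ed h = e
  ed_rv : ∀ h, 0 ≤ h → h < G.H → ed (G.rv h) = reverseArc (ed h)
  frm_eq : ∀ h, 0 ≤ h → h < G.H → G.frm h = ix (N.resTail (ed h))
  tgt_eq : ∀ h, 0 ≤ h → h < G.H → G.tgt h = ix (N.resHead (ed h))
  cst_eq : ∀ h, 0 ≤ h → h < G.H → G.cst h = N.resCost (ed h)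
  cap_le : ∀ a, N.upper a - N.lower a ≤ G.B
  U_le : U ≤ G.B
  feasible : ∃ y, N.IsFeasible y ∧ N.totalCost y ≤ U

/-- The memory holds the flow `x` and the potential `π`. -/
structure Holds (N : FlowNetwork V A) (G : Graph) (ix : V → ℤ) (ed : ℤ → A × Bool) (σ : Memory)
    (x : A → ℤ) (π : V → ℤ) : Prop where
  cap : ∀ h, 0 ≤ h → h < G.H → σ.arr 16 h = N.resCap x (ed h)
  exc : ∀ v, σ.arr 17 (ix v) = N.excess x v
  pi : ∀ v, σ.arr 18 (ix v) = π v
  slack : N.Slack x π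
  pi_nonneg : ∀ v, 0 ≤ π v
  pi_le : ∀ v, π v ≤ N.lagrangian x π
  exc_le : ∀ v, |N.excess x v| ≤ G.B

section

variable {N : FlowNetwork V A} {G : Graph} {ix : V → ℤ} {ed : ℤ → A × Bool} {U : ℤ} {σ : Memory}
  {x : A → ℤ} {π : V → ℤ}

theorem Represents.lagrangian_le (hR : Represents N G ix ed U) (hx : N.Slack x π) :
    N.lagrangian x π ≤ U := by
  obtain ⟨y, hy, hyU⟩ := hR.feasible
  have := (hx.lagrangian_le hy).trans hyU
  exact_mod_cast this

theorem Slack.resCap_le (hx : N.Slack x π) (e : A × Bool) :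
    N.resCap x e ≤ N.upper e.1 - N.lower e.1 := by
  have c1 := hx.cap (e.1, true)
  have c2 := hx.cap (e.1, false)
  rcases e with ⟨a, _ | _⟩ <;> simp only [resCap] at * <;> omega

/-- The potentials fit into words because each is at most the Lagrangian, which weak duality bounds
by `U`. The comparison survives a raise: a potential grows by at most `1`, the Lagrangian by at
least `1`. -/
theorem Holds.dataBound (hR : Represents N G ix ed U) (hs : Holds N G ix ed σ x π) :
    Graph.DataBound G (σ.arr 16) (σ.arr 18) (σ.arr 17) where
  cap_nonneg h h1 h2 := by
    rw [hs.cap h h1 h2]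
    exact hs.slack.cap _
  cap_le h h1 h2 := by
    rw [hs.cap h h1 h2]
    exact (Slack.resCap_le hs.slack _).trans (hR.cap_le _)
  exc_le v h1 h2 := by
    obtain ⟨v, rfl⟩ := hR.ix_surj v h1 h2
    rw [hs.exc]
    exact hs.exc_le v
  pi_nonneg v h1 h2 := by
    obtain ⟨v, rfl⟩ := hR.ix_surj v h1 h2
    rw [hs.pi]
    exact hs.pi_nonneg v
  pi_le v h1 h2 := by
    obtain ⟨v, rfl⟩ := hR.ix_surj v h1 h2
    rw [hs.pi]
    exact (hs.pi_le v).trans ((hR.lagrangian_le hs.slack).trans hR.U_le)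

theorem Holds.adm_iff (hR : Represents N G ix ed U) (hs : Holds N G ix ed σ x π) {h : ℤ}
    (h1 : 0 ≤ h) (h2 : h < G.H) : G.Adm (σ.arr 16) (σ.arr 18) h ↔
      0 < N.resCap x (ed h) ∧ N.redCost π (ed h) ≤ 0 := by
  rw [Graph.Adm, hs.cap h h1 h2, hR.frm_eq h h1 h2, hR.tgt_eq h h1 h2, hR.cst_eq h h1 h2, hs.pi,
    hs.pi, redCost]

theorem Represents.exists_ed (hR : Represents N G ix ed U) (hx : N.Slack x π) {e : A × Bool}
    (he : 0 < N.resCap x e) : ∃ h, 0 ≤ h ∧ h < G.H ∧ ed h = e :=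
  hR.ed_surj e (by have := Slack.resCap_le hx e; omega)

/-- The set of visited nodes meets the requirements for a raise: it contains the nodes with excess
as roots, `hneg` keeps it free of demand, and the completed search closes it under admissible arcs.
-/
theorem Holds.raise (hR : Represents N G ix ed U) (hs : Holds N G ix ed σ x π) {pos par : ℤ → ℤ}
    (hl : Graph.Labels G (σ.arr 16) (σ.arr 18) (σ.arr 17) pos par)
    (hneg : ∀ v, 0 ≤ v → v < G.K → σ.arr 17 v < 0 → pos v ≤ 0) (hrem : 0 < N.remaining x)
    {σ' : Memory} (h16 : σ'.arr 16 = σ.arr 16) (h17 : σ'.arr 17 = σ.arr 17)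
    (h18 : ∀ v, 0 ≤ v → v < G.K → σ'.arr 18 v = σ.arr 18 v + if 0 < pos v then 1 else 0) :
    ∃ π', Holds N G ix ed σ' x π' ∧ N.lagrangian x π + 1 ≤ N.lagrangian x π' := by
  have hL : N.lagrangian x π + 1 ≤ N.lagrangian x (FlowNetwork.raise π fun v => 0 < pos (ix v)) := by
    obtain ⟨s, hs0⟩ : ∃ s, 0 < N.excess x s := by
      by_contra! hne
      have : N.remaining x = 0 := Finset.sum_eq_zero fun v _ => max_eq_right (hne v)
      omega
    refine N.lagrangian_raise x π (fun v hv => ?_) (fun v hv => ?_) hs0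
    · exact hl.roots _ (hR.ix_nonneg v) (hR.ix_lt v) (by rwa [hs.exc])
    · exact not_lt.2 (hneg _ (hR.ix_nonneg v) (hR.ix_lt v) (by rwa [hs.exc]))
  refine ⟨FlowNetwork.raise π fun v => 0 < pos (ix v), ⟨?_, ?_, ?_, ?_, ?_, ?_, hs.exc_le⟩, hL⟩
  · rw [h16]
    exact hs.cap
  · rw [h17]
    exact hs.exc
  · intro v
    rw [h18 _ (hR.ix_nonneg v) (hR.ix_lt v), hs.pi]
    rfl
  · refine hs.slack.raise fun e h1 h2 h3 => ?_
    obtain ⟨h, k1, k2, rfl⟩ := hR.exists_ed hs.slack h2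
    rw [← hR.tgt_eq h k1 k2]
    rw [← hR.frm_eq h k1 k2] at h1
    exact hl.closed h k1 k2 h1 ((hs.adm_iff hR k1 k2).2 ⟨h2, h3⟩)
  · intro v
    have := hs.pi_nonneg v
    simp only [FlowNetwork.raise]
    split_ifs <;> omega
  · intro v
    have := hs.pi_le v
    have h : FlowNetwork.raise π (fun v => 0 < pos (ix v)) v ≤ π v + 1 := by
      simp only [FlowNetwork.raise]
      split_ifs <;> omega
    omega

end

theorem isResWalk_append {N : FlowNetwork V A} {x : A → ℤ} {e : A × Bool} {p : List (A × Bool)} :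
    ∀ {s : V}, N.IsResWalk x s p (N.resTail e) → 0 < N.resCap x e →
      N.IsResWalk x s (p ++ [e]) (N.resHead e) := by
  induction p with
  | nil =>
    rintro s h1 h2
    exact ⟨h1.symm, h2, rfl⟩
  | cons f p ih =>
    rintro s ⟨h1, h2, h3⟩ h4
    exact ⟨h1, h2, ih h3 h4⟩

namespace Graph

/-- The trace lists nodes as tails, whereas `IsResPath` lists them as heads after the start. The
equation transfers distinctness from one form to the other. -/
theorem Trace.nodes {G : Graph} {par : ℤ → ℤ} {s : ℤ} {L : List ℤ} :
    ∀ {v : ℤ}, G.Trace par v L s → v :: L.map G.frm = L.map G.tgt ++ [s] := by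
  induction L with
  | nil =>
    rintro v ⟨rfl, -⟩
    simp
  | cons h L ih =>
    rintro v ⟨-, rfl, -, -, hL⟩
    simp [ih hL]

theorem Trace.mem_range {G : Graph} {par : ℤ → ℤ} {s : ℤ} {L : List ℤ} :
    ∀ {v : ℤ}, G.Trace par v L s → ∀ h ∈ L, 0 ≤ h ∧ h < G.H := by
  induction L with
  | nil => simp
  | cons h L ih =>
    rintro v ⟨-, -, h0, hH, hL⟩ g hg
    rcases List.mem_cons.1 hg with rfl | hg
    · exact ⟨h0, hH⟩
    · exact ih hL g hg

theorem Trace.isResWalk {N : FlowNetwork V A} {G : Graph} {ix : V → ℤ} {ed : ℤ → A × Bool} {U : ℤ}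
    (hR : Represents N G ix ed U) {x : A → ℤ} {par : ℤ → ℤ} {s : V} {L : List ℤ} :
    ∀ {v : V}, G.Trace par (ix v) L (ix s) → (∀ h ∈ L, 0 < N.resCap x (ed h)) →
      N.IsResWalk x s (L.map ed).reverse v := by
  induction L with
  | nil =>
    rintro v ⟨h, -⟩ -
    exact (hR.ix_inj h).symm
  | cons h L ih =>
    rintro v ⟨-, hv, h0, hH, hL⟩ hc
    rw [hR.frm_eq h h0 hH] at hL
    rw [hR.tgt_eq h h0 hH] at hv
    rw [List.map_cons, List.reverse_cons, ← hR.ix_inj hv]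
    exact isResWalk_append (ih hL fun g hg => hc g (List.mem_cons_of_mem _ hg))
      (hc h List.mem_cons_self)

theorem Trace.nodup {N : FlowNetwork V A} {G : Graph} {ix : V → ℤ} {ed : ℤ → A × Bool} {U : ℤ}
    (hR : Represents N G ix ed U) {par : ℤ → ℤ} {s v : V} {L : List ℤ}
    (hL : G.Trace par (ix v) L (ix s)) (hn : (ix v :: L.map G.frm).Nodup) :
    (s :: (L.map ed).reverse.map N.resHead).Nodup := by
  rw [hL.nodes] at hn
  have h1 : L.map G.tgt = (L.map fun h => N.resHead (ed h)).map ix := by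
    rw [List.map_map]
    refine List.map_congr_left fun h hh => ?_
    obtain ⟨k1, k2⟩ := hL.mem_range h hh
    exact hR.tgt_eq h k1 k2
  rw [h1, show [ix s] = [s].map ix from rfl, ← List.map_append] at hn
  have h2 := List.nodup_reverse.2 hn.of_map
  rw [List.reverse_append] at h2
  simpa [List.map_reverse, Function.comp_def] using h2

end Graph

/-- Search from the nodes with excess, raising potentials until a node with unfulfilled demand is
reached. -/
def phaseProg : Program :=
  .seq (block [.move 20 9]) (.loop ⟨20, 9⟩ (.seq Graph.searchProg (.seq Graph.findProg
    (.cond ⟨20, 9⟩ Graph.raiseProg .skip))))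

/-- Size of the network. -/
def Graph.size (G : Graph) : ℕ := G.H.toNat + G.K.toNat + 1

/-- The distance of the Lagrangian from `U` is a store of time that is shared by all iterations:
each unsuccessful round is paid by its raise, and only the last, successful round costs a further
`60 * G.size`. No reachability argument is needed, since the bounded Lagrangian excludes an endless
series of failures. -/
theorem wp_phaseProg {W : ℤ} {N : FlowNetwork V A} {G : Graph} {ix : V → ℤ} {ed : ℤ → A × Bool}
    {U : ℤ} (hR : Represents N G ix ed U) (hW : 27 * G.B ≤ W) {σ : Memory} {x : A → ℤ} {π : V → ℤ}
    (hm : G.Mem σ) (hs : Holds N G ix ed σ x π) (hrem : 0 < N.remaining x) :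
    WP W phaseProg σ fun σ' t => ∃ π', Holds N G ix ed σ' x π' ∧
      Graph.Labels G (σ'.arr 16) (σ'.arr 18) (σ'.arr 17) (σ'.arr 19) (σ'.arr 20) ∧
      0 ≤ σ'.reg 20 ∧ σ'.reg 20 < G.K ∧ σ'.arr 17 (σ'.reg 20) < 0 ∧
      0 < σ'.arr 19 (σ'.reg 20) ∧
      t + 60 * G.size * (U - N.lagrangian x π').toNat ≤
        60 * G.size * (U - N.lagrangian x π).toNat + 60 * G.size + 2 := by
  have hB1 := hR.wf.one_le_B
  refine WP.seq (WP.move ?_ (WP.nil ?_))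
  · simp [hm.r9]; omega
  have hm' : G.Mem (σ.setReg 20 (σ.reg 9)) :=
    ⟨by simp [hm.r4], by simp [hm.r7], by simp [hm.r8], by simp [hm.r9], hm.a10,
      hm.a11, hm.a12, hm.a13, hm.a14, hm.a15⟩
  -- The value `-1` in register `20` means that no node with demand has been reached. The additional
  -- `60 * G.size` is kept for the successful search and spent on entering the second case.
  refine WP.mono (WP.loop (fun φ σ₁ => ∃ π', Holds N G ix ed σ₁ x π' ∧
    ((σ₁.reg 20 ≤ -1 ∧ φ = 60 * G.size * (U - N.lagrangian x π').toNat + 60 * G.size) ∨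
    (Graph.Labels G (σ₁.arr 16) (σ₁.arr 18) (σ₁.arr 17) (σ₁.arr 19) (σ₁.arr 20) ∧
      0 ≤ σ₁.reg 20 ∧ σ₁.reg 20 < G.K ∧ σ₁.arr 17 (σ₁.reg 20) < 0 ∧ 0 < σ₁.arr 19 (σ₁.reg 20) ∧
      φ = 60 * G.size * (U - N.lagrangian x π').toNat)))
    (60 * G.size * (U - N.lagrangian x π).toNat + 60 * G.size) ?_ ?_) ?_
  · exact ⟨π, ⟨hs.cap, hs.exc, hs.pi, hs.slack, hs.pi_nonneg, hs.pi_le, hs.exc_le⟩,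
      Or.inl ⟨by simp [hm.r9], rfl⟩⟩
  · rintro φ σ₁ hf ⟨π₁, h1, h2⟩ hb
    have hm₁ : G.Mem σ₁ := hm'.frame hf (by decide) (by decide)
    simp only [hm₁.r9] at hb
    rcases h2 with ⟨-, rfl⟩ | ⟨-, h3, -⟩
    swap
    · omega
    have hd := h1.dataBound hR
    refine WP.seq (WP.mono (Graph.wp_searchProg hR.wf hW hm₁ ⟨rfl, rfl, rfl⟩ hd) ?_)
    rintro σ₂ t₂ hf₂ ⟨hl, ht₂⟩
    have hm₂ : G.Mem σ₂ := hm₁.frame hf₂ (by decide) (by decide)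
    have e16 : σ₂.arr 16 = σ₁.arr 16 := hf₂.arr 16 (by decide)
    have e17 : σ₂.arr 17 = σ₁.arr 17 := hf₂.arr 17 (by decide)
    have e18 : σ₂.arr 18 = σ₁.arr 18 := hf₂.arr 18 (by decide)
    refine WP.seq (WP.mono (Graph.wp_findProg hR.wf hW hm₂ e17 rfl hd.exc_le hl.pos_nonneg
      hl.pos_le) ?_)
    rintro σ₃ t₃ hf₃ ⟨hfind, ht₃⟩
    have hm₃ : G.Mem σ₃ := hm₂.frame hf₃ (by decide) (by decide)
    have g16 : σ₃.arr 16 = σ₁.arr 16 := (hf₃.arr 16 (by decide)).trans e16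
    have g17 : σ₃.arr 17 = σ₁.arr 17 := (hf₃.arr 17 (by decide)).trans e17
    have g18 : σ₃.arr 18 = σ₁.arr 18 := (hf₃.arr 18 (by decide)).trans e18
    have g19 : σ₃.arr 19 = σ₂.arr 19 := hf₃.arr 19 (by decide)
    have g20 : σ₃.arr 20 = σ₂.arr 20 := hf₃.arr 20 (by decide)
    have hsize : G.size = G.H.toNat + G.K.toNat + 1 := rfl
    have hU := hR.lagrangian_le h1.slack
    refine WP.cond ?_ ?_
    · simp only [hm₃.r9]
      intro h20
      rcases hfind with ⟨-, hneg⟩ | ⟨h3, -⟩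
      swap
      · omega
      refine WP.mono (Graph.wp_raiseProg hR.wf hW hm₃ g18 g19 (fun v v1 v2 => ?_) hl.pos_nonneg
        hl.pos_le) ?_
      · rw [abs_of_nonneg (hd.pi_nonneg v v1 v2)]
        exact hd.pi_le v v1 v2
      rintro σ₄ t₄ hf₄ ⟨k1, ht₄⟩
      obtain ⟨π₂, hh, hlag⟩ := h1.raise hR hl hneg hrem ((hf₄.arr 16 (by decide)).trans g16)
        ((hf₄.arr 17 (by decide)).trans g17) k1
      have hU' := hR.lagrangian_le hh.slack
      refine ⟨_, ⟨π₂, hh, Or.inl ⟨?_, rfl⟩⟩, ?_⟩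
      · have : σ₄.reg 20 = σ₃.reg 20 := hf₄.reg 20 (by decide)
        omega
      -- The gain of at least `1` in the Lagrangian releases `60 * G.size` units, enough for
      -- searching, finding and raising.
      · have : (U - N.lagrangian x π₂).toNat + 1 ≤ (U - N.lagrangian x π₁).toNat := by omega
        have := Nat.mul_le_mul_left (60 * G.size) this
        rw [mul_add, mul_one] at this
        omega
    · simp only [hm₃.r9]
      intro h20
      rcases hfind with ⟨h3, -⟩ | ⟨h3, h4, h5, h6⟩
      · omega
      refine WP.skip ⟨_, ⟨π₁, ⟨?_, ?_, ?_, h1.slack, h1.pi_nonneg, h1.pi_le, h1.exc_le⟩,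
        Or.inr ⟨?_, h3, h4, ?_, ?_, rfl⟩⟩, ?_⟩
      · rw [g16]; exact h1.cap
      · rw [g17]; exact h1.exc
      · rw [g18]; exact h1.pi
      · rw [g16, g17, g18, g19, g20]; exact hl
      · rw [g17]; exact h5
      · rw [g19]; exact h6
      · omega
  · rintro σ' t hf ⟨φ', ⟨π', h1, h2⟩, hb, ht⟩
    have hm₁ : G.Mem σ' := hm'.frame hf (by decide) (by decide)
    simp only [hm₁.r9] at hb
    rcases h2 with ⟨h3, -⟩ | ⟨h3, h4, h5, h6, h7, rfl⟩
    · omega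
    · exact ⟨π', h1, h3, h4, h5, h6, h7, by omega⟩

end

/-! ### Augmentation in memory, and one complete iteration -/

section

open FlowNetwork

set_option linter.unusedSectionVars false

variable {V A : Type} [DecidableEq V] [Fintype V] [Fintype A] [DecidableEq A]

/-- Send flow along the tree path to the node in register `20`. -/
def augmentProg : Program :=
  .seq Graph.traceProg (.seq Graph.settleProg (.seq Graph.pushLoop Graph.copyProg))

/-- Registers `2`, `3`, `5` hold the numbers of arcs of two kinds and their sum. -/
structure Counts (G : Graph) (m₁ m₂ : ℤ) (σ : Memory) : Prop where
  r2 : σ.reg 2 = m₁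
  r3 : σ.reg 3 = m₂
  r5 : σ.reg 5 = m₁ + m₂
  m₁_nonneg : 0 ≤ m₁
  m₂_nonneg : 0 ≤ m₂
  le : m₁ + m₂ ≤ G.B
  two_mul : G.H = (m₁ + m₂) + (m₁ + m₂)

theorem Counts.frame {G : Graph} {m₁ m₂ : ℤ} {p : Program} {σ σ' : Memory}
    (hc : Counts G m₁ m₂ σ) (hf : Frame p σ σ') (hr : ∀ r ∈ [2, 3, 5], r ∉ p.regs) :
    Counts G m₁ m₂ σ' :=
  { hc with
    r2 := (hf.reg _ (hr _ (by simp))).trans hc.r2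
    r3 := (hf.reg _ (hr _ (by simp))).trans hc.r3
    r5 := (hf.reg _ (hr _ (by simp))).trans hc.r5 }

/-- Arrays `6` and `7` hold the residual capacities of the reverse arcs. -/
def Copied (m₁ m₂ : ℤ) (σ : Memory) : Prop :=
  (∀ j, 0 ≤ j → j < m₁ → σ.arr 6 j = σ.arr 16 (m₁ + m₂ + j)) ∧
    ∀ j, 0 ≤ j → j < m₂ → σ.arr 7 j = σ.arr 16 (m₁ + m₂ + m₁ + j)

theorem count_eq_ite {L : List ℤ} (h : L.Nodup) (a : ℤ) :
    (L.count a : ℤ) = if a ∈ L then 1 else 0 := by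
  split_ifs with h1
  · exact_mod_cast List.count_eq_one_of_mem h h1
  · exact_mod_cast List.count_eq_zero_of_not_mem h1

theorem wp_augmentProg {W : ℤ} {N : FlowNetwork V A} {G : Graph} {ix : V → ℤ} {ed : ℤ → A × Bool}
    {U m₁ m₂ : ℤ} (hR : Represents N G ix ed U) (hW : 27 * G.B ≤ W) {σ : Memory} {x : A → ℤ}
    {π : V → ℤ} (hm : G.Mem σ) (hs : Holds N G ix ed σ x π) (hc : Counts G m₁ m₂ σ)
    (hl : Graph.Labels G (σ.arr 16) (σ.arr 18) (σ.arr 17) (σ.arr 19) (σ.arr 20))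
    (h20 : 0 ≤ σ.reg 20) (h20' : σ.reg 20 < G.K) (hneg : σ.arr 17 (σ.reg 20) < 0)
    (hpos : 0 < σ.arr 19 (σ.reg 20)) (hrem : σ.reg 10 = N.remaining x) (hremB : σ.reg 10 ≤ G.B) :
    WP W augmentProg σ fun σ' t => ∃ x', N.SSPStep x x' ∧ Holds N G ix ed σ' x' π ∧
      Copied m₁ m₂ σ' ∧ σ'.reg 10 = N.remaining x' ∧ σ'.reg 10 + 1 ≤ σ.reg 10 ∧
      N.lagrangian x' π = N.lagrangian x π ∧ t ≤ 30 * G.size := by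
  have hK := hR.wf.K_nonneg
  have hKB := hR.wf.K_le
  have hHB := hR.wf.H_le
  have hB1 := hR.wf.one_le_B
  have hsize : G.size = G.H.toNat + G.K.toNat + 1 := rfl
  have hd := hs.dataBound hR
  -- the tree path
  obtain ⟨L, s, hL, hs0, hsK, hes, hlen, hadm, -, hnod⟩ := hl.exists_trace hR.wf
    (σ.arr 19 (σ.reg 20)).toNat (σ.reg 20) h20 h20' hpos (by omega)
  have hlenK := hl.pos_le _ h20 h20'
  obtain ⟨sv, rfl⟩ := hR.ix_surj s hs0 hsK
  obtain ⟨tv, htv⟩ := hR.ix_surj _ h20 h20'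
  rw [← htv] at hL hnod hneg
  have hLr := hL.mem_range
  have hadm' : ∀ h ∈ L, 0 < N.resCap x (ed h) ∧ N.redCost π (ed h) ≤ 0 := fun h hh =>
    (hs.adm_iff hR (hLr h hh).1 (hLr h hh).2).1 (hadm h hh)
  have hwalk := hL.isResWalk hR (fun h hh => (hadm' h hh).1)
  have hpn := hL.nodup hR hnod
  set p := (L.map ed).reverse with hp
  have hpnod : p.Nodup := (List.nodup_cons.1 hpn).2.of_map
  have hLn : L.Nodup := (List.nodup_cons.1 hnod).2.of_map
  have hmemp : ∀ e, e ∈ p ↔ ∃ h ∈ L, ed h = e := fun e => by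
    simp [hp]
  -- Admissibility gives reduced cost at most `0`, and the slackness of the residual arcs gives the
  -- converse inequality.
  have hred : ∀ e ∈ p, N.redCost π e = 0 := fun e he => by
    obtain ⟨h, hh, rfl⟩ := (hmemp e).1 he
    have h1 := hadm' h hh
    have h2 := hs.slack.red _ h1.1
    omega
  have hes' : 0 < N.excess x sv := by rwa [hs.exc] at hes
  have het' : N.excess x tv < 0 := by rwa [hs.exc] at hneg
  have hst : sv ≠ tv := fun h => by
    subst h
    omega
  have hshort : N.IsShortestResPath x sv p tv := by
    refine ⟨⟨hwalk, hpn⟩, fun r hr => ?_⟩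
    rw [pathCost_eq hwalk hred]
    exact le_pathCost hs.slack hr.1
  have hpar : -1 ≤ σ.arr 20 (ix tv) ∧ σ.arr 20 (ix tv) < G.H := by
    have hH := hR.wf.H_nonneg
    cases L with
    | nil => exact ⟨hL.2.ge, hL.2.trans_lt (by omega)⟩
    | cons h' L => exact ⟨hL.1.symm ▸ by have := hL.2.2.1; omega, hL.1.symm ▸ hL.2.2.2.1⟩
  have hbt := abs_le.1 (hs.exc_le tv)
  have hbs := abs_le.1 (hs.exc_le sv)
  -- the amount of flow
  refine WP.seq (WP.mono (Graph.wp_traceProg hR.wf hW hm ⟨rfl, rfl, rfl⟩ hd rfl hs0 hsK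
    (hR.ix_nonneg tv) (hR.ix_lt tv) htv.symm hL) ?_)
  rintro σ₁ t₁ hf₁ ⟨k11, kd, ht₁⟩
  have hm₁ : G.Mem σ₁ := hm.frame hf₁ (by decide) (by decide)
  have hc₁ : Counts G m₁ m₂ σ₁ := hc.frame hf₁ (by decide)
  have a16 : σ₁.arr 16 = σ.arr 16 := hf₁.arr 16 (by decide)
  have a17 : σ₁.arr 17 = σ.arr 17 := hf₁.arr 17 (by decide)
  have a18 : σ₁.arr 18 = σ.arr 18 := hf₁.arr 18 (by decide)
  have a20 : σ₁.arr 20 = σ.arr 20 := hf₁.arr 20 (by decide)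
  have r20 : σ₁.reg 20 = ix tv := (hf₁.reg 20 (by decide)).trans htv.symm
  have r10 : σ₁.reg 10 = σ.reg 10 := hf₁.reg 10 (by decide)
  rw [hs.exc] at kd
  set d := σ₁.reg 21 with hdd
  have hd1 : d ≤ -N.excess x tv := kd.1.1
  -- The demand and the residual capacities on the path are positive integers, so `1` is among the
  -- admissible amounts.
  have hd0 : 1 ≤ d := kd.2 ⟨by omega, fun h hh => by
    rw [hs.cap h (hLr h hh).1 (hLr h hh).2]
    exact (hadm' h hh).1⟩
  have hrem0 : 0 ≤ N.remaining x := Finset.sum_nonneg fun v _ => le_max_right _ _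
  refine WP.seq (WP.mono (Graph.wp_settleProg hW a17 k11 r20 rfl (fun h => hst (hR.ix_inj h))
    ?_ ?_ ?_ (by omega) ?_ (by omega) (by omega) rfl ?_) ?_)
  · rw [hs.exc]; omega
  · rw [hs.exc]; omega
  · rw [hs.exc]; omega
  · rw [hs.exc]; omega
  · rw [a20, abs_le]; omega
  rintro σ₂ t₂ hf₂ ⟨q21, q10, q14, q17, ht₂⟩
  rw [hs.exc, ← hdd] at q21 q10 q17
  rw [hs.exc] at q17
  set δ := min (N.excess x sv) d with hδ
  have hδ0 : 1 ≤ δ := by omega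
  have hδs : δ ≤ N.excess x sv := min_le_left _ _
  have hδt : δ ≤ -N.excess x tv := (min_le_right _ _).trans hd1
  have hδL : ∀ h ∈ L, δ ≤ N.resCap x (ed h) := fun h hh => by
    rw [← hs.cap h (hLr h hh).1 (hLr h hh).2]
    exact (min_le_right _ _).trans (kd.1.2 h hh)
  have hδp : ∀ e ∈ p, δ ≤ N.resCap x e := fun e he => by
    obtain ⟨h, hh, rfl⟩ := (hmemp e).1 he
    exact hδL h hh
  -- The greatest amount is found in two stages: `d` accounts for the demand and the capacities, and
  -- `δ` adds the excess of the root.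
  have hgreat : IsGreatest {c : ℤ | c ≤ N.excess x sv ∧ c ≤ -N.excess x tv ∧
      ∀ e ∈ p, c ≤ N.resCap x e} δ := by
    refine ⟨⟨hδs, hδt, hδp⟩, fun c hcc => le_min hcc.1 (kd.2 ⟨hcc.2.1, fun h hh => ?_⟩)⟩
    rw [hs.cap h (hLr h hh).1 (hLr h hh).2]
    exact hcc.2.2 _ ((hmemp _).2 ⟨h, hh, rfl⟩)
  -- the new flow
  have hm₂ : G.Mem σ₂ := hm₁.frame hf₂ (by decide) (by decide)
  have hc₂ : Counts G m₁ m₂ σ₂ := hc₁.frame hf₂ (by decide)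
  have b16 : σ₂.arr 16 = σ.arr 16 := (hf₂.arr 16 (by decide)).trans a16
  have b18 : σ₂.arr 18 = σ.arr 18 := (hf₂.arr 18 (by decide)).trans a18
  have b20 : σ₂.arr 20 = σ.arr 20 := (hf₂.arr 20 (by decide)).trans a20
  have hrv : ∀ h, 0 ≤ h → h < G.H → N.resCap x (ed (G.rv h)) = N.resCap x (reverseArc (ed h)) :=
    fun h h1 h2 => by rw [hR.ed_rv h h1 h2]
  have hsum : ∀ e, N.resCap x e + N.resCap x (reverseArc e) ≤ G.B := fun e => by
    refine le_trans (le_of_eq ?_) (hR.cap_le e.1)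
    rcases e with ⟨a, _ | _⟩ <;> simp [resCap, reverseArc]
  refine WP.seq (WP.mono (Graph.wp_pushLoop hR.wf hW (d := δ) (by omega) hs0 hsK L (ix tv) σ₂ hm₂
    b20 hL (by rw [q14, a20]) q21 ?_ ?_ ?_ hLn) ?_)
  · rw [b16]
    exact hd.cap_nonneg
  · intro h h1 h2
    rw [b16, hs.cap h h1 h2, hs.cap _ (hR.wf.rv_nonneg h h1 h2) (hR.wf.rv_lt h h1 h2),
      hrv h h1 h2]
    exact hsum _
  · intro h hh
    rw [b16, hs.cap h (hLr h hh).1 (hLr h hh).2]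
    exact hδL h hh
  rintro σ₃ t₃ hf₃ ⟨u1, u2, u3, ht₃⟩
  have hm₃ : G.Mem σ₃ := hm₂.frame hf₃ (by decide) (by decide)
  have hc₃ : Counts G m₁ m₂ σ₃ := hc₂.frame hf₃ (by decide)
  have c17 : σ₃.arr 17 = σ₂.arr 17 := hf₃.arr 17 (by decide)
  have c18 : σ₃.arr 18 = σ.arr 18 := (hf₃.arr 18 (by decide)).trans b18
  have c10 : σ₃.reg 10 = σ₂.reg 10 := hf₃.reg 10 (by decide)
  have hcap₃ : ∀ h, 0 ≤ h → h < G.H → σ₃.arr 16 h = N.resCap (augment x p δ) (ed h) := by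
    intro h h1 h2
    -- Reversal is an involution on arc numbers, so it preserves distinctness, and the
    -- multiplicities become indicators as in `resCap_augment`.
    have hrn : (L.map G.rv).Nodup := by
      refine hLn.map_on fun a ha b hb hab => ?_
      rw [← hR.wf.rv_rv a (hLr a ha).1 (hLr a ha).2, hab, hR.wf.rv_rv b (hLr b hb).1 (hLr b hb).2]
    rw [u1 h h1 h2, b16, hs.cap h h1 h2, resCap_augment, count_eq_ite hLn, count_eq_ite hrn]
    have e1 : h ∈ L ↔ ed h ∈ p := by
      rw [hmemp]
      refine ⟨fun hh => ⟨h, hh, rfl⟩, ?_⟩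
      rintro ⟨g, hg, hgh⟩
      rwa [← hR.ed_inj g (hLr g hg).1 (hLr g hg).2 h h1 h2 hgh]
    have e2 : h ∈ L.map G.rv ↔ reverseArc (ed h) ∈ p := by
      rw [hmemp, List.mem_map]
      constructor
      · rintro ⟨g, hg, rfl⟩
        obtain ⟨g1, g2⟩ := hLr g hg
        refine ⟨g, hg, ?_⟩
        rw [hR.ed_rv g g1 g2]
        simp [reverseArc]
      · rintro ⟨g, hg, hgh⟩
        obtain ⟨g1, g2⟩ := hLr g hg
        rw [← hR.ed_rv h h1 h2] at hgh
        refine ⟨g, hg, ?_⟩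
        rw [hR.ed_inj g g1 g2 _ (hR.wf.rv_nonneg h h1 h2) (hR.wf.rv_lt h h1 h2) hgh,
          hR.wf.rv_rv h h1 h2]
    simp only [e1, e2, mul_ite, mul_one, mul_zero]
  have hslack := hs.slack.augment (δ := δ) (by omega) hδp hred
  have hlag : N.lagrangian (augment x p δ) π = N.lagrangian x π := lagrangian_augment hred
  refine WP.mono (Graph.wp_copyProg (M := m₁ + m₂) hW hm₃.r8 hc₃.r2 hc₃.r3 hc₃.r5 hc.m₁_nonneg
    hc.m₂_nonneg rfl hc.le (by omega) ?_) ?_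
  · have := hc.two_mul
    have := hc.m₁_nonneg
    have := hc.m₂_nonneg
    intro h h1 h2
    have h3 := u2 h (by omega) (by omega)
    have h4 := u3 h (by omega) (by omega)
    have h5 := u2 _ (hR.wf.rv_nonneg h (by omega) (by omega))
      (hR.wf.rv_lt h (by omega) (by omega))
    rw [abs_le]
    omega
  rintro σ₄ t₄ hf₄ ⟨y6, y7, ht₄⟩
  have d16 : σ₄.arr 16 = σ₃.arr 16 := hf₄.arr 16 (by decide)
  have d17 : σ₄.arr 17 = σ₃.arr 17 := hf₄.arr 17 (by decide)
  have d18 : σ₄.arr 18 = σ₃.arr 18 := hf₄.arr 18 (by decide)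
  have d10 : σ₄.reg 10 = σ₃.reg 10 := hf₄.reg 10 (by decide)
  have hremx := remaining_augment hwalk hpnod (δ := δ) (by omega) hδs hδt
  refine ⟨augment x p δ, ⟨sv, tv, p, δ, hes', het', hshort, hgreat, rfl⟩,
    ⟨?_, ?_, ?_, hslack, hs.pi_nonneg, ?_, ?_⟩, ?_, ?_, ?_, hlag, ?_⟩
  · rw [d16]
    exact hcap₃
  · intro v
    rw [d17, c17, q17, excess_augment δ v hwalk hpnod]
    rcases eq_or_ne v tv with rfl | h1
    · rw [Function.update_self, if_neg hst, if_pos rfl]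
      ring
    rw [Function.update_of_ne (fun h => h1 (hR.ix_inj h)), if_neg h1.symm]
    rcases eq_or_ne v sv with rfl | h2
    · rw [Function.update_self, if_pos rfl]
      ring
    · rw [Function.update_of_ne (fun h => h2 (hR.ix_inj h)), if_neg h2.symm, hs.exc]
      ring
  · rw [d18, c18]
    exact hs.pi
  · rw [hlag]
    exact hs.pi_le
  · intro v
    have hv := abs_le.1 (hs.exc_le v)
    rw [excess_augment δ v hwalk hpnod, abs_le]
    split_ifs with h1 h2 h2
    · omega
    · subst h1; omega
    · subst h2; omega
    · omega
  · rw [Copied, d16]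
    exact ⟨y6, y7⟩
  · rw [d10, c10, q10, r10, hrem, hremx]
  · rw [d10, c10, q10, r10]
    omega
  · have := hc.two_mul
    omega

/-- One iteration of the successive shortest path algorithm. -/
def bodyProg : Program := .seq phaseProg augmentProg

theorem wp_bodyProg {W : ℤ} {N : FlowNetwork V A} {G : Graph} {ix : V → ℤ} {ed : ℤ → A × Bool}
    {U m₁ m₂ : ℤ} (hR : Represents N G ix ed U) (hW : 27 * G.B ≤ W) {σ : Memory} {x : A → ℤ}
    {π : V → ℤ} (hm : G.Mem σ) (hs : Holds N G ix ed σ x π) (hc : Counts G m₁ m₂ σ)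
    (hrem : σ.reg 10 = N.remaining x) (hrem0 : 0 < σ.reg 10) (hremB : σ.reg 10 ≤ G.B) :
    WP W bodyProg σ fun σ' t => ∃ x' π', N.SSPStep x x' ∧ Holds N G ix ed σ' x' π' ∧
      Copied m₁ m₂ σ' ∧ σ'.reg 10 = N.remaining x' ∧ σ'.reg 10 + 1 ≤ σ.reg 10 ∧
      t + 60 * G.size * (U - N.lagrangian x' π').toNat ≤
        60 * G.size * (U - N.lagrangian x π).toNat + 100 * G.size := by
  refine WP.seq (WP.mono (wp_phaseProg hR hW hm hs (by omega)) ?_)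
  rintro σ₁ t₁ hf₁ ⟨π', h1, h2, h3, h4, h5, h6, ht₁⟩
  have e10 : σ₁.reg 10 = σ.reg 10 := hf₁.reg 10 (by decide)
  refine WP.mono (wp_augmentProg hR hW (hm.frame hf₁ (by decide) (by decide)) h1
    (hc.frame hf₁ (by decide)) h2 h3 h4 h5 h6 (by omega) (by omega)) ?_
  rintro σ₂ t₂ - ⟨x', k1, k2, k3, k4, k5, k6, ht₂⟩
  refine ⟨x', π', k1, k2, k3, k4, by omega, ?_⟩
  -- The `60 * G.size + 2` of the phase and the `30 * G.size` of the augmentation fit into `100 *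
  -- G.size`.
  have hsize : 1 ≤ G.size := Nat.le_add_left _ _
  rw [k6]
  omega

end

/-! ### Building the graph -/

/-- Positions `h` and `M + h` of the graph arrays hold the residual arcs of the arc from `a` to `b`
of cost `c` and capacity `u` without flow. -/
structure ArcData (M : ℤ) (σ : Memory) (h a b c u : ℤ) : Prop where
  frm : σ.arr 10 h = a
  tgt : σ.arr 11 h = b
  cst : σ.arr 12 h = c
  rv : σ.arr 13 h = M + h
  cap : σ.arr 16 h = u
  frm' : σ.arr 10 (M + h) = b
  tgt' : σ.arr 11 (M + h) = a
  cst' : σ.arr 12 (M + h) = -c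
  rv' : σ.arr 13 (M + h) = h
  cap' : σ.arr 16 (M + h) = 0

theorem ArcData.congr {M : ℤ} {σ σ' : Memory} {h a b c u : ℤ} (hd : ArcData M σ h a b c u)
    (h0 : ∀ i ∈ [10, 11, 12, 13, 16], σ'.arr i h = σ.arr i h)
    (h1 : ∀ i ∈ [10, 11, 12, 13, 16], σ'.arr i (M + h) = σ.arr i (M + h)) :
    ArcData M σ' h a b c u where
  frm := (h0 _ (by simp)).trans hd.frm
  tgt := (h0 _ (by simp)).trans hd.tgt
  cst := (h0 _ (by simp)).trans hd.cst
  rv := (h0 _ (by simp)).trans hd.rv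
  cap := (h0 _ (by simp)).trans hd.cap
  frm' := (h1 _ (by simp)).trans hd.frm'
  tgt' := (h1 _ (by simp)).trans hd.tgt'
  cst' := (h1 _ (by simp)).trans hd.cst'
  rv' := (h1 _ (by simp)).trans hd.rv'
  cap' := (h1 _ (by simp)).trans hd.cap'

/-- `σ'` arises from `σ` by storing the residual arcs of an arc at positions `h` and `M + h`. -/
structure ArcStored (M : ℤ) (σ σ' : Memory) (h a b c u : ℤ) : Prop where
  a10 : σ'.arr 10 = Function.update (Function.update (σ.arr 10) h a) (M + h) b
  a11 : σ'.arr 11 = Function.update (Function.update (σ.arr 11) h b) (M + h) a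
  a12 : σ'.arr 12 = Function.update (Function.update (σ.arr 12) h c) (M + h) (-c)
  a13 : σ'.arr 13 = Function.update (Function.update (σ.arr 13) h (M + h)) (M + h) h
  a16 : σ'.arr 16 = Function.update (Function.update (σ.arr 16) h u) (M + h) 0

theorem ArcStored.arcData {M : ℤ} {σ σ' : Memory} {h a b c u : ℤ}
    (hs : ArcStored M σ σ' h a b c u) (hM : 0 < M) : ArcData M σ' h a b c u := by
  have h1 : h ≠ M + h := by omega
  constructor <;> simp [hs.a10, hs.a11, hs.a12, hs.a13, hs.a16, Function.update_of_ne h1]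

theorem ArcStored.arcData_of_ne {M : ℤ} {σ σ' : Memory} {h a b c u : ℤ}
    (hs : ArcStored M σ σ' h a b c u) {g a' b' c' u' : ℤ} (hd : ArcData M σ g a' b' c' u')
    (hg : 0 ≤ g) (hgM : g < M) (h0 : 0 ≤ h) (hM : h < M) (hne : g ≠ h) :
    ArcData M σ' g a' b' c' u' := by
  have h1 : g ≠ M + h := by omega
  have h2 : M + g ≠ M + h := by omega
  have h3 : M + g ≠ h := by omega
  refine hd.congr (fun i hi => ?_) fun i hi => ?_ <;>
    simp only [List.mem_cons, List.not_mem_nil, or_false] at hi <;>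
    rcases hi with rfl | rfl | rfl | rfl | rfl <;>
    simp [hs.a10, hs.a11, hs.a12, hs.a13, hs.a16, Function.update_of_ne h1,
      Function.update_of_ne h2, Function.update_of_ne h3, Function.update_of_ne hne]

/-- Add the arcs listed in arrays `p`, `q`, `r`, from the position in register `21` on. Registers
`c` and `c'` hold their cost and its negative. -/
def addLoop (p q r c c' : ℕ) : Program :=
  .loop ⟨8, 11⟩ (block [.sub 11 11 8, .add 14 21 11, .add 22 5 14, .load 15 p 11, .load 16 q 11,
    .add 16 16 0, .load 17 r 11, .store 10 14 16, .store 11 14 15, .store 12 14 c, .store 13 14 22,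
    .store 16 14 17, .store 10 22 15, .store 11 22 16, .store 12 22 c', .store 13 22 14,
    .store 16 22 7])

/-- Register `0` holds `k₁`: the nodes of the second covariate are numbered after those of the
first, hence the shift of the tail. The second clause protects the treatment arcs when the control
arcs are added; for these both cost registers are register `7`, which holds `0`. -/
theorem wp_addLoop {W B : ℤ} (hW : 27 * B ≤ W) {p q r c c' : ℕ} (hp : p < 10) (hq : q < 10)
    (hr : r < 10) (hc : c < 10) (hc' : c' < 10) {σ : Memory} (h7 : σ.reg 7 = 0)
    (h8 : σ.reg 8 = 1) {N off M : ℤ} (h11 : σ.reg 11 = N) (h21 : σ.reg 21 = off)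
    (h5 : σ.reg 5 = M) (hN : 0 ≤ N) (hoff : 0 ≤ off) (hM : off + N ≤ M) (hMB : M ≤ B) (hB : 1 ≤ B)
    (hcc : σ.reg c' = -σ.reg c) (hcB : |σ.reg c| ≤ B)
    (hpB : ∀ j, 0 ≤ j → j < N → |σ.arr p j| ≤ B) (hqB : ∀ j, 0 ≤ j → j < N → |σ.arr q j| ≤ B)
    (hrB : ∀ j, 0 ≤ j → j < N → |σ.arr r j| ≤ B) (h0B : |σ.reg 0| ≤ B) :
    WP W (addLoop p q r c c') σ fun σ' t =>
      (∀ j, 0 ≤ j → j < N →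
        ArcData M σ' (off + j) (σ.arr q j + σ.reg 0) (σ.arr p j) (σ.reg c) (σ.arr r j)) ∧
      (∀ h a b c u, 0 ≤ h → h < M → (h < off ∨ off + N ≤ h) → ArcData M σ h a b c u →
        ArcData M σ' h a b c u) ∧ t ≤ 20 * N.toNat + 1 := by
  have hregs : ∀ i < 10, i ∉ (addLoop p q r c c').regs := fun i hi => by
    simp [addLoop, block, Program.regs]; omega
  have harrs : ∀ i < 10, i ∉ (addLoop p q r c c').arrs := fun i hi => by
    simp [addLoop, block, Program.arrs]; omega
  refine WP.mono (WP.loop (fun φ σ₁ => 0 ≤ σ₁.reg 11 ∧ σ₁.reg 11 ≤ N ∧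
    φ = 20 * (σ₁.reg 11).toNat ∧
    (∀ j, σ₁.reg 11 ≤ j → j < N →
      ArcData M σ₁ (off + j) (σ.arr q j + σ.reg 0) (σ.arr p j) (σ.reg c) (σ.arr r j)) ∧
    (∀ h a b c u, 0 ≤ h → h < M → (h < off ∨ off + N ≤ h) → ArcData M σ h a b c u →
      ArcData M σ₁ h a b c u)) (20 * N.toNat) ?_ ?_) ?_
  · rw [h11]
    exact ⟨hN, le_rfl, rfl, fun j h1 h2 => by omega, fun h a b c u _ _ _ hd => hd⟩
  · rintro φ σ₁ hf ⟨h1, h2, rfl, hi, hk⟩ hb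
    have e0 : σ₁.reg 0 = σ.reg 0 := hf.reg 0 (hregs _ (by omega))
    have e7 : σ₁.reg 7 = 0 := (hf.reg 7 (hregs _ (by omega))).trans h7
    have e8 : σ₁.reg 8 = 1 := (hf.reg 8 (hregs _ (by omega))).trans h8
    have e5 : σ₁.reg 5 = M := (hf.reg 5 (hregs _ (by omega))).trans h5
    have ec : σ₁.reg c = σ.reg c := hf.reg c (hregs _ hc)
    have ec' : σ₁.reg c' = -σ.reg c := (hf.reg c' (hregs _ hc')).trans hcc
    have e21 : σ₁.reg 21 = off :=
      (hf.reg 21 (by simp [block, Program.regs])).trans h21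
    have ep : σ₁.arr p = σ.arr p := hf.arr p (harrs _ hp)
    have eq : σ₁.arr q = σ.arr q := hf.arr q (harrs _ hq)
    have er : σ₁.arr r = σ.arr r := hf.arr r (harrs _ hr)
    simp only [e8] at hb
    obtain ⟨v, hv⟩ : ∃ v, σ₁.reg 11 = v + 1 := ⟨σ₁.reg 11 - 1, by ring⟩
    rw [hv] at h1 h2 hb hi
    have b1 := abs_le.1 (hpB v (by omega) (by omega))
    have b2 := abs_le.1 (hqB v (by omega) (by omega))
    have b3 := abs_le.1 (hrB v (by omega) (by omega))
    have b4 := abs_le.1 h0B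
    have b5 := abs_le.1 hcB
    have n1 : c ≠ 11 := by omega
    have n2 : c ≠ 14 := by omega
    have n3 : c ≠ 15 := by omega
    have n4 : c ≠ 16 := by omega
    have n5 : c ≠ 17 := by omega
    have n6 : c ≠ 22 := by omega
    have n1' : c' ≠ 11 := by omega
    have n2' : c' ≠ 14 := by omega
    have n3' : c' ≠ 15 := by omega
    have n4' : c' ≠ 16 := by omega
    have n5' : c' ≠ 17 := by omega
    have n6' : c' ≠ 22 := by omega
    have key : ∀ σ₂ : Memory, σ₂.reg 11 = v → ArcStored M σ₁ σ₂ (off + v) (σ.arr q v + σ.reg 0)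
        (σ.arr p v) (σ.reg c) (σ.arr r v) → 0 ≤ σ₂.reg 11 ∧ σ₂.reg 11 ≤ N ∧
        20 * v.toNat = 20 * (σ₂.reg 11).toNat ∧
        (∀ j, σ₂.reg 11 ≤ j → j < N →
          ArcData M σ₂ (off + j) (σ.arr q j + σ.reg 0) (σ.arr p j) (σ.reg c) (σ.arr r j)) ∧
        (∀ h a b c u, 0 ≤ h → h < M → (h < off ∨ off + N ≤ h) → ArcData M σ h a b c u →
          ArcData M σ₂ h a b c u) := by
      rintro σ₂ g1 g2
      rw [g1]
      refine ⟨by omega, by omega, rfl, fun j j1 j2 => ?_, fun h a b c u k1 k2 k3 k4 => ?_⟩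
      · rcases eq_or_ne j v with rfl | hne
        · exact g2.arcData (by omega)
        · exact g2.arcData_of_ne (hi j (by omega) j2) (by omega) (by omega) (by omega) (by omega)
            (by omega)
      · exact g2.arcData_of_ne (hk h a b c u k1 k2 k3 k4) (by omega) (by omega) (by omega)
          (by omega) (by omega)
    refine WP.sub ?_ (WP.add ?_ (WP.add ?_ (WP.load ?_ (WP.load ?_ (WP.add ?_ (WP.load ?_
      (WP.store ?_ (WP.store ?_ (WP.store ?_ (WP.store ?_ (WP.store ?_ (WP.store ?_
      (WP.store ?_ (WP.store ?_ (WP.store ?_ (WP.store ?_ (WP.nil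
      ⟨20 * v.toNat, key _ ?_ ?_, by omega⟩)))))))))))))))))
    · simp [hv, e8, abs_le]; omega
    · simp [hv, e8, e21, abs_le]; omega
    · simp [hv, e8, e21, e5, abs_le]; omega
    · simp [hv, e8, ep, abs_le]; omega
    · simp [hv, e8, eq, abs_le]; omega
    · simp [hv, e8, eq, e0, abs_le]; omega
    · simp [hv, e8, er, abs_le]; omega
    · simp [hv, e8, eq, e0, abs_le]; omega
    · simp [hv, e8, ep, abs_le]; omega
    · simp [ec, abs_le, n1, n2, n3, n4, n5, n6]; omega
    · simp [hv, e8, e21, e5, abs_le]; omega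
    · simp [hv, e8, er, abs_le]; omega
    · simp [hv, e8, ep, abs_le]; omega
    · simp [hv, e8, eq, e0, abs_le]; omega
    · simp [ec', abs_le, n1', n2', n3', n4', n5', n6']; omega
    · simp [hv, e8, e21, abs_le]; omega
    · simp [e7]; omega
    · simp [hv, e8]
    · constructor <;> simp [hv, e8, e21, e5, ep, eq, er, e0, ec, ec', e7, n1, n2, n3, n4, n5, n6,
        n1', n2', n3', n4', n5', n6']
  · rintro σ' t hf ⟨φ', ⟨h1, h2, rfl, hi, hk⟩, hb, ht⟩
    have e8 : σ'.reg 8 = 1 := (hf.reg 8 (hregs _ (by omega))).trans h8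
    simp only [e8] at hb
    exact ⟨fun j j1 j2 => hi j (by omega) j2, hk, by omega⟩

/-- Compute the excesses and the remaining supply from the treatment arcs. -/
def excessLoop : Program :=
  .loop ⟨8, 11⟩ (block [.sub 11 11 8, .load 15 0 11, .load 16 1 11, .add 16 16 0, .load 17 2 11,
    .load 18 17 15, .sub 18 18 17, .store 17 15 18, .load 18 17 16, .add 18 18 17, .store 17 16 18,
    .add 10 10 17])

theorem wp_excessLoop {W B : ℤ} (hW : 27 * B ≤ W) {σ : Memory} (h8 : σ.reg 8 = 1) {N : ℕ}
    {a b u : ℕ → ℤ} (h11 : σ.reg 11 = N) (h10 : σ.reg 10 = 0) (h17 : ∀ i, σ.arr 17 i = 0)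
    (ha : ∀ j < N, σ.arr 0 j = a j) (hb : ∀ j < N, σ.arr 1 j + σ.reg 0 = b j)
    (hu : ∀ j < N, σ.arr 2 j = u j) (ha0 : ∀ j < N, |a j| ≤ B) (hb0 : ∀ j < N, |b j| ≤ B)
    (hk : |σ.reg 0| ≤ B) (hN : (N : ℤ) ≤ B)
    (hu0 : ∀ j, 0 ≤ u j) (huB : ∑ j ∈ Finset.range N, u j ≤ B) :
    WP W excessLoop σ fun σ' t =>
      (∀ i, σ'.arr 17 i = ∑ j ∈ Finset.range N, (if b j = i then u j else 0) -
        ∑ j ∈ Finset.range N, (if a j = i then u j else 0)) ∧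
      σ'.reg 10 = ∑ j ∈ Finset.range N, u j ∧ t ≤ 20 * N + 1 := by
  -- Every intermediate excess is a difference of two partial sums of capacities, so these bounds
  -- keep the loop within the word bound.
  have hpart : ∀ v, ∑ j ∈ Finset.Ico v N, u j ≤ B := fun v =>
    (Finset.sum_le_sum_of_subset_of_nonneg (by intro j; simp) fun j _ _ => hu0 j).trans huB
  have hite : ∀ v (f : ℕ → ℤ) i, 0 ≤ ∑ j ∈ Finset.Ico v N, (if f j = i then u j else 0) ∧
      ∑ j ∈ Finset.Ico v N, (if f j = i then u j else 0) ≤ B := fun v f i => by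
    constructor
    · exact Finset.sum_nonneg fun j _ => by split_ifs <;> simp [hu0]
    · refine le_trans (Finset.sum_le_sum fun j _ => ?_) (hpart v)
      split_ifs <;> simp [hu0]
  refine WP.mono (WP.loop (fun φ σ₁ => ∃ v : ℕ, σ₁.reg 11 = v ∧ v ≤ N ∧ φ = 20 * v ∧
    (∀ i, σ₁.arr 17 i = ∑ j ∈ Finset.Ico v N, (if b j = i then u j else 0) -
        ∑ j ∈ Finset.Ico v N, (if a j = i then u j else 0)) ∧
    σ₁.reg 10 = ∑ j ∈ Finset.Ico v N, u j) (20 * N) ?_ ?_) ?_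
  · exact ⟨N, h11, le_rfl, rfl, by simp [h17], by simp [h10]⟩
  · rintro φ σ₁ hf ⟨w, h1, h2, rfl, hi, hr⟩ hbr
    have e0 : σ₁.reg 0 = σ.reg 0 := hf.reg 0 (by decide)
    have e8 : σ₁.reg 8 = 1 := (hf.reg 8 (by decide)).trans h8
    have f0 : σ₁.arr 0 = σ.arr 0 := hf.arr 0 (by decide)
    have f1 : σ₁.arr 1 = σ.arr 1 := hf.arr 1 (by decide)
    have f2 : σ₁.arr 2 = σ.arr 2 := hf.arr 2 (by decide)
    simp only [e8] at hbr
    obtain ⟨v, rfl⟩ : ∃ v, w = v + 1 := ⟨w - 1, by omega⟩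
    have hvN : v < N := by omega
    have g0 : σ₁.arr 0 v = a v := by rw [f0, ha v hvN]
    have g1 : σ₁.arr 1 v = b v - σ.reg 0 := by rw [f1, ← hb v hvN]; ring
    have g2 : σ₁.arr 2 v = u v := by rw [f2, hu v hvN]
    have b1 := abs_le.1 (ha0 v hvN)
    have b2 := abs_le.1 (hb0 v hvN)
    have b3 := hu0 v
    have b4 := abs_le.1 hk
    have b5 := hpart v
    have b6 := hpart (v + 1)
    have b7 : 0 ≤ ∑ j ∈ Finset.Ico (v + 1) N, u j := Finset.sum_nonneg fun j _ => hu0 j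
    rw [Finset.sum_eq_sum_Ico_succ_bot hvN] at b5
    have e11 : σ₁.reg 11 = v + 1 := by rw [h1]; push_cast; rfl
    have k1 := hite (v + 1) b (a v)
    have k2 := hite (v + 1) a (a v)
    have k3 := hite (v + 1) b (b v)
    have k4 := hite (v + 1) a (b v)
    have i1 := hi (a v)
    have i2 := hi (b v)
    refine WP.sub ?_ (WP.load ?_ (WP.load ?_ (WP.add ?_ (WP.load ?_ (WP.load ?_ (WP.sub ?_
      (WP.store ?_ (WP.load ?_ (WP.add ?_ (WP.store ?_ (WP.add ?_ (WP.nil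
      ⟨20 * v, ⟨v, ?_, by omega, rfl, fun i => ?_, ?_⟩, by omega⟩))))))))))))
    · simp [e11, e8]; omega
    · simp [e11, e8, g0, abs_le]; omega
    · simp [e11, e8, g1, abs_le]; omega
    · simp [e11, e8, g1, e0, abs_le]; omega
    · simp [e11, e8, g2, abs_le]; omega
    · simp [e11, e8, g0, abs_le]; omega
    · simp [e11, e8, g0, g2, abs_le]; omega
    · simp [e11, e8, g0, g2, abs_le]; omega
    · simp [e11, e8, g0, g1, g2, e0, Function.update_apply, abs_le]; split_ifs <;> omega
    · simp [e11, e8, g0, g1, g2, e0, Function.update_apply, abs_le]; split_ifs <;> omega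
    · simp [e11, e8, g0, g1, g2, e0, Function.update_apply, abs_le]; split_ifs <;> omega
    · simp [e11, e8, g2, hr, abs_le]; omega
    · simp [e11, e8]
    · have i3 := hi i
      rw [Finset.sum_eq_sum_Ico_succ_bot hvN, Finset.sum_eq_sum_Ico_succ_bot hvN]
      simp [e11, e8, g0, g1, g2, e0, Function.update_apply]
      -- Tail and head are not assumed distinct here. If `a v = b v`, the second load reads the
      -- value just stored, and the two changes cancel.
      rcases eq_or_ne i (a v) with rfl | hne1
      · rcases eq_or_ne (a v) (b v) with h | hne2
        · simp [h] at i1 i2 ⊢; omega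
        · rw [if_neg hne2, if_pos rfl, if_neg hne2.symm]; simp; omega
      · rcases eq_or_ne i (b v) with rfl | hne2
        · simp [hne1, hne1.symm]; omega
        · simp [hne1, hne2, hne1.symm, hne2.symm]; omega
    · rw [Finset.sum_eq_sum_Ico_succ_bot hvN]
      simp [e11, e8, g2, hr]; ring
  · rintro σ' t hf ⟨φ', ⟨v, h1, h2, rfl, hi, hr⟩, hb, ht⟩
    have e8 : σ'.reg 8 = 1 := (hf.reg 8 (by decide)).trans h8
    simp only [e8] at hb
    have hv : v = 0 := by omega
    subst hv
    rw [← Finset.range_eq_Ico] at hr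
    simp only [← Finset.range_eq_Ico] at hi
    exact ⟨hi, hr, by omega⟩

/-- Set up empty lists of leaving arcs. -/
def clearLoop : Program := .loop ⟨8, 11⟩ (block [.sub 11 11 8, .store 15 11 9])

theorem wp_clearLoop {W : ℤ} (hW : 1 ≤ W) {σ : Memory} (h8 : σ.reg 8 = 1) (h9 : σ.reg 9 = -1)
    {K : ℤ} (h11 : σ.reg 11 = K) (hK : 0 ≤ K) (hKW : K ≤ W) :
    WP W clearLoop σ fun σ' t =>
      (∀ v, 0 ≤ v → v < K → σ'.arr 15 v = -1) ∧ t ≤ 10 * K.toNat + 1 := by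
  refine WP.mono (WP.loop (fun φ σ₁ => 0 ≤ σ₁.reg 11 ∧ σ₁.reg 11 ≤ K ∧
    φ = 10 * (σ₁.reg 11).toNat ∧ ∀ v, σ₁.reg 11 ≤ v → v < K → σ₁.arr 15 v = -1)
    (10 * K.toNat) ?_ ?_) ?_
  · rw [h11]
    exact ⟨hK, le_rfl, rfl, fun j h1 h2 => by omega⟩
  · rintro φ σ₁ hf ⟨h1, h2, rfl, hi⟩ hb
    have e8 : σ₁.reg 8 = 1 := (hf.reg 8 (by decide)).trans h8
    have e9 : σ₁.reg 9 = -1 := (hf.reg 9 (by decide)).trans h9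
    simp only [e8] at hb
    obtain ⟨v, hv⟩ : ∃ v, σ₁.reg 11 = v + 1 := ⟨σ₁.reg 11 - 1, by ring⟩
    rw [hv] at h1 h2 hb hi
    refine WP.sub ?_ (WP.store ?_ (WP.nil ⟨10 * v.toNat, ?_, by omega⟩))
    · simp [hv, e8, abs_le]; omega
    · simp [e9, hW]
    · simp [hv, e8, e9]
      refine ⟨by omega, by omega, fun j j1 j2 => ?_⟩
      rcases eq_or_ne j v with rfl | hne
      · simp
      · rw [Function.update_of_ne hne]
        exact hi j (by omega) j2
  · rintro σ' t hf ⟨φ', ⟨h1, h2, rfl, hi⟩, hb, ht⟩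
    have e8 : σ'.reg 8 = 1 := (hf.reg 8 (by decide)).trans h8
    simp only [e8] at hb
    exact ⟨fun j j1 j2 => hi j (by omega) j2, by omega⟩

/-- The lists of leaving arcs of the arcs `0, …, n - 1`. -/
structure Linked (K n : ℤ) (frm nxt hd : ℤ → ℤ) : Prop where
  nxt_ge : ∀ h, 0 ≤ h → h < n → -1 ≤ nxt h
  nxt_lt : ∀ h, 0 ≤ h → h < n → nxt h < h
  frm_nxt : ∀ h, 0 ≤ h → h < n → 0 ≤ nxt h → frm (nxt h) = frm h
  le_nxt : ∀ h, 0 ≤ h → h < n → ∀ h', 0 ≤ h' → h' < h → frm h' = frm h → h' ≤ nxt h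
  hd_ge : ∀ v, 0 ≤ v → v < K → -1 ≤ hd v
  hd_lt : ∀ v, 0 ≤ v → v < K → hd v < n
  frm_hd : ∀ v, 0 ≤ v → v < K → 0 ≤ hd v → frm (hd v) = v
  le_hd : ∀ v, 0 ≤ v → v < K → ∀ h, 0 ≤ h → h < n → frm h = v → h ≤ hd v

/-- The new arc `n` is larger than all arcs linked so far, so putting it at the front keeps its list
decreasing. -/
theorem Linked.link {K n : ℤ} {frm nxt hd : ℤ → ℤ} (hl : Linked K n frm nxt hd) (hn : 0 ≤ n)
    (h0 : 0 ≤ frm n) (hK : frm n < K) :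
    Linked K (n + 1) frm (Function.update nxt n (hd (frm n))) (Function.update hd (frm n) n) where
  nxt_ge h h1 h2 := by
    rcases eq_or_ne h n with rfl | hne
    · rw [Function.update_self]; exact hl.hd_ge _ h0 hK
    · rw [Function.update_of_ne hne]; exact hl.nxt_ge h h1 (by omega)
  nxt_lt h h1 h2 := by
    rcases eq_or_ne h n with rfl | hne
    · rw [Function.update_self]; exact hl.hd_lt _ h0 hK
    · rw [Function.update_of_ne hne]; exact hl.nxt_lt h h1 (by omega)
  frm_nxt h h1 h2 := by
    rcases eq_or_ne h n with rfl | hne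
    · rw [Function.update_self]; exact hl.frm_hd _ h0 hK
    · rw [Function.update_of_ne hne]; exact hl.frm_nxt h h1 (by omega)
  le_nxt h h1 h2 h' h3 h4 h5 := by
    rcases eq_or_ne h n with rfl | hne
    · rw [Function.update_self]; exact hl.le_hd _ h0 hK h' h3 h4 h5
    · rw [Function.update_of_ne hne]; exact hl.le_nxt h h1 (by omega) h' h3 h4 h5
  hd_ge v h1 h2 := by
    rcases eq_or_ne v (frm n) with rfl | hne
    · rw [Function.update_self]; omega
    · rw [Function.update_of_ne hne]; exact hl.hd_ge v h1 h2
  hd_lt v h1 h2 := by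
    rcases eq_or_ne v (frm n) with rfl | hne
    · rw [Function.update_self]; omega
    · rw [Function.update_of_ne hne]
      have := hl.hd_lt v h1 h2
      omega
  frm_hd v h1 h2 := by
    rcases eq_or_ne v (frm n) with rfl | hne
    · rw [Function.update_self]; exact fun _ => rfl
    · rw [Function.update_of_ne hne]; exact hl.frm_hd v h1 h2
  le_hd v h1 h2 h h3 h4 h5 := by
    rcases eq_or_ne v (frm n) with rfl | hne
    · rw [Function.update_self]; omega
    · rw [Function.update_of_ne hne]
      refine hl.le_hd v h1 h2 h h3 ?_ h5
      have : h ≠ n := fun h6 => hne (by rw [← h5, h6])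
      omega

/-- Put all arcs into the lists of arcs that leave a node. -/
def linkLoop : Program :=
  .loop ⟨14, 6⟩ (block [.load 15 10 14, .load 16 15 15, .store 14 14 16, .store 15 15 14,
    .add 14 14 8])

theorem wp_linkLoop {W : ℤ} {σ : Memory} {frm : ℤ → ℤ} {K H : ℤ} (h8 : σ.reg 8 = 1)
    (h6 : σ.reg 6 = H - 1) (h14 : σ.reg 14 = 0) (h10 : σ.arr 10 = frm)
    (h15 : ∀ v, 0 ≤ v → v < K → σ.arr 15 v = -1) (hH : 0 ≤ H) (hHW : H ≤ W) (hKW : K ≤ W)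
    (hW : 1 ≤ W) (hf0 : ∀ h, 0 ≤ h → h < H → 0 ≤ frm h) (hfK : ∀ h, 0 ≤ h → h < H → frm h < K) :
    WP W linkLoop σ fun σ' t =>
      Linked K H frm (σ'.arr 14) (σ'.arr 15) ∧ t ≤ 10 * H.toNat + 1 := by
  refine WP.mono (WP.loop (fun φ σ₁ => 0 ≤ σ₁.reg 14 ∧ σ₁.reg 14 ≤ H ∧
    φ = 10 * (H - σ₁.reg 14).toNat ∧ Linked K (σ₁.reg 14) frm (σ₁.arr 14) (σ₁.arr 15))
    (10 * H.toNat) ?_ ?_) ?_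
  · rw [h14]
    refine ⟨le_rfl, hH, by simp, ?_⟩
    exact ⟨fun h _ _ => by omega, fun h _ _ => by omega, fun h _ _ => by omega,
      fun h _ _ => by omega, fun v h1 h2 => (h15 v h1 h2).ge,
      fun v h1 h2 => (h15 v h1 h2).trans_lt (by omega),
      fun v h1 h2 h3 => by rw [h15 v h1 h2] at h3; omega, fun v _ _ h _ _ => by omega⟩
  · rintro φ σ₁ hf ⟨h1, h2, rfl, hi⟩ hb
    have e8 : σ₁.reg 8 = 1 := (hf.reg 8 (by decide)).trans h8
    have e6 : σ₁.reg 6 = H - 1 := (hf.reg 6 (by decide)).trans h6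
    have e10 : σ₁.arr 10 = frm := (hf.arr 10 (by decide)).trans h10
    simp only [e6] at hb
    have f0 := hf0 _ h1 (by omega)
    have fK := hfK _ h1 (by omega)
    have g1 := hi.hd_ge _ f0 fK
    have g2 := hi.hd_lt _ f0 fK
    refine WP.load ?_ (WP.load ?_ (WP.store ?_ (WP.store ?_ (WP.add ?_ (WP.nil
      ⟨10 * (H - (σ₁.reg 14 + 1)).toNat, ?_, by omega⟩)))))
    · simp [e10, abs_le]; omega
    · simp [e10, abs_le]; omega
    · simp [e10, abs_le]; omega
    · simp [abs_le]; omega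
    · simp [e8, abs_le]; omega
    · simp [e8, e10]
      exact ⟨by omega, by omega, hi.link h1 f0 fK⟩
  · rintro σ' t hf ⟨φ', ⟨h1, h2, rfl, hi⟩, hb, ht⟩
    have e6 : σ'.reg 6 = H - 1 := (hf.reg 6 (by decide)).trans h6
    simp only [e6] at hb
    have h3 : σ'.reg 14 = H := by omega
    rw [h3] at hi
    exact ⟨hi, by omega⟩

section

/-! ### Selections and flows -/

/-- Row sums, column sums and totals of the level-intersection sizes are all instances. -/
theorem sum_card_fiber {α Q : Type} [Fintype Q] [DecidableEq Q] (S : Finset α) (f : α → Q)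
    (P : Q → Prop) [DecidablePred P] :
    ∑ q with P q, (S.filter fun s => f s = q).card = (S.filter fun s => P (f s)).card := by
  rw [Finset.card_eq_sum_card_fiberwise (f := f) (t := Finset.univ.filter P)]
  · refine Finset.sum_congr rfl fun q hq => ?_
    rw [Finset.filter_filter]
    congr 1
    refine Finset.filter_congr fun s _ => ?_
    constructor
    · rintro rfl
      exact ⟨(Finset.mem_filter.1 hq).2, rfl⟩
    · exact fun h => h.2
  · intro s hs
    simp only [Finset.coe_filter, Set.mem_ofPred_eq] at hs ⊢
    exact ⟨Finset.mem_univ _, hs.2⟩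

namespace Samples

variable {k : Fin 2 → ℕ} {n n' : ℕ} (I : Samples 2 k n n')

theorem sum_treatCount_fst (i : Fin (k 0)) :
    ∑ q : Fin (k 0) × Fin (k 1) with q.1 = i, I.treatCount q = I.levelSize 0 i :=
  sum_card_fiber Finset.univ I.treatCell fun q => q.1 = i

theorem sum_treatCount_snd (i : Fin (k 1)) :
    ∑ q : Fin (k 0) × Fin (k 1) with q.2 = i, I.treatCount q = I.levelSize 1 i :=
  sum_card_fiber Finset.univ I.treatCell fun q => q.2 = i

theorem sum_treatCount : ∑ q, I.treatCount q = n := by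
  have := sum_card_fiber Finset.univ I.treatCell fun _ => True
  simpa [treatCount] using this

theorem sum_controlCount : ∑ q, I.controlCount q = n' := by
  have := sum_card_fiber Finset.univ I.controlCell fun _ => True
  simpa [controlCount] using this

theorem sum_levelSize (p : Fin 2) : ∑ i, I.levelSize p i = n := by
  have := sum_card_fiber Finset.univ (fun s => I.treat s p) fun _ => True
  simpa [levelSize] using this

theorem network_balance_inl (x : Arc k → ℝ) (i : Fin (k 0)) :
    (∑ a with I.network.tail a = .inl i, x a) - (∑ a with I.network.head a = .inl i, x a) =
      (∑ q with q.1 = i, x (.inl q)) - ∑ q with q.1 = i, x (.inr q) := by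
  simp only [Finset.sum_filter, Fintype.sum_sum_type]
  simp [network]

theorem network_balance_inr (x : Arc k → ℝ) (i : Fin (k 1)) :
    (∑ a with I.network.tail a = .inr i, x a) - (∑ a with I.network.head a = .inr i, x a) =
      (∑ q with q.2 = i, x (.inr q)) - ∑ q with q.2 = i, x (.inl q) := by
  simp only [Finset.sum_filter, Fintype.sum_sum_type]
  simp [network]

theorem reversed_balance_inl (x : Arc k → ℝ) (i : Fin (k 0)) :
    (∑ a with I.reversedNetwork.tail a = .inl i, x a) -
      (∑ a with I.reversedNetwork.head a = .inl i, x a) =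
      -((∑ q with q.1 = i, x (.inl q)) + ∑ q with q.1 = i, x (.inr q)) := by
  simp only [Finset.sum_filter, Fintype.sum_sum_type]
  simp [reversedNetwork]

theorem reversed_balance_inr (x : Arc k → ℝ) (i : Fin (k 1)) :
    (∑ a with I.reversedNetwork.tail a = .inr i, x a) -
      (∑ a with I.reversedNetwork.head a = .inr i, x a) =
      (∑ q with q.2 = i, x (.inl q)) + ∑ q with q.2 = i, x (.inr q) := by
  simp only [Finset.sum_filter, Fintype.sum_sum_type]
  simp [reversedNetwork]

theorem network_isFeasible_iff (x : Arc k → ℝ) : I.network.IsFeasible x ↔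
    (∀ i, ∑ q with q.1 = i, x (.inl q) = ∑ q with q.1 = i, x (.inr q)) ∧
    (∀ i, ∑ q with q.2 = i, x (.inl q) = ∑ q with q.2 = i, x (.inr q)) ∧
    (∀ q, 0 ≤ x (.inl q) ∧ x (.inl q) ≤ I.treatCount q) ∧
    ∀ q, 0 ≤ x (.inr q) ∧ x (.inr q) ≤ I.controlCount q := by
  rw [FlowNetwork.IsFeasible, Sum.forall, Sum.forall]
  simp only [network_balance_inl, network_balance_inr]
  simp only [network, Sum.elim_inl, Sum.elim_inr, Int.cast_zero, Int.cast_natCast, sub_eq_zero]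
  rw [and_assoc]
  refine and_congr Iff.rfl (and_congr ?_ Iff.rfl)
  exact forall_congr' fun i => eq_comm

/-- Flow in `network` that corresponds to a real-valued flow in `reversedNetwork`. -/
def unreverseReal (x : Arc k → ℝ) : Arc k → ℝ :=
  Sum.elim (fun q => I.treatCount q - x (Sum.inl q)) (fun q => x (Sum.inr q))

theorem unreverseReal_unreverseReal (x : Arc k → ℝ) :
    I.unreverseReal (I.unreverseReal x) = x := by
  funext a
  rcases a with q | q <;> simp [unreverseReal]

theorem unreverseReal_cast (x : Arc k → ℤ) :
    I.unreverseReal (fun a => (x a : ℝ)) = fun a => (I.unreverse x a : ℝ) := by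
  funext a
  rcases a with q | q <;> simp [unreverseReal, unreverse]

/-- The supplies and demands of the reversed network are the row and column sums of the capacities
`u`. Substituting `u - x` on the treatment arcs therefore turns one set of balance equations into
the other. -/
theorem reversed_isFeasible_iff (x : Arc k → ℝ) :
    I.reversedNetwork.IsFeasible x ↔ I.network.IsFeasible (I.unreverseReal x) := by
  rw [network_isFeasible_iff, FlowNetwork.IsFeasible, Sum.forall, Sum.forall]
  simp only [reversed_balance_inl, reversed_balance_inr]
  simp only [reversedNetwork, unreverseReal, Sum.elim_inl, Sum.elim_inr, Int.cast_zero,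
    Int.cast_natCast, Int.cast_neg, Finset.sum_sub_distrib, ← sum_treatCount_fst,
    ← sum_treatCount_snd, Nat.cast_sum, Int.cast_sum]
  rw [and_assoc]
  refine and_congr (forall_congr' fun i => ?_) (and_congr (forall_congr' fun i => ?_)
    (and_congr (forall_congr' fun q => ?_) Iff.rfl))
  · constructor <;> intro h <;> linarith
  · constructor <;> intro h <;> linarith
  · constructor <;> rintro ⟨h1, h2⟩ <;> constructor <;> linarith

theorem network_totalCost (x : Arc k → ℝ) : I.network.totalCost x = -∑ q, x (.inl q) := by
  simp [FlowNetwork.totalCost, network]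

theorem reversed_totalCost (x : Arc k → ℝ) : I.reversedNetwork.totalCost x = ∑ q, x (.inl q) := by
  simp [FlowNetwork.totalCost, reversedNetwork]

/-- The costs differ by the constant `n`, so minimisers correspond. -/
theorem totalCost_unreverseReal (x : Arc k → ℝ) :
    I.network.totalCost (I.unreverseReal x) = I.reversedNetwork.totalCost x - n := by
  rw [network_totalCost, reversed_totalCost]
  simp only [unreverseReal, Sum.elim_inl, Finset.sum_sub_distrib]
  rw [← Nat.cast_sum, sum_treatCount]
  ring

theorem network_isFeasible_zero : I.network.IsFeasible fun _ => 0 := by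
  rw [network_isFeasible_iff]
  simp

theorem isMinCostFlow_unreverse {x : Arc k → ℤ}
    (hx : I.reversedNetwork.IsMinCostFlow fun a => (x a : ℝ)) :
    I.network.IsMinCostFlow fun a => (I.unreverse x a : ℝ) := by
  rw [← unreverseReal_cast]
  refine ⟨(I.reversed_isFeasible_iff _).1 hx.1, fun y hy => ?_⟩
  have h1 := hx.2 (I.unreverseReal y)
    ((I.reversed_isFeasible_iff _).2 (by rwa [unreverseReal_unreverseReal]))
  have h2 := I.totalCost_unreverseReal (I.unreverseReal y)
  rw [unreverseReal_unreverseReal] at h2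
  rw [totalCost_unreverseReal]
  linarith

/-- Summing over the level-intersections within one level turns fine balance into equality of row or
column sums. The capacity constraints hold for every selection. -/
theorem isFineBalanced_iff (S : Finset (Fin n)) (S' : Finset (Fin n')) :
    I.IsFineBalanced 1 S S' ↔ I.network.IsFeasible fun a => (I.selectionFlow S S' a : ℝ) := by
  rw [network_isFeasible_iff, IsFineBalanced, Fin.forall_fin_two]
  simp only [selectionFlow, Sum.elim_inl, Sum.elim_inr, one_mul, Int.cast_natCast]
  have h1 := fun i => sum_card_fiber S I.treatCell (fun q => q.1 = i)
  have h2 := fun i => sum_card_fiber S' I.controlCell (fun q => q.1 = i)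
  have h3 := fun i => sum_card_fiber S I.treatCell (fun q => q.2 = i)
  have h4 := fun i => sum_card_fiber S' I.controlCell (fun q => q.2 = i)
  have h5 : ∀ q, (S.filter fun s => I.treatCell s = q).card ≤ I.treatCount q := fun q =>
    Finset.card_le_card (Finset.filter_subset_filter _ (Finset.subset_univ _))
  have h6 : ∀ q, (S'.filter fun s => I.controlCell s = q).card ≤ I.controlCount q := fun q =>
    Finset.card_le_card (Finset.filter_subset_filter _ (Finset.subset_univ _))
  have h7 : (∀ q, (0 : ℝ) ≤ (S.filter fun s => I.treatCell s = q).card ∧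
      ((S.filter fun s => I.treatCell s = q).card : ℝ) ≤ I.treatCount q) :=
    fun q => ⟨Nat.cast_nonneg _, by exact_mod_cast h5 q⟩
  have h8 : (∀ q, (0 : ℝ) ≤ (S'.filter fun s => I.controlCell s = q).card ∧
      ((S'.filter fun s => I.controlCell s = q).card : ℝ) ≤ I.controlCount q) :=
    fun q => ⟨Nat.cast_nonneg _, by exact_mod_cast h6 q⟩
  simp only [← Nat.cast_sum, Nat.cast_inj, h1, h2, h3, h4]
  exact ⟨fun h => ⟨h.1, h.2, h7, h8⟩, fun h => ⟨h.1, h.2.1⟩⟩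

theorem totalCost_selectionFlow (S : Finset (Fin n)) (S' : Finset (Fin n')) :
    I.network.totalCost (fun a => (I.selectionFlow S S' a : ℝ)) = -(S.card : ℝ) := by
  rw [network_totalCost]
  have h := sum_card_fiber S I.treatCell fun _ => True
  simp only [Finset.filter_true] at h
  simp only [selectionFlow, Sum.elim_inl, Int.cast_natCast]
  rw [← Nat.cast_sum, h]

/-- The fibres are disjoint, so subsets of the right size can be chosen in each of them
independently. This is why every integral flow comes from a selection. -/
theorem exists_card_fiber_eq {α Q : Type} [Fintype α] [DecidableEq α] [Fintype Q] [DecidableEq Q]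
    (f : α → Q) (x : Q → ℕ)
    (hx : ∀ q, x q ≤ (Finset.univ.filter fun s => f s = q).card) :
    ∃ S : Finset α, ∀ q, (S.filter fun s => f s = q).card = x q := by
  choose T hT hc using fun q => Finset.exists_subset_card_eq (hx q)
  have hf : ∀ q, ∀ s ∈ T q, f s = q := fun q s hs => (Finset.mem_filter.1 (hT q hs)).2
  refine ⟨Finset.univ.biUnion T, fun q => ?_⟩
  rw [← hc q]
  congr 1
  ext s
  simp only [Finset.mem_filter, Finset.mem_biUnion, Finset.mem_univ, true_and]
  constructor
  · rintro ⟨⟨r, hr⟩, rfl⟩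
    rwa [hf r s hr]
  · exact fun h => ⟨⟨q, h⟩, hf q s h⟩

theorem exists_selectionFlow_eq {x : Arc k → ℤ} (hx : I.network.IsFeasible fun a => (x a : ℝ)) :
    ∃ (S : Finset (Fin n)) (S' : Finset (Fin n')), I.selectionFlow S S' = x := by
  obtain ⟨-, -, h3, h4⟩ := (I.network_isFeasible_iff _).1 hx
  have h3' : ∀ q, 0 ≤ x (.inl q) ∧ x (.inl q) ≤ I.treatCount q := fun q => by
    exact_mod_cast h3 q
  have h4' : ∀ q, 0 ≤ x (.inr q) ∧ x (.inr q) ≤ I.controlCount q := fun q => by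
    exact_mod_cast h4 q
  obtain ⟨S, hS⟩ := exists_card_fiber_eq I.treatCell (fun q => (x (.inl q)).toNat) (fun q => by
    have := h3' q
    rw [treatCount] at this
    omega)
  obtain ⟨S', hS'⟩ := exists_card_fiber_eq I.controlCell (fun q => (x (.inr q)).toNat) (fun q => by
    have := h4' q
    rw [controlCount] at this
    omega)
  refine ⟨S, S', funext fun a => ?_⟩
  rcases a with q | q
  · simp [selectionFlow, hS, (h3' q).1]
  · simp [selectionFlow, hS', (h4' q).1]

/-- Selections realise only integral flows, while the minimum is taken over real-valued ones. The
integral minimum cost flow `z` bridges the gap: it comes from a selection, so the best selection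
attains the real minimum. -/
theorem isMaxSelection_iff {z : Arc k → ℤ} (hz : I.network.IsMinCostFlow fun a => (z a : ℝ))
    (S : Finset (Fin n)) (S' : Finset (Fin n')) : I.IsMaxSelection 1 S S' ↔
      I.network.IsMinCostFlow fun a => (I.selectionFlow S S' a : ℝ) := by
  obtain ⟨R, R', rfl⟩ := I.exists_selectionFlow_eq hz.1
  constructor
  · rintro ⟨h1, h2⟩
    refine ⟨(I.isFineBalanced_iff S S').1 h1, fun y hy => ?_⟩
    have h3 := hz.2 y hy
    rw [totalCost_selectionFlow] at h3 ⊢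
    have h4 : (R.card : ℝ) ≤ S.card := by
      exact_mod_cast h2 R R' ((I.isFineBalanced_iff R R').2 hz.1)
    linarith
  · rintro ⟨h1, h2⟩
    refine ⟨(I.isFineBalanced_iff S S').2 h1, fun T T' hT => ?_⟩
    have h3 := h2 _ ((I.isFineBalanced_iff T T').1 hT)
    rw [totalCost_selectionFlow, totalCost_selectionFlow] at h3
    exact_mod_cast neg_le_neg_iff.1 h3

end Samples

/-- Without treatment samples the treatment arcs have capacity `0`, so every feasible flow costs
`0`. The case is separate because the analysis of the program assumes `0 < n`. -/
theorem Samples.isMinCostFlow_zero {k : Fin 2 → ℕ} {n' : ℕ} (I : Samples 2 k 0 n') :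
    I.network.IsMinCostFlow fun a => (((0 : Arc k → ℤ) a : ℤ) : ℝ) := by
  simp only [Pi.zero_apply, Int.cast_zero]
  refine ⟨I.network_isFeasible_zero, fun y hy => ?_⟩
  obtain ⟨-, -, h3, -⟩ := (I.network_isFeasible_iff _).1 hy
  have h : ∀ q, y (.inl q) = 0 := fun q => by
    have h4 : I.treatCount q = 0 := by simp [treatCount]
    have := h3 q
    rw [h4, Nat.cast_zero] at this
    linarith
  simp [network_totalCost, h]

end

/-! ### The graph in memory represents the network; the run of the main loop -/

section

open FlowNetwork

set_option linter.unusedSectionVars false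

section

variable {V A : Type} [DecidableEq V] [Fintype V] [Fintype A] [DecidableEq A]

/-- The graph in memory. -/
def graphOf (K M B : ℤ) (σ : Memory) : Graph :=
  ⟨K, M + M, B, σ.arr 10, σ.arr 11, σ.arr 12, σ.arr 13, σ.arr 14, σ.arr 15⟩

/-- The arcs listed by `arc`, followed by their reverses. -/
def residualArc (M : ℤ) (arc : ℤ → A) (h : ℤ) : A × Bool :=
  if h < M then (arc h, true) else (arc (h - M), false)

theorem residualArc_of_lt {M : ℤ} {arc : ℤ → A} {h : ℤ} (hM : h < M) :
    residualArc M arc h = (arc h, true) := if_pos hM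

theorem residualArc_add {M : ℤ} {arc : ℤ → A} {h : ℤ} (h0 : 0 ≤ h) :
    residualArc M arc (M + h) = (arc h, false) := by
  rw [residualArc, if_neg (by omega), add_sub_cancel_left]

theorem represents_graphOf {N : FlowNetwork V A} {ix : V → ℤ} {arc : ℤ → A} {K M B U : ℤ}
    {σ : Memory} (ix_nonneg : ∀ v, 0 ≤ ix v) (ix_lt : ∀ v, ix v < K)
    (ix_inj : Function.Injective ix) (ix_surj : ∀ i, 0 ≤ i → i < K → ∃ v, ix v = i)
    (arc_inj : ∀ h, 0 ≤ h → h < M → ∀ h', 0 ≤ h' → h' < M → arc h = arc h' → h = h')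
    (arc_surj : ∀ a, N.lower a < N.upper a → ∃ h, 0 ≤ h ∧ h < M ∧ arc h = a)
    (hd : ∀ h, 0 ≤ h → h < M → ArcData M σ h (ix (N.tail (arc h))) (ix (N.head (arc h)))
      (N.cost (arc h)) (N.upper (arc h)))
    (hl : Linked K (M + M) (σ.arr 10) (σ.arr 14) (σ.arr 15)) (hK : 0 ≤ K) (hKB : K ≤ B)
    (hM : 0 ≤ M) (hMB : M ≤ B) (hB : 3 ≤ B) (hc0 : ∀ a, -1 ≤ N.cost a) (hc1 : ∀ a, N.cost a ≤ 1)
    (hcap : ∀ a, N.upper a - N.lower a ≤ B) (hU : U ≤ B)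
    (hfeas : ∃ y, N.IsFeasible y ∧ N.totalCost y ≤ U) :
    Represents N (graphOf K M B σ) ix (residualArc M arc) U := by
  have hcases : ∀ h, 0 ≤ h → h < M + M → h < M ∨ ∃ g, 0 ≤ g ∧ g < M ∧ h = M + g := by
    intro h h0 h1
    rcases lt_or_ge h M with h2 | h2
    · exact Or.inl h2
    · exact Or.inr ⟨h - M, by omega, by omega, by omega⟩
  have hfrm : ∀ h, 0 ≤ h → h < M + M → σ.arr 10 h = ix (N.resTail (residualArc M arc h)) := by
    intro h h0 h1
    rcases hcases h h0 h1 with h2 | ⟨g, h2, h3, rfl⟩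
    · rw [residualArc_of_lt h2]; exact (hd h h0 h2).frm
    · rw [residualArc_add h2]; exact (hd g h2 h3).frm'
  have htgt : ∀ h, 0 ≤ h → h < M + M → σ.arr 11 h = ix (N.resHead (residualArc M arc h)) := by
    intro h h0 h1
    rcases hcases h h0 h1 with h2 | ⟨g, h2, h3, rfl⟩
    · rw [residualArc_of_lt h2]; exact (hd h h0 h2).tgt
    · rw [residualArc_add h2]; exact (hd g h2 h3).tgt'
  have hcst : ∀ h, 0 ≤ h → h < M + M → σ.arr 12 h = N.resCost (residualArc M arc h) := by
    intro h h0 h1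
    rcases hcases h h0 h1 with h2 | ⟨g, h2, h3, rfl⟩
    · rw [residualArc_of_lt h2]; exact (hd h h0 h2).cst
    · rw [residualArc_add h2]; exact (hd g h2 h3).cst'
  have hcost : ∀ e, -1 ≤ N.resCost e ∧ N.resCost e ≤ 1 := by
    rintro ⟨a, _ | _⟩ <;> simp only [resCost] <;> have := hc0 a <;> have := hc1 a <;> omega
  refine ⟨?_, ix_nonneg, ix_lt, ix_inj, ix_surj, ?_, ?_, ?_, hfrm, htgt, hcst, hcap, hU, hfeas⟩
  · refine
      { K_nonneg := hK
        H_nonneg := by simp only [graphOf]; omega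
        one_le_B := hB
        K_le := hKB
        H_le := by simp only [graphOf]; omega
        frm_nonneg := fun h h0 h1 => (ix_nonneg _).trans_eq (hfrm h h0 h1).symm
        frm_lt := fun h h0 h1 => (hfrm h h0 h1).trans_lt (ix_lt _)
        tgt_nonneg := fun h h0 h1 => (ix_nonneg _).trans_eq (htgt h h0 h1).symm
        tgt_lt := fun h h0 h1 => (htgt h h0 h1).trans_lt (ix_lt _)
        cst_ge := fun h h0 h1 => (hcost _).1.trans_eq (hcst h h0 h1).symm
        cst_le := fun h h0 h1 => (hcst h h0 h1).trans_le (hcost _).2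
        rv_nonneg := fun h h0 h1 => ?_
        rv_lt := fun h h0 h1 => ?_
        rv_rv := fun h h0 h1 => ?_
        rv_ne := fun h h0 h1 => ?_
        nxt_ge := hl.nxt_ge
        nxt_lt := hl.nxt_lt
        frm_nxt := hl.frm_nxt
        le_nxt := hl.le_nxt
        hd_ge := hl.hd_ge
        hd_lt := hl.hd_lt
        frm_hd := hl.frm_hd
        le_hd := hl.le_hd }
    all_goals
      simp only [graphOf] at *
      rcases hcases h h0 h1 with h2 | ⟨g, h2, h3, rfl⟩
    · rw [(hd h h0 h2).rv]; omega
    · rw [(hd g h2 h3).rv']; omega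
    · rw [(hd h h0 h2).rv]; omega
    · rw [(hd g h2 h3).rv']; omega
    · rw [(hd h h0 h2).rv, (hd h h0 h2).rv']
    · rw [(hd g h2 h3).rv', (hd g h2 h3).rv]
    · rw [(hd h h0 h2).rv]; omega
    · rw [(hd g h2 h3).rv']; omega
  · intro h h0 h1 h' h0' h1' he
    rcases hcases h h0 h1 with h2 | ⟨g, h2, h3, rfl⟩ <;>
      rcases hcases h' h0' h1' with h2' | ⟨g', h2', h3', rfl⟩
    · rw [residualArc_of_lt h2, residualArc_of_lt h2', Prod.mk.injEq] at he
      exact arc_inj h h0 h2 h' h0' h2' he.1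
    · rw [residualArc_of_lt h2, residualArc_add h2'] at he
      simp at he
    · rw [residualArc_add h2, residualArc_of_lt h2'] at he
      simp at he
    · rw [residualArc_add h2, residualArc_add h2', Prod.mk.injEq] at he
      rw [arc_inj g h2 h3 g' h2' h3' he.1]
  · rintro ⟨a, b⟩ ha
    obtain ⟨h, h0, h1, rfl⟩ := arc_surj a ha
    rcases b with _ | _
    · exact ⟨M + h, by omega, by simp only [graphOf]; omega, residualArc_add h0⟩
    · exact ⟨h, h0, by simp only [graphOf]; omega, residualArc_of_lt h1⟩
  · intro h h0 h1
    simp only [graphOf] at *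
    rcases hcases h h0 h1 with h2 | ⟨g, h2, h3, rfl⟩
    · rw [(hd h h0 h2).rv, residualArc_add h0, residualArc_of_lt h2]
      rfl
    · rw [(hd g h2 h3).rv', residualArc_add h2, residualArc_of_lt h3]
      rfl

/-- Here the reversal of the treatment arcs pays off: the costs are nonnegative, and only forward
arcs are residual at the zero flow, so zero potentials are a valid start. -/
theorem holds_zero {N : FlowNetwork V A} {ix : V → ℤ} {arc : ℤ → A} {K M B : ℤ}
    {σ : Memory} (hd : ∀ h, 0 ≤ h → h < M → ArcData M σ h (ix (N.tail (arc h)))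
      (ix (N.head (arc h))) (N.cost (arc h)) (N.upper (arc h)))
    (hexc : ∀ v, σ.arr 17 (ix v) = N.supply v) (hpi : ∀ i, σ.arr 18 i = 0)
    (hlow : ∀ a, N.lower a = 0) (hup : ∀ a, 0 ≤ N.upper a) (hcost : ∀ a, 0 ≤ N.cost a)
    (hB : ∀ v, |N.supply v| ≤ B) :
    Holds N (graphOf K M B σ) ix (residualArc M arc) σ 0 0 where
  cap h h0 h1 := by
    simp only [graphOf] at h1
    rcases lt_or_ge h M with h2 | h2
    · rw [residualArc_of_lt h2, (hd h h0 h2).cap]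
      simp [resCap]
    · obtain ⟨g, rfl⟩ : ∃ g, h = M + g := ⟨h - M, by omega⟩
      rw [residualArc_add (by omega), (hd g (by omega) (by omega)).cap']
      simp [resCap, hlow]
  exc v := by
    rw [hexc]
    simp [excess]
  pi v := hpi _
  slack := by
    constructor
    · rintro ⟨a, _ | _⟩ <;> simp [resCap, hlow, hup]
    · rintro ⟨a, _ | _⟩ <;> simp [resCap, hlow, redCost, resCost, hcost]
  pi_nonneg v := le_rfl
  pi_le v := by simp [lagrangian]
  exc_le v := by simpa [excess, graphOf] using hB v

/-- The state of the memory before and after an iteration. -/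
structure Ready (N : FlowNetwork V A) (G : Graph) (ix : V → ℤ) (ed : ℤ → A × Bool) (m₁ m₂ : ℤ)
    (σ : Memory) (x : A → ℤ) (π : V → ℤ) : Prop where
  mem : G.Mem σ
  holds : Holds N G ix ed σ x π
  counts : Counts G m₁ m₂ σ
  copied : Copied m₁ m₂ σ
  rem : σ.reg 10 = N.remaining x
  rem_le : σ.reg 10 ≤ G.B

/-- Induction on the bound `r` for the remaining supply, which drops by at least `1` in every
iteration. The store measured by the Lagrangian passes from one iteration to the next, so raises are
paid once in total. Each iteration adds `100 * G.size` for the body, and one more `G.size` covers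
the loop test. -/
theorem exists_run {W : ℤ} {N : FlowNetwork V A} {G : Graph} {ix : V → ℤ} {ed : ℤ → A × Bool}
    {U m₁ m₂ : ℤ} (hR : Represents N G ix ed U) (hW : 27 * G.B ≤ W) (r : ℕ) :
    ∀ (σ : Memory) (x : A → ℤ) (π : V → ℤ), Ready N G ix ed m₁ m₂ σ x π → N.remaining x ≤ r →
    ∃ (m : ℕ) (xs : ℕ → A → ℤ) (σs : ℕ → Memory) (ts : ℕ → ℕ), m ≤ r ∧ xs 0 = x ∧ σs 0 = σ ∧
      (∀ j < m, Test.Holds ⟨8, 10⟩ (σs j) ∧ Exec W bodyProg (σs j) (σs (j + 1)) (ts j)) ∧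
      ¬ Test.Holds ⟨8, 10⟩ (σs m) ∧ (∀ j < m, N.SSPStep (xs j) (xs (j + 1))) ∧
      (∀ j ≤ m, Frame bodyProg σ (σs j) ∧ ∃ π, Ready N G ix ed m₁ m₂ (σs j) (xs j) π) ∧
      ∑ j ∈ Finset.range m, (1 + ts j) ≤
        60 * G.size * (U - N.lagrangian x π).toNat + 101 * G.size * r := by
  induction r with
  | zero =>
    intro σ x π hr h0
    refine ⟨0, fun _ => x, fun _ => σ, fun _ => 0, le_rfl, rfl, rfl, by simp, ?_, by simp,
      fun j _ => ⟨Frame.refl _ _, π, hr⟩, by simp⟩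
    have h1 := hr.rem
    have h2 := hr.mem.r8
    simp only [Test.Holds]
    push_cast at h0
    omega
  | succ r ih =>
    intro σ x π hr h0
    by_cases hb : Test.Holds ⟨8, 10⟩ σ
    · have hb' := hb
      simp only [Test.Holds, hr.mem.r8] at hb'
      obtain ⟨σ', t, he, x', π', hstep, hh, hcop, hrem, hdec, ht⟩ :=
        wp_bodyProg hR hW hr.mem hr.holds hr.counts hr.rem (by omega) hr.rem_le
      have hf := he.frame
      have hr' : Ready N G ix ed m₁ m₂ σ' x' π' :=
        ⟨hr.mem.frame hf (by decide) (by decide), hh, hr.counts.frame hf (by decide), hcop, hrem,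
          by have := hr.rem_le; omega⟩
      obtain ⟨m, xs, σs, ts, k1, k2, k3, k4, k5, k6, k7, k8⟩ := ih σ' x' π' hr' (by
        have := hr.rem
        push_cast at h0
        omega)
      refine ⟨m + 1, fun j => Nat.casesOn j x xs, fun j => Nat.casesOn j σ σs,
        fun j => Nat.casesOn j t ts, by omega, rfl, rfl, ?_, k5, ?_, ?_, ?_⟩
      · rintro (_ | j) hj
        · rw [← k3] at he
          exact ⟨hb, he⟩
        · exact k4 j (by omega)
      · rintro (_ | j) hj
        · rw [← k2] at hstep
          exact hstep
        · exact k6 j (by omega)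
      · rintro (_ | j) hj
        · exact ⟨Frame.refl _ _, π, hr⟩
        · obtain ⟨g1, g2⟩ := k7 j (by omega)
          exact ⟨hf.trans g1, g2⟩
      · rw [Finset.sum_range_succ']
        have hsize : 1 ≤ G.size := Nat.le_add_left _ _
        change ∑ j ∈ Finset.range m, (1 + ts j) + (1 + t) ≤ _
        rw [mul_add]
        omega
    · exact ⟨0, fun _ => x, fun _ => σ, fun _ => 0, by simp, rfl, rfl, by simp, hb, by simp,
        fun j _ => ⟨Frame.refl _ _, π, hr⟩, by simp⟩

end

end

section

open FlowNetwork

/-! ### The whole program -/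

/-- Build the graph. -/
def startProg : Program :=
  .seq (block [.const 7 0, .const 8 1, .const 9 (-1), .add 4 0 1, .add 5 2 3, .add 6 5 5,
    .sub 6 6 8, .const 21 0, .move 11 2]) (.seq (addLoop 0 1 2 8 9) (.seq (block [.move 21 2,
    .move 11 3]) (.seq (addLoop 3 4 5 7 7) (.seq (block [.move 11 2]) (.seq excessLoop
    (.seq (block [.move 11 4]) (.seq clearLoop (.seq (block [.const 14 0]) linkLoop))))))))

/-- The part of the memory after `startProg` that depends on the input. -/
structure Started (k₀ k₁ B : ℤ) (m₁ m₂ : ℕ) (a a' b b' u u' : ℕ → ℤ) (σ : Memory) : Prop where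
  r4 : σ.reg 4 = k₀ + k₁
  r5 : σ.reg 5 = m₁ + m₂
  r7 : σ.reg 7 = 0
  r8 : σ.reg 8 = 1
  r9 : σ.reg 9 = -1
  r10 : σ.reg 10 = ∑ j ∈ Finset.range m₁, u j
  arc₁ : ∀ j < m₁, ArcData (m₁ + m₂) σ j (b j + k₀) (a j) 1 (u j)
  arc₂ : ∀ j < m₂, ArcData (m₁ + m₂) σ (m₁ + j) (b' j + k₀) (a' j) 0 (u' j)
  exc : ∀ i, σ.arr 17 i = ∑ j ∈ Finset.range m₁, (if b j + k₀ = i then u j else 0) -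
    ∑ j ∈ Finset.range m₁, (if a j = i then u j else 0)
  linked : Linked (k₀ + k₁) (m₁ + m₂ + (m₁ + m₂)) (σ.arr 10) (σ.arr 14) (σ.arr 15)

theorem wp_startProg {W B k₀ k₁ : ℤ} {m₁ m₂ : ℕ} {a a' b b' u u' : ℕ → ℤ} (hW : 27 * B ≤ W)
    {σ : Memory} (h0 : σ.reg 0 = k₀) (h1 : σ.reg 1 = k₁) (h2 : σ.reg 2 = m₁) (h3 : σ.reg 3 = m₂)
    (h10 : σ.reg 10 = 0) (h17 : ∀ i, σ.arr 17 i = 0) (hB : 3 ≤ B) (hk₀ : 0 ≤ k₀) (hk₁ : 0 ≤ k₁)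
    (hkB : k₀ + k₁ ≤ B) (hmB : (m₁ : ℤ) + m₂ ≤ B)
    (ea : ∀ j < m₁, σ.arr 0 j = a j) (eb : ∀ j < m₁, σ.arr 1 j = b j)
    (eu : ∀ j < m₁, σ.arr 2 j = u j) (ea' : ∀ j < m₂, σ.arr 3 j = a' j)
    (eb' : ∀ j < m₂, σ.arr 4 j = b' j) (eu' : ∀ j < m₂, σ.arr 5 j = u' j)
    (ba : ∀ j < m₁, 0 ≤ a j ∧ a j < k₀) (bb : ∀ j < m₁, 0 ≤ b j ∧ b j < k₁)
    (ba' : ∀ j < m₂, 0 ≤ a' j ∧ a' j < k₀) (bb' : ∀ j < m₂, 0 ≤ b' j ∧ b' j < k₁)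
    (bu : ∀ j, 0 ≤ u j) (bu' : ∀ j, 0 ≤ u' j) (hu : ∑ j ∈ Finset.range m₁, u j ≤ B)
    (hu' : ∀ j < m₂, u' j ≤ B) :
    WP W startProg σ fun σ' t => Started k₀ k₁ B m₁ m₂ a a' b b' u u' σ' ∧
      t ≤ 60 * (m₁ + m₂) + 20 * (k₀ + k₁).toNat + 60 := by
  have huB : ∀ j < m₁, u j ≤ B := fun j hj =>
    (Finset.single_le_sum (fun i _ => bu i) (Finset.mem_range.2 hj)).trans hu
  have hnat : ∀ (m : ℕ) (P : ℤ → Prop), (∀ j < m, P (j : ℕ)) → ∀ j : ℤ, 0 ≤ j → j < m → P j := by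
    intro m P hP j j0 j1
    obtain ⟨i, rfl⟩ := Int.eq_ofNat_of_zero_le j0
    exact hP i (by omega)
  refine WP.seq (WP.const ?_ (WP.const ?_ (WP.const ?_ (WP.add ?_ (WP.add ?_ (WP.add ?_ (WP.sub ?_
    (WP.const ?_ (WP.move ?_ (WP.nil ?_))))))))))
  · simp; omega
  · simp; omega
  · simp; omega
  · simp [h0, h1, abs_le]; omega
  · simp [h2, h3, abs_le]; omega
  · simp [h2, h3, abs_le]; omega
  · simp [h2, h3, abs_le]; omega
  · simp; omega
  · simp [h2]; omega
  refine WP.seq (WP.mono (wp_addLoop (B := B) (N := m₁) (off := 0) (M := m₁ + m₂) hW (by decide)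
    (by decide) (by decide) (by decide) (by decide) ?_ ?_ ?_ ?_ ?_ (by omega) le_rfl (by omega) hmB
    (by omega) ?_ ?_ ?_ ?_ ?_ ?_) ?_)
  · simp
  · simp
  · simp [h2]
  · simp
  · simp [h2, h3]
  · simp
  · simp; omega
  · refine hnat m₁ _ fun j hj => ?_
    have := ba j hj
    simp [ea j hj, abs_le]; omega
  · refine hnat m₁ _ fun j hj => ?_
    have := bb j hj
    simp [eb j hj, abs_le]; omega
  · refine hnat m₁ _ fun j hj => ?_
    have := bu j
    have := huB j hj
    simp [eu j hj, abs_le]; omega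
  · simp [h0, abs_le]; omega
  rintro σ₁ t₁ hf₁ ⟨hA, -, ht₁⟩
  have hinp₁ : ∀ i < 10, σ₁.arr i = σ.arr i := fun i hi =>
    (hf₁.arr i (by simp [addLoop, block, Program.arrs]; omega)).trans (by simp)
  have q0 : σ₁.reg 0 = k₀ := (hf₁.reg 0 (by decide)).trans (by simp [h0])
  have q2 : σ₁.reg 2 = m₁ := (hf₁.reg 2 (by decide)).trans (by simp [h2])
  have q3 : σ₁.reg 3 = m₂ := (hf₁.reg 3 (by decide)).trans (by simp [h3])
  have q4 : σ₁.reg 4 = k₀ + k₁ := (hf₁.reg 4 (by decide)).trans (by simp [h0, h1])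
  have q5 : σ₁.reg 5 = m₁ + m₂ := (hf₁.reg 5 (by decide)).trans (by simp [h2, h3])
  have q6 : σ₁.reg 6 = m₁ + m₂ + (m₁ + m₂) - 1 :=
    (hf₁.reg 6 (by decide)).trans (by simp [h2, h3])
  have q7 : σ₁.reg 7 = 0 := (hf₁.reg 7 (by decide)).trans (by simp)
  have q8 : σ₁.reg 8 = 1 := (hf₁.reg 8 (by decide)).trans (by simp)
  have q9 : σ₁.reg 9 = -1 := (hf₁.reg 9 (by decide)).trans (by simp)
  have q10 : σ₁.reg 10 = 0 := (hf₁.reg 10 (by decide)).trans (by simp [h10])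
  have q17 : ∀ i, σ₁.arr 17 i = 0 := fun i => by
    rw [hf₁.arr 17 (by decide)]
    simp [h17]
  clear hf₁
  have hA₁ : ∀ j < m₁, ArcData (m₁ + m₂) σ₁ j (b j + k₀) (a j) 1 (u j) := fun j hj => by
    simpa [ea j hj, eb j hj, eu j hj, h0] using hA j (by omega) (by omega)
  refine WP.seq (WP.move ?_ (WP.move ?_ (WP.nil ?_)))
  · simp [q2]; omega
  · simp [q3]; omega
  refine WP.seq (WP.mono (wp_addLoop (B := B) (N := m₂) (off := m₁) (M := m₁ + m₂) hW (by decide)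
    (by decide) (by decide) (by decide) (by decide) ?_ ?_ ?_ ?_ ?_ (by omega) (by omega) le_rfl hmB
    (by omega) ?_ ?_ ?_ ?_ ?_ ?_) ?_)
  · simp [q7]
  · simp [q8]
  · simp [q3]
  · simp [q2]
  · simp [q5]
  · simp [q7]
  · simp [q7]; omega
  · refine hnat m₂ _ fun j hj => ?_
    have := ba' j hj
    simp [hinp₁, ea' j hj, abs_le]; omega
  · refine hnat m₂ _ fun j hj => ?_
    have := bb' j hj
    simp [hinp₁, eb' j hj, abs_le]; omega
  · refine hnat m₂ _ fun j hj => ?_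
    have := bu' j
    have := hu' j hj
    simp [hinp₁, eu' j hj, abs_le]; omega
  · simp [q0, abs_le]; omega
  rintro σ₂ t₂ hf₂ ⟨hA', hkeep, ht₂⟩
  have hinp₂ : ∀ i < 10, σ₂.arr i = σ.arr i := fun i hi =>
    (hf₂.arr i (by simp [addLoop, block, Program.arrs]; omega)).trans (hinp₁ i hi)
  have hreg₂ : ∀ i < 11, σ₂.reg i = σ₁.reg i := fun i hi =>
    (hf₂.reg i (by simp [addLoop, block, Program.regs]; omega)).trans (by
      simp only [Memory.reg_setReg]
      rw [if_neg (by omega), if_neg (by omega)])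
  have p17 : ∀ i, σ₂.arr 17 i = 0 := fun i => by
    rw [hf₂.arr 17 (by decide)]
    simp [q17]
  clear hf₂
  have hA₂ : ∀ j < m₂, ArcData (m₁ + m₂) σ₂ (m₁ + j) (b' j + k₀) (a' j) 0 (u' j) := fun j hj => by
    simpa [hinp₁, ea' j hj, eb' j hj, eu' j hj, q0, q7] using hA' j (by omega) (by omega)
  have hA₁₂ : ∀ j < m₁, ArcData (m₁ + m₂) σ₂ j (b j + k₀) (a j) 1 (u j) := fun j hj => by
    refine hkeep _ _ _ _ _ (by omega) (by omega) (by omega) ?_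
    exact (hA₁ j hj).congr (fun i _ => rfl) (fun i _ => rfl)
  refine WP.seq (WP.move ?_ (WP.nil ?_))
  · rw [hreg₂ 2 (by omega), q2, abs_le]; omega
  refine WP.seq (WP.mono (wp_excessLoop (B := B) (N := m₁) (a := a) (b := fun j => b j + k₀)
    (u := u) hW ?_ ?_ ?_ ?_ ?_ ?_ ?_ ?_ ?_ ?_ (by omega) bu hu) ?_)
  · simp [hreg₂, q8]
  · simp [hreg₂, q2]
  · simp [hreg₂, q10]
  · simp [p17]
  · intro j hj
    simp [hinp₂, ea j hj]
  · intro j hj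
    simp [hinp₂, eb j hj, hreg₂, q0]
  · intro j hj
    simp [hinp₂, eu j hj]
  · intro j hj
    have := ba j hj
    rw [abs_le]; omega
  · intro j hj
    have := bb j hj
    rw [abs_le]; omega
  · simp [hreg₂, q0, abs_le]; omega
  rintro σ₃ t₃ hf₃ ⟨hexc, hsum, ht₃⟩
  have hreg₃ : ∀ i < 10, σ₃.reg i = σ₁.reg i := fun i hi =>
    (hf₃.reg i (by simp [excessLoop, block, Program.regs]; omega)).trans (by
      simp only [Memory.reg_setReg]
      rw [if_neg (by omega), hreg₂ i (by omega)])
  have harr₃ : ∀ i, i ≠ 17 → σ₃.arr i = σ₂.arr i := fun i hi =>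
    (hf₃.arr i (by simp [excessLoop, block, Program.arrs]; omega)).trans (by simp)
  clear hf₃
  refine WP.seq (WP.move ?_ (WP.nil ?_))
  · rw [hreg₃ 4 (by omega), q4, abs_le]; omega
  refine WP.seq (WP.mono (wp_clearLoop (K := k₀ + k₁) (by omega) ?_ ?_ ?_ (by omega) (by omega)) ?_)
  · simp [hreg₃, q8]
  · simp [hreg₃, q9]
  · simp [hreg₃, q4]
  rintro σ₄ t₄ hf₄ ⟨hclear, ht₄⟩
  have hreg₄ : ∀ i < 11, σ₄.reg i = σ₃.reg i := fun i hi =>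
    (hf₄.reg i (by simp [clearLoop, block, Program.regs]; omega)).trans (by
      simp only [Memory.reg_setReg]
      rw [if_neg (by omega)])
  have harr₄ : ∀ i, i ≠ 15 → σ₄.arr i = σ₃.arr i := fun i hi =>
    (hf₄.arr i (by simp [clearLoop, block, Program.arrs]; omega)).trans (by simp)
  clear hf₄
  have harr₄₂ : ∀ i, i ≠ 15 → i ≠ 17 → σ₄.arr i = σ₂.arr i := fun i h h' =>
    (harr₄ i h).trans (harr₃ i h')
  have hA₁₄ : ∀ j < m₁, ArcData (m₁ + m₂) σ₄ j (b j + k₀) (a j) 1 (u j) := fun j hj => by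
    refine (hA₁₂ j hj).congr (fun i hi => ?_) (fun i hi => ?_) <;>
      rw [harr₄₂] <;> rintro rfl <;> simp at hi
  have hA₂₄ : ∀ j < m₂, ArcData (m₁ + m₂) σ₄ (m₁ + j) (b' j + k₀) (a' j) 0 (u' j) := fun j hj => by
    refine (hA₂ j hj).congr (fun i hi => ?_) (fun i hi => ?_) <;>
      rw [harr₄₂] <;> rintro rfl <;> simp at hi
  -- The linking loop uses tails as indices of list heads, so the tails of all arcs and of their
  -- reverses must be node numbers.
  have hfrm : ∀ h, 0 ≤ h → h < (m₁ : ℤ) + m₂ + (m₁ + m₂) →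
      0 ≤ σ₄.arr 10 h ∧ σ₄.arr 10 h < k₀ + k₁ := by
    intro h g0 g1
    have hlow : ∀ g, 0 ≤ g → g < (m₁ : ℤ) + m₂ → (0 ≤ σ₄.arr 10 g ∧ σ₄.arr 10 g < k₀ + k₁) ∧
        0 ≤ σ₄.arr 10 (m₁ + m₂ + g) ∧ σ₄.arr 10 (m₁ + m₂ + g) < k₀ + k₁ := by
      intro g g0 g1
      obtain ⟨i, rfl⟩ := Int.eq_ofNat_of_zero_le g0
      rcases lt_or_ge i m₁ with hi | hi
      · have r1 := ba i hi
        have r2 := bb i hi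
        rw [(hA₁₄ i hi).frm, (hA₁₄ i hi).frm']
        omega
      · obtain ⟨j, rfl⟩ := Nat.exists_eq_add_of_le hi
        have hj : j < m₂ := by omega
        have r1 := ba' j hj
        have r2 := bb' j hj
        push_cast
        rw [(hA₂₄ j hj).frm, (hA₂₄ j hj).frm']
        omega
    rcases lt_or_ge h ((m₁ : ℤ) + m₂) with h2 | h2
    · exact (hlow h g0 h2).1
    · have := (hlow (h - (m₁ + m₂)) (by omega) (by omega)).2
      rwa [add_sub_cancel] at this
  refine WP.seq (WP.const ?_ (WP.nil ?_))
  · simp; omega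
  refine WP.mono (wp_linkLoop (K := k₀ + k₁) (H := m₁ + m₂ + (m₁ + m₂)) ?_ ?_ ?_ rfl ?_ (by omega)
    (by omega) (by omega) (by omega) ?_ ?_) ?_
  · simp [hreg₄, hreg₃, q8]
  · simp [hreg₄, hreg₃, q6]
  · simp
  · simpa using hclear
  · simpa using fun h g0 g1 => (hfrm h g0 g1).1
  · simpa using fun h g0 g1 => (hfrm h g0 g1).2
  rintro σ₅ t₅ hf₅ ⟨hlink, ht₅⟩
  have hreg₅ : ∀ i < 11, σ₅.reg i = σ₃.reg i := fun i hi =>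
    (hf₅.reg i (by simp [linkLoop, block, Program.regs]; omega)).trans (by
      simp only [Memory.reg_setReg]
      rw [if_neg (by omega), hreg₄ i hi])
  have harr₅ : ∀ i, i ≠ 14 → i ≠ 15 → σ₅.arr i = σ₄.arr i := fun i hi hi' =>
    (hf₅.arr i (by simp [linkLoop, block, Program.arrs]; omega)).trans (by simp)
  refine ⟨⟨?_, ?_, ?_, ?_, ?_, ?_, fun j hj => ?_, fun j hj => ?_, ?_, ?_⟩, ?_⟩
  · simp [hreg₅, hreg₃, q4]
  · simp [hreg₅, hreg₃, q5]
  · simp [hreg₅, hreg₃, q7]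
  · simp [hreg₅, hreg₃, q8]
  · simp [hreg₅, hreg₃, q9]
  · simp [hreg₅, hsum]
  · refine (hA₁₄ j hj).congr (fun i hi => ?_) (fun i hi => ?_) <;>
      rw [harr₅] <;> rintro rfl <;> simp at hi
  · refine (hA₂₄ j hj).congr (fun i hi => ?_) (fun i hi => ?_) <;>
      rw [harr₅] <;> rintro rfl <;> simp at hi
  · rw [harr₅ 17 (by omega) (by omega), harr₄ 17 (by omega)]
    exact hexc
  · rw [harr₅ 10 (by omega) (by omega)]
    exact hlink
  · omega

end

/-! ### Output of the flow, listings of level-intersections, and data of the reversed network -/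

section

open FlowNetwork

/-- Subtract the reversed flow from the capacities of the treatment arcs. -/
def diffLoop : Program :=
  .loop ⟨8, 11⟩ (block [.sub 11 11 8, .load 17 2 11, .load 18 6 11, .sub 17 17 18, .store 8 11 17])

theorem wp_diffLoop {W : ℤ} {σ : Memory} (h8 : σ.reg 8 = 1) {N : ℤ} (h11 : σ.reg 11 = N)
    (hN : 0 ≤ N) (hNW : N ≤ W) (h2 : ∀ j, 0 ≤ j → j < N → |σ.arr 2 j| ≤ W)
    (h6 : ∀ j, 0 ≤ j → j < N → |σ.arr 6 j| ≤ W)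
    (hd : ∀ j, 0 ≤ j → j < N → |σ.arr 2 j - σ.arr 6 j| ≤ W) :
    WP W diffLoop σ fun σ' t =>
      (∀ j, 0 ≤ j → j < N → σ'.arr 8 j = σ.arr 2 j - σ.arr 6 j) ∧ t ≤ 10 * N.toNat + 1 := by
  refine WP.mono (WP.loop (fun φ σ₁ => 0 ≤ σ₁.reg 11 ∧ σ₁.reg 11 ≤ N ∧
    φ = 10 * (σ₁.reg 11).toNat ∧ ∀ j, σ₁.reg 11 ≤ j → j < N → σ₁.arr 8 j = σ.arr 2 j - σ.arr 6 j)
    (10 * N.toNat) ?_ ?_) ?_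
  · rw [h11]
    exact ⟨hN, le_rfl, rfl, fun j h1 h2 => by omega⟩
  · rintro φ σ₁ hf ⟨g1, g2, rfl, hi⟩ hb
    have e8 : σ₁.reg 8 = 1 := (hf.reg 8 (by decide)).trans h8
    have e2 : σ₁.arr 2 = σ.arr 2 := hf.arr 2 (by decide)
    have e6 : σ₁.arr 6 = σ.arr 6 := hf.arr 6 (by decide)
    simp only [e8] at hb
    obtain ⟨v, hv⟩ : ∃ v, σ₁.reg 11 = v + 1 := ⟨σ₁.reg 11 - 1, by ring⟩
    rw [hv] at g1 g2 hb hi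
    refine WP.sub ?_ (WP.load ?_ (WP.load ?_ (WP.sub ?_ (WP.store ?_ (WP.nil
      ⟨10 * v.toNat, ?_, by omega⟩)))))
    · simp [hv, e8, abs_le]; omega
    · simpa [hv, e8, e2] using h2 v (by omega) (by omega)
    · simpa [hv, e8, e6] using h6 v (by omega) (by omega)
    · simpa [hv, e8, e2, e6] using hd v (by omega) (by omega)
    · simpa [hv, e8, e2, e6] using hd v (by omega) (by omega)
    · simp [hv, e8, e2, e6]
      refine ⟨by omega, by omega, fun j j1 j2 => ?_⟩
      rcases eq_or_ne j v with rfl | hne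
      · simp
      · rw [Function.update_of_ne hne]
        exact hi j (by omega) j2
  · rintro σ' t hf ⟨φ', ⟨g1, g2, rfl, hi⟩, hb, ht⟩
    have e8 : σ'.reg 8 = 1 := (hf.reg 8 (by decide)).trans h8
    simp only [e8] at hb
    exact ⟨fun j j1 j2 => hi j (by omega) j2, by omega⟩

/-- Output the flow that corresponds to the reversed flow. -/
def finishProg : Program :=
  .seq (block [.move 11 2]) (.seq diffLoop (.seq (block [.const 21 0, .move 11 3]) (copyLoop 7 9)))

theorem wp_finishProg {W : ℤ} {σ : Memory} (h8 : σ.reg 8 = 1) {m₁ m₂ : ℤ} (h2 : σ.reg 2 = m₁)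
    (h3 : σ.reg 3 = m₂) (hm₁ : 0 ≤ m₁) (hm₂ : 0 ≤ m₂) (hW₁ : m₁ ≤ W) (hW₂ : m₂ ≤ W)
    (b2 : ∀ j, 0 ≤ j → j < m₁ → |σ.arr 2 j| ≤ W) (b6 : ∀ j, 0 ≤ j → j < m₁ → |σ.arr 6 j| ≤ W)
    (bd : ∀ j, 0 ≤ j → j < m₁ → |σ.arr 2 j - σ.arr 6 j| ≤ W)
    (b7 : ∀ j, 0 ≤ j → j < m₂ → |σ.arr 7 j| ≤ W) :
    WP W finishProg σ fun σ' t =>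
      (∀ j, 0 ≤ j → j < m₁ → σ'.arr 8 j = σ.arr 2 j - σ.arr 6 j) ∧
      (∀ j, 0 ≤ j → j < m₂ → σ'.arr 9 j = σ.arr 7 j) ∧
      t ≤ 10 * m₁.toNat + 10 * m₂.toNat + 10 := by
  refine WP.seq (WP.move ?_ (WP.nil ?_))
  · simp [h2, abs_le]; omega
  refine WP.seq (WP.mono (wp_diffLoop (N := m₁) ?_ ?_ hm₁ hW₁ b2 b6 bd) ?_)
  · simp [h8]
  · simp [h2]
  rintro σ₁ t₁ hf₁ ⟨k1, ht₁⟩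
  have e3 : σ₁.reg 3 = m₂ := (hf₁.reg 3 (by decide)).trans (by simp [h3])
  have e8 : σ₁.reg 8 = 1 := (hf₁.reg 8 (by decide)).trans (by simp [h8])
  have e7 : σ₁.arr 7 = σ.arr 7 := (hf₁.arr 7 (by decide)).trans (by simp)
  refine WP.seq (WP.const ?_ (WP.move ?_ (WP.nil ?_)))
  · simp; omega
  · simp [e3, abs_le]; omega
  refine WP.mono (wp_copyLoop (N := m₂) (off := 0) (by decide) ?_ ?_ ?_ hm₂ hW₂ ?_ ?_) ?_
  · simp [e8]
  · simp [e3]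
  · simp
  · intro j j1 j2
    simp [abs_le]; omega
  · intro j j1 j2
    simpa [e7] using b7 j j1 j2
  rintro σ₂ t₂ hf₂ ⟨k2, ht₂⟩
  have e8' : σ₂.arr 8 = σ₁.arr 8 := (hf₂.arr 8 (by decide)).trans (by simp)
  refine ⟨fun j j1 j2 => ?_, fun j j1 j2 => ?_, by omega⟩
  · rw [e8', k1 j j1 j2]
    simp
  · rw [k2 j j1 j2]
    simp [e7]

theorem sum_range_getD {Q : Type} (l : List Q) (d : Q) (f : Q → ℤ) :
    ∑ j ∈ Finset.range l.length, f (l.getD j d) = (l.map f).sum := by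
  induction l with
  | nil => simp
  | cons q l ih =>
    rw [List.length_cons, Finset.sum_range_succ', List.map_cons, List.sum_cons, ← ih, add_comm]
    simp

/-- Pairs that are not listed have capacity `0` and contribute nothing, so sums over array positions
do not depend on the order of the listing. -/
theorem IsListing.sum_eq {Q : Type} [Fintype Q] [DecidableEq Q] {c : Q → ℕ} {l : List Q}
    (hl : IsListing c l) (d : Q) (f : Q → ℤ) (hf : ∀ q, c q = 0 → f q = 0) :
    ∑ j ∈ Finset.range l.length, f (l.getD j d) = ∑ q, f q := by
  rw [sum_range_getD, ← List.sum_toFinset f hl.1]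
  refine Finset.sum_subset (Finset.subset_univ _) fun q _ hq => hf q ?_
  rw [List.mem_toFinset, hl.2] at hq
  omega

/-- Every listed pair contributes at least `1` to the sum of capacities. This is the source of `n +
n'` in the time bound. -/
theorem IsListing.length_le {Q : Type} [Fintype Q] [DecidableEq Q] {c : Q → ℕ} {l : List Q}
    (hl : IsListing c l) : l.length ≤ ∑ q, c q := by
  rw [← List.toFinset_card_of_nodup hl.1, Finset.card_eq_sum_ones]
  refine (Finset.sum_le_sum fun q hq => ?_).trans
    (Finset.sum_le_sum_of_subset (Finset.subset_univ l.toFinset))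
  exact (hl.2 q).1 (List.mem_toFinset.1 hq)

theorem IsListing.getD_inj {Q : Type} {c : Q → ℕ} {l : List Q} (hl : IsListing c l) (d : Q)
    {i j : ℕ} (hi : i < l.length) (hj : j < l.length) (h : l.getD i d = l.getD j d) : i = j := by
  rw [List.getD_eq_getElem _ _ hi, List.getD_eq_getElem _ _ hj] at h
  exact (hl.1.getElem_inj_iff).1 h

theorem IsListing.exists_getD {Q : Type} {c : Q → ℕ} {l : List Q} (hl : IsListing c l) (d : Q)
    {q : Q} (hq : 0 < c q) : ∃ j < l.length, l.getD j d = q := by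
  obtain ⟨j, hj, rfl⟩ := List.getElem_of_mem ((hl.2 q).2 hq)
  exact ⟨j, hj, List.getD_eq_getElem _ _ hj⟩

theorem listArray_map {Q : Type} (l : List Q) (d : Q) (f : Q → ℤ) {j : ℕ} (hj : j < l.length) :
    listArray (l.map f) j = f (l.getD j d) := by
  simp [listArray, hj]

namespace Samples

variable {k : Fin 2 → ℕ} {n n' : ℕ}

/-- Numbering of the nodes. -/
def nodeIndex (k : Fin 2 → ℕ) : Node k → ℤ :=
  Sum.elim (fun i => ((i : ℕ) : ℤ)) (fun i => (k 0 : ℤ) + ((i : ℕ) : ℤ))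

/-- The arc at a position of the concatenation of two lists of pairs of levels. -/
def arcAt (l l' : List (Fin (k 0) × Fin (k 1))) (d : Fin (k 0) × Fin (k 1)) (h : ℤ) : Arc k :=
  if h < l.length then .inl (l.getD h.toNat d) else .inr (l'.getD (h - l.length).toNat d)

theorem arcAt_inl (l l' : List (Fin (k 0) × Fin (k 1))) (d : Fin (k 0) × Fin (k 1)) {j : ℕ}
    (hj : j < l.length) : arcAt l l' d j = .inl (l.getD j d) := by
  rw [arcAt, if_pos (by omega), Int.toNat_natCast]

theorem arcAt_inr (l l' : List (Fin (k 0) × Fin (k 1))) (d : Fin (k 0) × Fin (k 1)) (j : ℕ) :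
    arcAt l l' d (l.length + j) = .inr (l'.getD j d) := by
  rw [arcAt, if_neg (by omega), add_sub_cancel_left, Int.toNat_natCast]

theorem arcAt_cases {P : ℤ → Prop} {l l' : List (Fin (k 0) × Fin (k 1))}
    (h1 : ∀ j < l.length, P j) (h2 : ∀ j < l'.length, P (l.length + j)) (h : ℤ) (h0 : 0 ≤ h)
    (hM : h < l.length + l'.length) : P h := by
  obtain ⟨i, rfl⟩ := Int.eq_ofNat_of_zero_le h0
  rcases lt_or_ge i l.length with hi | hi
  · exact h1 i hi
  · obtain ⟨j, rfl⟩ := Nat.exists_eq_add_of_le hi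
    push_cast
    exact h2 j (by omega)

variable (I : Samples 2 k n n')

theorem levelSize_le (p : Fin 2) (i : Fin (k p)) : I.levelSize p i ≤ n :=
  (Finset.card_filter_le _ _).trans (by simp)

theorem treatCount_le (q : Fin (k 0) × Fin (k 1)) : I.treatCount q ≤ n :=
  (Finset.card_filter_le _ _).trans (by simp)

theorem controlCount_le (q : Fin (k 0) × Fin (k 1)) : I.controlCount q ≤ n' :=
  (Finset.card_filter_le _ _).trans (by simp)

theorem upper_nonneg (a : Arc k) : 0 ≤ I.reversedNetwork.upper a := by
  rcases a with q | q <;> simp [reversedNetwork]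

theorem upper_le (a : Arc k) : I.reversedNetwork.upper a ≤ n + n' := by
  rcases a with q | q
  · have := I.treatCount_le q
    simp only [reversedNetwork, Sum.elim_inl]
    omega
  · have := I.controlCount_le q
    simp only [reversedNetwork, Sum.elim_inr]
    omega

/-- The zero flow of the original network corresponds to saturated treatment arcs, at cost `n`. This
is the bound `U = n` on the Lagrangian and thus on the number of raises. -/
theorem exists_reversed_feasible :
    ∃ y, I.reversedNetwork.IsFeasible y ∧ I.reversedNetwork.totalCost y ≤ ((n : ℤ) : ℝ) := by
  refine ⟨I.unreverseReal fun _ => 0, ?_, ?_⟩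
  · rw [reversed_isFeasible_iff, unreverseReal_unreverseReal]
    exact I.network_isFeasible_zero
  · have h1 := I.totalCost_unreverseReal (I.unreverseReal fun _ => 0)
    rw [unreverseReal_unreverseReal, network_totalCost] at h1
    simp only [Finset.sum_const_zero, neg_zero] at h1
    push_cast
    linarith

theorem sum_supply : ∑ v, I.reversedNetwork.supply v = 0 := by
  simp only [reversedNetwork, Fintype.sum_sum_type, Sum.elim_inl, Sum.elim_inr,
    Finset.sum_neg_distrib, ← Nat.cast_sum, sum_levelSize]
  simp

theorem remaining_zero : I.reversedNetwork.remaining 0 = n := by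
  simp only [FlowNetwork.remaining, FlowNetwork.excess, Pi.zero_apply, Finset.sum_const_zero,
    sub_zero, add_zero]
  rw [Fintype.sum_sum_type]
  simp only [reversedNetwork, Sum.elim_inl, Sum.elim_inr]
  rw [Finset.sum_eq_zero fun i _ => max_eq_right (by omega), zero_add]
  rw [Finset.sum_congr rfl fun i _ => max_eq_left (by omega), ← Nat.cast_sum, sum_levelSize]

end Samples

end

/-! ### The state of the memory after set-up -/

section

open FlowNetwork

theorem IsListing.length_le_card {Q : Type} [Fintype Q] {c : Q → ℕ} {l : List Q}
    (hl : IsListing c l) : l.length ≤ Fintype.card Q :=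
  hl.1.length_le_card

namespace Samples

variable {k : Fin 2 → ℕ} {n n' : ℕ}

/-- The bound on the numbers in the input. -/
def inputBound (k : Fin 2 → ℕ) (n n' : ℕ) : ℤ := ((n + n' + k 0 + k 1 : ℕ) : ℤ)

/-- The graph that the program builds from two lists of pairs of levels. -/
def listedGraph (n n' : ℕ) (l l' : List (Fin (k 0) × Fin (k 1))) (σ : Memory) : Graph :=
  graphOf (k 0 + k 1) (l.length + l'.length) (inputBound k n n') σ

variable (I : Samples 2 k n n') {l l' : List (Fin (k 0) × Fin (k 1))}

theorem three_le_inputBound (I : Samples 2 k n n') (hn : 0 < n) : 3 ≤ inputBound k n n' := by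
  have h0 := (I.treat ⟨0, hn⟩ 0).pos
  have h1 := (I.treat ⟨0, hn⟩ 1).pos
  simp only [inputBound]
  omega

theorem length_add_le (hl : IsListing I.treatCount l) (hl' : IsListing I.controlCount l') :
    l.length + l'.length ≤ n + n' := by
  have h1 := hl.length_le
  have h2 := hl'.length_le
  rw [sum_treatCount] at h1
  rw [sum_controlCount] at h2
  omega

theorem wp_startProg_input {W : ℤ} (hW : 27 * inputBound k n n' ≤ W) (hn : 0 < n)
    (hl : IsListing I.treatCount l) (hl' : IsListing I.controlCount l')
    (d : Fin (k 0) × Fin (k 1)) :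
    WP W startProg (I.input l l') fun σ t =>
      Started (k 0) (k 1) (inputBound k n n') l.length l'.length
        (fun j => ((l.getD j d).1 : ℕ)) (fun j => ((l'.getD j d).1 : ℕ))
        (fun j => ((l.getD j d).2 : ℕ)) (fun j => ((l'.getD j d).2 : ℕ))
        (fun j => I.treatCount (l.getD j d)) (fun j => I.controlCount (l'.getD j d)) σ ∧
      t ≤ 60 * (l.length + l'.length) + 20 * (k 0 + k 1) + 60 := by
  have hlen := I.length_add_le hl hl'
  have hB := I.three_le_inputBound hn
  refine WP.mono (wp_startProg (k₀ := k 0) (k₁ := k 1) hW rfl rfl rfl rfl rfl (fun i => rfl) hB (by omega) (by omega) ?_ ?_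
    (fun j hj => listArray_map l d (fun q => ((q.1 : ℕ) : ℤ)) hj)
    (fun j hj => listArray_map l d (fun q => ((q.2 : ℕ) : ℤ)) hj)
    (fun j hj => listArray_map l d (fun q => (I.treatCount q : ℤ)) hj)
    (fun j hj => listArray_map l' d (fun q => ((q.1 : ℕ) : ℤ)) hj)
    (fun j hj => listArray_map l' d (fun q => ((q.2 : ℕ) : ℤ)) hj)
    (fun j hj => listArray_map l' d (fun q => (I.controlCount q : ℤ)) hj)
    (fun j _ => ?_) (fun j _ => ?_) (fun j _ => ?_) (fun j _ => ?_)
    (fun j => by omega) (fun j => by omega) ?_ (fun j _ => ?_)) ?_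
  · simp only [inputBound]; omega
  · simp only [inputBound]; omega
  · have := (l.getD j d).1.isLt; omega
  · have := (l.getD j d).2.isLt; omega
  · have := (l'.getD j d).1.isLt; omega
  · have := (l'.getD j d).2.isLt; omega
  · rw [hl.sum_eq d (fun q => (I.treatCount q : ℤ)) (fun q h => by simp [h]), ← Nat.cast_sum,
      sum_treatCount]
    simp only [inputBound]; omega
  · have := I.controlCount_le (l'.getD j d)
    simp only [inputBound]; omega
  · rintro σ t - ⟨hs, ht⟩
    exact ⟨hs, by omega⟩

/-- The memory after `startProg`. -/
theorem ready_startProg {W : ℤ} (hW : 27 * inputBound k n n' ≤ W) (hn : 0 < n)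
    (hl : IsListing I.treatCount l) (hl' : IsListing I.controlCount l')
    (d : Fin (k 0) × Fin (k 1)) :
    WP W startProg (I.input l l') fun σ t =>
      Represents I.reversedNetwork (listedGraph n n' l l' σ) (nodeIndex k)
        (residualArc (l.length + l'.length) (arcAt l l' d)) n ∧
      Ready I.reversedNetwork (listedGraph n n' l l' σ) (nodeIndex k)
        (residualArc (l.length + l'.length) (arcAt l l' d)) l.length l'.length σ 0 0 ∧
      t ≤ 60 * (l.length + l'.length) + 20 * (k 0 + k 1) + 60 := by
  have hlen := I.length_add_le hl hl'
  have hB := I.three_le_inputBound hn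
  refine WP.mono (I.wp_startProg_input hW hn hl hl' d) ?_
  rintro σ t hf ⟨hs, ht⟩
  have hdata : ∀ h : ℤ, 0 ≤ h → h < l.length + l'.length →
      ArcData (l.length + l'.length) σ h
        (nodeIndex k (I.reversedNetwork.tail (arcAt l l' d h)))
        (nodeIndex k (I.reversedNetwork.head (arcAt l l' d h)))
        (I.reversedNetwork.cost (arcAt l l' d h)) (I.reversedNetwork.upper (arcAt l l' d h)) := by
    refine arcAt_cases (fun j hj => ?_) fun j hj => ?_
    · rw [arcAt_inl l l' d hj]
      simpa [reversedNetwork, nodeIndex, add_comm] using hs.arc₁ j hj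
    · rw [arcAt_inr l l' d j]
      simpa [reversedNetwork, nodeIndex, add_comm] using hs.arc₂ j hj
  -- At a node of either covariate one of the two sums is empty: numbers below `k 0` belong to the
  -- first covariate and the others to the second. The other sum is the level size.
  have hexc : ∀ v, σ.arr 17 (nodeIndex k v) = I.reversedNetwork.supply v := by
    rintro (i | i)
    · simp only [nodeIndex, reversedNetwork, Sum.elim_inl, ← sum_treatCount_fst, Nat.cast_sum]
      rw [hs.exc,
        hl.sum_eq d (fun q => if ((q.2 : ℕ) : ℤ) + k 0 = i then (I.treatCount q : ℤ) else 0)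
          (fun q h => by simp [h]),
        hl.sum_eq d (fun q => if ((q.1 : ℕ) : ℤ) = i then (I.treatCount q : ℤ) else 0)
          (fun q h => by simp [h]),
        Finset.sum_eq_zero fun q _ => if_neg (by have := i.isLt; omega), zero_sub,
        Finset.sum_filter]
      refine congrArg _ (Finset.sum_congr rfl fun q _ => if_congr ?_ rfl rfl)
      rw [Nat.cast_inj, Fin.val_inj]
    · simp only [nodeIndex, reversedNetwork, Sum.elim_inr, ← sum_treatCount_snd, Nat.cast_sum]
      rw [hs.exc,
        hl.sum_eq d (fun q => if ((q.2 : ℕ) : ℤ) + k 0 = k 0 + (i : ℕ) then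
          (I.treatCount q : ℤ) else 0) (fun q h => by simp [h]),
        hl.sum_eq d (fun q => if ((q.1 : ℕ) : ℤ) = k 0 + (i : ℕ) then (I.treatCount q : ℤ) else 0)
          (fun q h => by simp [h]),
        Finset.sum_eq_zero (s := Finset.univ)
          (f := fun q : Fin (k 0) × Fin (k 1) => ite (((q.1 : ℕ) : ℤ) = k 0 + (i : ℕ)) _ _)
          fun q _ => if_neg (by have := q.1.isLt; omega), sub_zero, Finset.sum_filter]
      refine Finset.sum_congr rfl fun q _ => if_congr ?_ rfl rfl
      rw [add_comm, add_right_inj, Nat.cast_inj, Fin.val_inj]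
  have hsupply : ∀ v, |I.reversedNetwork.supply v| ≤ inputBound k n n' := by
    rintro (i | i)
    · have := I.levelSize_le 0 i
      simp only [reversedNetwork, Sum.elim_inl, inputBound, abs_le]
      omega
    · have := I.levelSize_le 1 i
      simp only [reversedNetwork, Sum.elim_inr, inputBound, abs_le]
      omega
  have hupper : ∀ a, I.reversedNetwork.upper a ≤ inputBound k n n' := fun a => by
    have := I.upper_le a
    simp only [inputBound]
    omega
  have hrem : σ.reg 10 = n := by
    rw [hs.r10, hl.sum_eq d (fun q => (I.treatCount q : ℤ)) (fun q h => by simp [h]),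
      ← Nat.cast_sum, sum_treatCount]
  have hMB : (l.length : ℤ) + l'.length ≤ inputBound k n n' := by
    simp only [inputBound]
    omega
  refine ⟨represents_graphOf ?_ ?_ ?_ ?_ ?_ ?_ hdata hs.linked (by omega) ?_ (by omega) hMB hB
      ?_ ?_ ?_ ?_ (by simpa using I.exists_reversed_feasible),
    ⟨?_, holds_zero hdata hexc ?_ (fun _ => rfl) I.upper_nonneg ?_ hsupply, ?_, ?_, ?_, ?_⟩, ht⟩
  · rintro (i | i) <;> simp only [nodeIndex, Sum.elim_inl, Sum.elim_inr] <;> omega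
  · rintro (i | i) <;> simp only [nodeIndex, Sum.elim_inl, Sum.elim_inr] <;> omega
  · rintro (i | i) (j | j) h <;> simp only [nodeIndex, Sum.elim_inl, Sum.elim_inr] at h
    · exact congrArg Sum.inl (Fin.ext (by omega))
    · omega
    · omega
    · exact congrArg Sum.inr (Fin.ext (by omega))
  · intro i h0 h1
    rcases lt_or_ge i (k 0) with h2 | h2
    · exact ⟨.inl ⟨i.toNat, by omega⟩, by simp [nodeIndex, h0]⟩
    · exact ⟨.inr ⟨(i - k 0).toNat, by omega⟩, by
        simp only [nodeIndex, Sum.elim_inr]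
        omega⟩
  · refine arcAt_cases (fun i hi => arcAt_cases (fun j hj h => ?_) fun j hj h => ?_) fun i hi =>
      arcAt_cases (fun j hj h => ?_) fun j hj h => ?_
    · rw [arcAt_inl _ _ _ hi, arcAt_inl _ _ _ hj, Sum.inl.injEq] at h
      rw [hl.getD_inj d hi hj h]
    · rw [arcAt_inl _ _ _ hi, arcAt_inr] at h
      simp at h
    · rw [arcAt_inl _ _ _ hj, arcAt_inr] at h
      simp at h
    · rw [arcAt_inr, arcAt_inr, Sum.inr.injEq] at h
      rw [hl'.getD_inj d hi hj h]
  · rintro (q | q) hq <;> simp only [reversedNetwork, Sum.elim_inl, Sum.elim_inr] at hq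
    · obtain ⟨j, hj, rfl⟩ := hl.exists_getD d (q := q) (by omega)
      exact ⟨j, by omega, by omega, arcAt_inl _ _ _ hj⟩
    · obtain ⟨j, hj, rfl⟩ := hl'.exists_getD d (q := q) (by omega)
      exact ⟨l.length + j, by omega, by omega, arcAt_inr _ _ _ _⟩
  · simp only [inputBound]; omega
  · rintro (q | q) <;> simp [reversedNetwork]
  · rintro (q | q) <;> simp [reversedNetwork]
  · intro a
    simpa [reversedNetwork] using hupper a
  · simp only [inputBound]; omega
  · exact ⟨hs.r4, hs.r7, hs.r8, hs.r9, rfl, rfl, rfl, rfl, rfl, rfl⟩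
  · intro i
    rw [hf.arr 18 (by decide)]
    rfl
  · rintro (q | q) <;> simp [reversedNetwork]
  · exact ⟨hf.reg 2 (by decide), hf.reg 3 (by decide), hs.r5, by omega, by omega, hMB, rfl⟩
  -- Arrays `6` and `7` are still `0` from the input, which is the residual capacity of the reverse
  -- arcs at the zero flow.
  · refine ⟨fun j h0 h1 => ?_, fun j h0 h1 => ?_⟩
    · rw [hf.arr 6 (by decide), (hdata j h0 (by omega)).cap']
      rfl
    · rw [hf.arr 7 (by decide), add_assoc, (hdata (l.length + j) (by omega) (by omega)).cap']
      rfl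
  · rw [hrem, remaining_zero]
  · rw [hrem]
    simp only [listedGraph, graphOf, inputBound]
    omega

variable {I}

theorem holdsFlow_of_ready {G : Graph} {d : Fin (k 0) × Fin (k 1)} {σ : Memory} {x : Arc k → ℤ}
    {π : Node k → ℤ} (hl : IsListing I.treatCount l) (hl' : IsListing I.controlCount l')
    (hr : Ready I.reversedNetwork G (nodeIndex k)
      (residualArc (l.length + l'.length) (arcAt l l' d)) l.length l'.length σ x π) :
    HoldsFlow l l' σ 6 7 x := by
  -- Arcs that are not listed have capacity `0`, so they carry no flow.
  have hcap : ∀ a, I.reversedNetwork.upper a = 0 → x a = 0 := by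
    intro a ha
    have h1 := hr.holds.slack.cap (a, true)
    have h2 := hr.holds.slack.cap (a, false)
    simp only [resCap, ha] at h1 h2
    simp only [reversedNetwork] at h2
    omega
  have hH := hr.counts.two_mul
  refine ⟨⟨fun j hj => ?_, fun q hq => hcap _ ?_⟩, fun j hj => ?_, fun q hq => hcap _ ?_⟩
  · rw [hr.copied.1 j (by omega) (by omega), hr.holds.cap _ (by omega) (by omega),
      residualArc_add (by omega), arcAt_inl _ _ _ hj, List.getD_eq_getElem _ _ hj]
    simp [resCap, reversedNetwork]
  · rw [hl.2] at hq
    simp only [reversedNetwork, Sum.elim_inl]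
    omega
  · rw [hr.copied.2 j (by omega) (by omega), hr.holds.cap _ (by omega) (by omega), add_assoc,
      residualArc_add (by omega), arcAt_inr, List.getD_eq_getElem _ _ hj]
    simp [resCap, reversedNetwork]
  · rw [hl'.2] at hq
    simp only [reversedNetwork, Sum.elim_inr]
    omega

end Samples

end

/-! ### The complete run and its time bound -/

section

open FlowNetwork

namespace Samples

variable {k : Fin 2 → ℕ} {n n' : ℕ} (I : Samples 2 k n n') {l l' : List (Fin (k 0) × Fin (k 1))}

/-- Each of the two listings has at most `k 0 * k 1` entries, and together they have at most `n +
n'`, so their total is at most twice the minimum. As a sample exists, `k 0 + k 1 ≥ 2`; its logarithm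
is then at least `1 / 2`, so the last term absorbs the number of nodes and the added `1`. -/
theorem size_le (hn : 0 < n) (hl : IsListing I.treatCount l) (hl' : IsListing I.controlCount l') :
    ((2 * (l.length + l'.length) + (k 0 + k 1) + 1 : ℕ) : ℝ) ≤
      4 * (min ((n : ℝ) + n') ((k 0 : ℝ) * k 1) +
        ((k 0 : ℝ) + k 1) * Real.log ((k 0 : ℝ) + k 1)) := by
  have h0 : (1 : ℝ) ≤ k 0 := by exact_mod_cast (I.treat ⟨0, hn⟩ 0).pos
  have h1 : (1 : ℝ) ≤ k 1 := by exact_mod_cast (I.treat ⟨0, hn⟩ 1).pos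
  have h2 : ((l.length : ℝ) + l'.length) ≤ n + n' := by exact_mod_cast I.length_add_le hl hl'
  have h3 : (l.length : ℝ) ≤ (k 0 : ℝ) * k 1 := by
    have := hl.length_le_card
    simp only [Fintype.card_prod, Fintype.card_fin] at this
    exact_mod_cast this
  have h4 : (l'.length : ℝ) ≤ (k 0 : ℝ) * k 1 := by
    have := hl'.length_le_card
    simp only [Fintype.card_prod, Fintype.card_fin] at this
    exact_mod_cast this
  have h5 : ((l.length : ℝ) + l'.length) ≤ 2 * min ((n : ℝ) + n') ((k 0 : ℝ) * k 1) := by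
    rw [mul_min_of_nonneg _ _ (by norm_num : (0 : ℝ) ≤ 2)]
    refine le_min ?_ (by linarith)
    have : (0 : ℝ) ≤ (n : ℝ) + n' := by positivity
    linarith
  have h6 : (1 / 2 : ℝ) ≤ Real.log ((k 0 : ℝ) + k 1) := by
    have := Real.log_two_gt_d9
    have := Real.log_le_log (by norm_num : (0 : ℝ) < 2) (by linarith : (2 : ℝ) ≤ (k 0 : ℝ) + k 1)
    linarith
  have h7 := mul_le_mul_of_nonneg_left h6 (by linarith : (0 : ℝ) ≤ (k 0 : ℝ) + k 1)
  push_cast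
  linarith

theorem size_listedGraph (σ : Memory) : (listedGraph n n' l l' σ).size =
    2 * (l.length + l'.length) + (k 0 + k 1) + 1 := by
  simp only [Graph.size, listedGraph, graphOf]
  omega

/-- The program finds a minimum cost flow by successive shortest paths. -/
theorem exists_program_run {W : ℤ} (hW : 27 * inputBound k n n' ≤ W) (hn : 0 < n)
    (hl : IsListing I.treatCount l) (hl' : IsListing I.controlCount l') :
    ∃ (m : ℕ) (x : ℕ → Arc k → ℤ) (σ : ℕ → Memory) (out : Memory) (t₀ t₂ : ℕ) (t : ℕ → ℕ),
      m ≤ n ∧ Exec W startProg (I.input l l') (σ 0) t₀ ∧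
      (∀ j < m, Test.Holds ⟨8, 10⟩ (σ j) ∧ Exec W bodyProg (σ j) (σ (j + 1)) (t j)) ∧
      ¬ Test.Holds ⟨8, 10⟩ (σ m) ∧ Exec W finishProg (σ m) out t₂ ∧
      t₀ + (∑ j ∈ Finset.range m, (1 + t j) + 1 + t₂) ≤
        240 * ((2 * (l.length + l'.length) + (k 0 + k 1) + 1) * n) ∧
      x 0 = 0 ∧ (∀ j < m, I.reversedNetwork.SSPStep (x j) (x (j + 1))) ∧
      (∀ j ≤ m, HoldsFlow l l' (σ j) 6 7 (x j)) ∧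
      I.reversedNetwork.IsMinCostFlow (fun a => (x m a : ℝ)) ∧
      HoldsFlow l l' out 8 9 (I.unreverse (x m)) := by
  have hlen := I.length_add_le hl hl'
  obtain ⟨σ₀, t₀, he₀, hR, hr₀, ht₀⟩ := I.ready_startProg hW hn hl hl' (I.treatCell ⟨0, hn⟩)
  obtain ⟨m, x, σ, t, hm, hx₀, rfl, hs, hend, hssp, hready, ht⟩ :=
    exists_run hR hW n σ₀ 0 0 hr₀ I.remaining_zero.le
  obtain ⟨hf, π, hr⟩ := hready m le_rfl
  have hflow := holdsFlow_of_ready hl hl' hr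
  have hmin : I.reversedNetwork.IsMinCostFlow (fun a => (x m a : ℝ)) := by
    refine hr.holds.slack.isMinCostFlow (excess_eq_zero I.sum_supply ?_)
    rw [← hr.rem]
    have := hr.mem.r8
    simp only [Test.Holds] at hend
    omega
  have hbound : ∀ a, 0 ≤ x m a ∧ x m a ≤ I.reversedNetwork.upper a ∧
      I.reversedNetwork.upper a ≤ W := by
    intro a
    have h1 := hr.holds.slack.cap (a, true)
    have h2 := hr.holds.slack.cap (a, false)
    have h3 := I.upper_le a
    simp only [resCap] at h1 h2
    simp only [inputBound] at hW
    simp only [reversedNetwork] at h2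
    exact ⟨by omega, by omega, by omega⟩
  have hcap : ∀ j, (h : j < l.length) → (σ m).arr 2 j = I.treatCount l[j] := by
    intro j hj
    rw [hf.arr 2 (by decide), he₀.frame.arr 2 (by decide)]
    exact (listArray_map l l[j] (fun q => (I.treatCount q : ℤ)) hj).trans
      (by rw [List.getD_eq_getElem _ _ hj])
  have hnat : ∀ (r : ℕ) (P : ℤ → Prop), (∀ j < r, P (j : ℕ)) → ∀ j : ℤ, 0 ≤ j → j < r → P j := by
    intro r P hP j j0 j1
    obtain ⟨i, rfl⟩ := Int.eq_ofNat_of_zero_le j0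
    exact hP i (by omega)
  have hlW : ((l.length + l'.length : ℕ) : ℤ) ≤ W := by
    simp only [inputBound] at hW
    omega
  obtain ⟨out, t₂, he₂, h8, h9, ht₂⟩ := wp_finishProg hr.mem.r8 hr.counts.r2 hr.counts.r3
    (by omega) (by omega) (by omega) (by omega)
    (hnat _ (fun j => |(σ m).arr 2 j| ≤ W) fun j hj => by
      rw [hcap j hj]
      have := hbound (.inl l[j])
      simp only [reversedNetwork, Sum.elim_inl] at this
      simp only [abs_le]
      omega)
    (hnat _ (fun j => |(σ m).arr 6 j| ≤ W) fun j hj => by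
      simp only [hflow.1.1 j hj]
      have := hbound (.inl l[j])
      simp only [abs_le]
      omega)
    (hnat _ (fun j => |(σ m).arr 2 j - (σ m).arr 6 j| ≤ W) fun j hj => by
      simp only [hcap j hj, hflow.1.1 j hj]
      have := hbound (.inl l[j])
      simp only [reversedNetwork, Sum.elim_inl] at this
      simp only [abs_le]
      omega)
    (hnat _ (fun j => |(σ m).arr 7 j| ≤ W) fun j hj => by
      simp only [hflow.2.1 j hj]
      have := hbound (.inr l'[j])
      simp only [abs_le]
      omega)
  refine ⟨m, x, σ, out, t₀, t₂, t, hm, he₀, hs, hend, he₂, ?_, hx₀, hssp,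
    fun j hj => ?_, hmin, ⟨fun j hj => ?_, fun q hq => ?_⟩, fun j hj => ?_, fun q hq => ?_⟩
  -- With `S` for the size, raises cost at most `60 * S * n` and iterations at most `101 * S * n`.
  -- Set-up and output need at most `70 * S`, the exit test `1`, and both are absorbed because `n ≥
  -- 1`.
  · rw [size_listedGraph] at ht
    have hlag : I.reversedNetwork.lagrangian 0 0 = 0 := by simp [lagrangian]
    rw [hlag, sub_zero, Int.toNat_natCast, mul_assoc, mul_assoc] at ht
    have hS := Nat.le_mul_of_pos_right (2 * (l.length + l'.length) + (k 0 + k 1) + 1) hn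
    omega
  · obtain ⟨-, π', hr'⟩ := hready j hj
    exact holdsFlow_of_ready hl hl' hr'
  · rw [h8 j (by omega) (by omega), hcap j hj, hflow.1.1 j hj]
    rfl
  · have h1 : x m (.inl q) = 0 := hflow.1.2 q hq
    rw [hl.2] at hq
    simp only [unreverse, Sum.elim_inl]
    omega
  · rw [h9 j (by omega) (by omega), hflow.2.1 j hj]
    rfl
  · exact hflow.2.2 q hq

theorem exists_isListing {Q : Type} [Fintype Q] (c : Q → ℕ) : ∃ l, IsListing c l :=
  ⟨(Finset.univ.filter fun q => 0 < c q).toList, Finset.nodup_toList _, fun q => by simp⟩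

/-- There is an integral minimum cost flow. -/
theorem exists_isMinCostFlow :
    ∃ z : Arc k → ℤ, I.network.IsMinCostFlow fun a => (z a : ℝ) := by
  rcases Nat.eq_zero_or_pos n with rfl | hn
  · exact ⟨0, I.isMinCostFlow_zero⟩
  · obtain ⟨l, hl⟩ := exists_isListing I.treatCount
    obtain ⟨l', hl'⟩ := exists_isListing I.controlCount
    -- Integrality of the optimum is read off from the algorithm: a run with the smallest permitted
    -- word bound yields an integral flow.
    obtain ⟨m, x, -, -, -, -, -, -, -, -, -, -, -, -, -, -, hmin, -⟩ :=
      I.exists_program_run le_rfl hn hl hl'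
    exact ⟨_, I.isMinCostFlow_unreverse hmin⟩

/-- The bound is at least `3`, so the factor `27 = 3 ^ 3` is absorbed by three of its powers. This
explains the exponent `4` of the word size. -/
theorem inputBound_mul_le (I : Samples 2 k n n') (hn : 0 < n) :
    27 * inputBound k n n' ≤ ((n + n' + k 0 + k 1 : ℕ) : ℤ) ^ 4 := by
  have h := I.three_le_inputBound hn
  have h3 : (3 : ℤ) ^ 3 ≤ inputBound k n n' ^ 3 := pow_le_pow_left₀ (by norm_num) h 3
  calc 27 * inputBound k n n' ≤ inputBound k n n' ^ 3 * inputBound k n n' :=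
        mul_le_mul_of_nonneg_right (by linarith) (by linarith)
    _ = _ := (pow_succ _ 3).symm

end Samples

end

end FineBalance

/-! ### The main theorem -/

theorem mainTheorem5 :
    -- The selection problem is a minimum cost flow problem on the level nodes.
    (∀ (k : Fin 2 → ℕ) (n n' : ℕ) (I : Samples 2 k n n'),
      (∀ (S : Finset (Fin n)) (S' : Finset (Fin n')),
        (I.IsFineBalanced 1 S S' ↔
          I.network.IsFeasible (fun a => (I.selectionFlow S S' a : ℝ))) ∧
        I.network.totalCost (fun a => (I.selectionFlow S S' a : ℝ)) = -(S.card : ℝ) ∧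
        (I.IsMaxSelection 1 S S' ↔
          I.network.IsMinCostFlow (fun a => (I.selectionFlow S S' a : ℝ)))) ∧
      (∀ x : Samples.Arc k → ℤ, I.network.IsFeasible (fun a => (x a : ℝ)) →
        ∃ (S : Finset (Fin n)) (S' : Finset (Fin n')), I.selectionFlow S S' = x)) ∧
    -- One program solves it by successive shortest paths within the stated time.
    (∃ (start body finish : Program) (test : Test) (C : ℝ) (w : ℕ),
      ∀ (k : Fin 2 → ℕ) (n n' : ℕ) (I : Samples 2 k n n'), 0 < n →
      ∀ l l' : List (Fin (k 0) × Fin (k 1)),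
        IsListing I.treatCount l → IsListing I.controlCount l' →
        ∃ (m : ℕ) (x : ℕ → Samples.Arc k → ℤ) (σ : ℕ → Memory) (out : Memory) (T : ℕ),
          -- The run of the program, its running time and its word size.
          Exec (((n + n' + k 0 + k 1 : ℕ) : ℤ) ^ w)
            (.seq start (.seq (.loop test body) finish)) (I.input l l') out T ∧
          (T : ℝ) ≤ C * (n * (min ((n : ℝ) + n') ((k 0 : ℝ) * k 1) +
            ((k 0 : ℝ) + k 1) * Real.log ((k 0 : ℝ) + k 1))) ∧
          -- Its main loop performs the iterations of the successive shortest path algorithm.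
          m ≤ n ∧
          (∃ t, Exec (((n + n' + k 0 + k 1 : ℕ) : ℤ) ^ w) start (I.input l l') (σ 0) t) ∧
          (∀ j < m, test.Holds (σ j) ∧
            ∃ t, Exec (((n + n' + k 0 + k 1 : ℕ) : ℤ) ^ w) body (σ j) (σ (j + 1)) t) ∧
          ¬ test.Holds (σ m) ∧
          (∃ t, Exec (((n + n' + k 0 + k 1 : ℕ) : ℤ) ^ w) finish (σ m) out t) ∧
          x 0 = 0 ∧
          (∀ j < m, I.reversedNetwork.SSPStep (x j) (x (j + 1))) ∧
          (∀ j ≤ m, Samples.HoldsFlow l l' (σ j) 6 7 (x j)) ∧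
          -- Its result is a minimum cost flow, that is, the sizes of an optimal selection.
          I.reversedNetwork.IsMinCostFlow (fun a => (x m a : ℝ)) ∧
          I.network.IsMinCostFlow (fun a => (I.unreverse (x m) a : ℝ)) ∧
          Samples.HoldsFlow l l' out 8 9 (I.unreverse (x m)) ∧
          ∃ (S : Finset (Fin n)) (S' : Finset (Fin n')),
            I.IsMaxSelection 1 S S' ∧ I.selectionFlow S S' = I.unreverse (x m)) := by
  -- The constant `960` is `240 * 4`: the factor of the step count times that of `size_le`. The loop
  -- test compares register `8`, which holds `1`, with register `10`, the remaining supply.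
  refine ⟨fun k n n' I => ⟨fun S S' => ⟨I.isFineBalanced_iff S S', I.totalCost_selectionFlow S S', ?_⟩,
      fun x hx => I.exists_selectionFlow_eq hx⟩, startProg, bodyProg, finishProg, ⟨8, 10⟩, 960, 4,
    fun k n n' I hn l l' hl hl' => ?_⟩
  · obtain ⟨z, hz⟩ := I.exists_isMinCostFlow
    exact I.isMaxSelection_iff hz S S'
  · obtain ⟨m, x, σ, out, t₀, t₂, t, hm, he₀, hs, hend, he₂, hT, hx₀, hssp, hflow, hmin, hout⟩ :=
      I.exists_program_run (I.inputBound_mul_le hn) hn hl hl'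
    have hmin' := I.isMinCostFlow_unreverse hmin
    obtain ⟨S, S', hS⟩ := I.exists_selectionFlow_eq hmin'.1
    refine ⟨m, x, σ, out, _, .seq he₀ (.seq (exec_loop_of_seq m σ t hs hend) he₂), ?_, hm,
      ⟨t₀, he₀⟩, fun j hj => ⟨(hs j hj).1, t j, (hs j hj).2⟩, hend, ⟨t₂, he₂⟩, hx₀, hssp, hflow,
      hmin, hmin', hout, S, S', ?_, hS⟩
    · have h1 := mul_le_mul_of_nonneg_right (I.size_le hn hl hl') (Nat.cast_nonneg (α := ℝ) n)
      rw [← Nat.cast_mul] at h1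
      have h2 : ((240 * ((2 * (l.length + l'.length) + (k 0 + k 1) + 1) * n) : ℕ) : ℝ) =
          240 * (((2 * (l.length + l'.length) + (k 0 + k 1) + 1) * n : ℕ) : ℝ) := by
        push_cast
        ring
      have h3 := (Nat.cast_le (α := ℝ)).2 hT
      linarith
    · rw [I.isMaxSelection_iff hmin', hS]
      exact hmin'
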